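/- Consider a connected metric graph with finitely many vertices, $K\ge 1$ infinite leads $e_1,\dots,e_K$ (each a copy of $[0,\infty)$ attached at $x=0$ to one vertex) and $M$ finite edges $e_m$, $K+1\le m\le K+M$, each a copy of $[0,\ell_m]$, $\ell_m>0$, joining two distinct vertices. Let $P=-\partial_x^2$ on $L^2=\bigoplus_{m=1}^{K+M}L^2([0,\ell_m])$ ($\ell_m=\infty$ for the leads), with domain $\mathcal D(P)$ the set of $u=(u_m)$, $u_m\in H^2([0,\ell_m])$, which are continuous at the vertices and satisfy $\sum_{e_m\ni v}\partial_\nu u_m(v)=0$ at every vertex $v$; here $\partial_\nu u_m(0)=-u_m'(0)$ and $\partial_\nu u_m(\ell_m)=u_m'(\ell_m)$. $\mathcal D_{\rm loc}(P)$ is defined in the same way with $H^2_{\rm loc}$. Resonances of $P$ are the poles of the meromorphic continuation of $\mu\mapsto(P-\mu^2)^{-1}:L^2_{\rm comp}\to L^2_{\rm loc}$ from $\operatorname{Im}\mu>0$ to $\mathbb C$. For $1\le k\le K$ the generalized eigenfunction $e^k(\mu)\in\mathcal D_{\rm loc}(P)$ is characterized, for real $\mu\neq 0$ such that $\mu^2$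 is not an eigenvalue of $P$, by $(P-\mu^2)e^k(\mu)=0$ and $e^k_j(\mu,x)=\delta_{jk}e^{-i\mu x}+s_{jk}(\mu)e^{i\mu x}$ on the leads $1\le j\le K$; at the remaining real $\mu\ne0$ it is defined by holomorphic extension in $\mu$. Let $\lambda\in\mathbb R\setminus\{0\}$ be such that $\lambda^2$ is a simple eigenvalue of $P$, with normalized eigenfunction $u$, $\|u\|_{L^2}=1$, and suppose that $\lambda\ell_m\in\pi\mathbb Z$ for every finite edge. Let $a_m$, $K+1\le m\le K+M$, be smooth real functions on an interval $(-T,T)$ with $a_m(0)=0$, put $a_m\equiv0$ on the leads, and let $P(t)$ be the operator defined as above on the same graph with the lengths of the finite edges replaced by $\ell_m(t)=e^{-a_m(t)}\ell_m$. Write $\dot a_m=a_m'(0)$ and $\langle\dot a u,e^k(\lambda)\rangle=\sum_m\dot a_m\int_0^{\ell_m}u_m\,\overline{e^k_m(\lambda)}\,dx$. Then the holomorphic extensions $e^k(\lambda)$ exist, and for every $k$ the boundary terms vanish: $$\sum_v\sum_{e_m\ni v}\tfrac14\dot a_m\Big(3\,\partial_\nu u_m(v)\,\overline{e^k(\lambda,v)}-u(v)\,\overline{\partial_\nu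 e^k_m(\lambda,v)}\Big)=0 .$$ Moreover, there are $t_0\in(0,T)$ and a smooth function $t\mapsto\lambda(t)\in\mathbb C$, $|t|\le t_0$, with $\lambda(0)=\lambda$, such that $\lambda(t)$ is a resonance of $P(t)$ for all $|t|\le t_0$ and $$\operatorname{Im}\ddot\lambda(0)=-\sum_{k=1}^K\big|\lambda\,\langle\dot a u,e^k(\lambda)\rangle\big|^2 .$$ -/

import Mathlib

open MeasureTheory Set Filter Topology
open scoped ContDiff ENNReal ComplexConjugate

noncomputable section

/-- A metric graph with vertex set `V`, infinite leads `L` and finite edges `E`.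
The lead `k` is a copy of `[0, ∞)` attached at `x = 0` to the vertex `base k`; the finite edge `e`
is a copy of `[0, len e]` with `x = 0` at `src e` and `x = len e` at `tgt e`.
There are no loops; parallel edges are allowed. -/
structure QuantumGraph (V L E : Type*) where
  base : L → V
  src : E → V
  tgt : E → V
  src_ne_tgt : ∀ e, src e ≠ tgt e
  len : E → ℝ
  len_pos : ∀ e, 0 < len e

namespace QuantumGraph

/-- Connectedness of the graph. (Leads are attached to exactly one vertex, so it is enough that the
vertices are connected through the finite edges.) -/
def Connected {V L E : Type*} (G : QuantumGraph V L E) : Prop :=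
  (SimpleGraph.fromRel (fun v w : V => ∃ e, G.src e = v ∧ G.tgt e = w)).Connected

/-- The same graph with the lengths changed to `exp (-b e) * len e`. -/
def deform {V L E : Type*} (G : QuantumGraph V L E) (b : E → ℝ) : QuantumGraph V L E where
  base := G.base
  src := G.src
  tgt := G.tgt
  src_ne_tgt := G.src_ne_tgt
  len e := Real.exp (-b e) * G.len e
  len_pos e := mul_pos (Real.exp_pos _) (G.len_pos e)

/-- The interval that coordinatizes a lead or a finite edge. -/
def dom {V L E : Type*} (G : QuantumGraph V L E) : L ⊕ E → Set ℝ
  | .inl _ => Ici 0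
  | .inr e => Icc 0 (G.len e)

/-- The intervals with the leads cut off at distance `R`. -/
def truncDom {V L E : Type*} (G : QuantumGraph V L E) (R : ℝ) : L ⊕ E → Set ℝ
  | .inl _ => Icc 0 R
  | .inr e => Icc 0 (G.len e)

/-! The ends of the edges: `inl k` is the end of the lead `k`, `inr (inl e)` and `inr (inr e)` are
the ends `x = 0` and `x = len e` of the finite edge `e`. A pair of a vertex `v` and an edge
`e_m ∋ v` is the same as an end `p` with `endVertex p = v`. -/

def endVertex {V L E : Type*} (G : QuantumGraph V L E) : L ⊕ (E ⊕ E) → V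
  | .inl k => G.base k
  | .inr (.inl e) => G.src e
  | .inr (.inr e) => G.tgt e

def endEdge {L E : Type*} : L ⊕ (E ⊕ E) → L ⊕ E
  | .inl k => .inl k
  | .inr (.inl e) => .inr e
  | .inr (.inr e) => .inr e

def endPos {V L E : Type*} (G : QuantumGraph V L E) : L ⊕ (E ⊕ E) → ℝ
  | .inl _ => 0
  | .inr (.inl _) => 0
  | .inr (.inr e) => G.len e

def endSign {L E : Type*} : L ⊕ (E ⊕ E) → ℂ
  | .inl _ => -1
  | .inr (.inl _) => -1
  | .inr (.inr _) => 1

/-- The value `u_m(v)` at an end. -/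
def endValue {V L E : Type*} (G : QuantumGraph V L E) (u : L ⊕ E → ℝ → ℂ)
    (p : L ⊕ (E ⊕ E)) : ℂ :=
  u (endEdge p) (G.endPos p)

/-- The outward derivative `∂_ν u_m(v)` at an end: `-u_m'(0)` or `u_m'(ℓ_m)`. -/
def endNormalDeriv {V L E : Type*} (G : QuantumGraph V L E) (u : L ⊕ E → ℝ → ℂ)
    (p : L ⊕ (E ⊕ E)) : ℂ :=
  endSign p * derivWithin (u (endEdge p)) (G.dom (endEdge p)) (G.endPos p)

/-- `u ∈ H²_loc(I)` for a closed interval `I`, with second weak derivative `g`: the function `u` is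
differentiable on `I` (one-sided at the endpoints), and `u'` is the indefinite integral of
`g ∈ L²_loc(I)`. -/
def IsH2Loc (I : Set ℝ) (u g : ℝ → ℂ) : Prop :=
  DifferentiableOn ℝ u I ∧
  (∀ R : ℝ, MemLp g 2 (volume.restrict (I ∩ Icc (-R) R))) ∧
  ∀ x ∈ I, ∀ y ∈ I, derivWithin u I y - derivWithin u I x = ∫ s in x..y, g s

/-- `u ∈ D_loc(P)`, with `P u = -g`: each `u_m` is in `H²_loc` with `u_m'' = g_m`, `u` is
continuous at the vertices, and the outward derivatives sum to zero at every vertex. -/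
def IsDomLoc {V L E : Type*} [DecidableEq V] [Fintype L] [Fintype E] (G : QuantumGraph V L E)
    (u g : L ⊕ E → ℝ → ℂ) : Prop :=
  (∀ m, IsH2Loc (G.dom m) (u m) (g m)) ∧
  (∀ p q, G.endVertex p = G.endVertex q → G.endValue u p = G.endValue u q) ∧
  ∀ v, ∑ p with G.endVertex p = v, G.endNormalDeriv u p = 0

/-- `u ∈ D(P)`, with `P u = -g`: `u ∈ D_loc(P)` and all `u_m`, `u_m'`, `u_m'' = g_m` are in `L²`. -/
def IsDom {V L E : Type*} [DecidableEq V] [Fintype L] [Fintype E] (G : QuantumGraph V L E)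
    (u g : L ⊕ E → ℝ → ℂ) : Prop :=
  G.IsDomLoc u g ∧
  ∀ m, MemLp (u m) 2 (volume.restrict (G.dom m)) ∧
    MemLp (derivWithin (u m) (G.dom m)) 2 (volume.restrict (G.dom m)) ∧
    MemLp (g m) 2 (volume.restrict (G.dom m))

/-- `w ∈ D(P)` and `(P - z) w = f` in `L²`. -/
def ResolventEq {V L E : Type*} [DecidableEq V] [Fintype L] [Fintype E] (G : QuantumGraph V L E)
    (z : ℂ) (w f : L ⊕ E → ℝ → ℂ) : Prop :=
  ∃ g, G.IsDom w g ∧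
    ∀ m, ∀ᵐ x ∂(volume.restrict (G.dom m)), -g m x - z * w m x = f m x

/-- `u ∈ D(P)` and `P u = z u`. -/
def IsEigenvector {V L E : Type*} [DecidableEq V] [Fintype L] [Fintype E]
    (G : QuantumGraph V L E) (z : ℂ) (u : L ⊕ E → ℝ → ℂ) : Prop :=
  G.IsDom u (fun m x => -(z * u m x))

/-- `z ∈ Spec_pp(P)` in the sense that `z` is an eigenvalue of `P`. -/
def IsEigenvalue {V L E : Type*} [DecidableEq V] [Fintype L] [Fintype E]
    (G : QuantumGraph V L E) (z : ℂ) : Prop :=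
  ∃ u, G.IsEigenvector z u ∧ ∃ m, ∃ x ∈ G.dom m, u m x ≠ 0

/-- `z` is a simple eigenvalue of `P`: its eigenspace is one-dimensional. -/
def IsSimpleEigenvalue {V L E : Type*} [DecidableEq V] [Fintype L] [Fintype E]
    (G : QuantumGraph V L E) (z : ℂ) : Prop :=
  G.IsEigenvalue z ∧ ∀ u w, G.IsEigenvector z u → G.IsEigenvector z w →
    (∃ m, ∃ x ∈ G.dom m, u m x ≠ 0) → ∃ c : ℂ, ∀ m, ∀ x ∈ G.dom m, w m x = c * u m x

/-- The Hilbert space `H_R = ⊕_k L²([0, R]) ⊕ ⊕_m L²([0, ℓ_m])`. -/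
abbrev HR {V L E : Type*} [Fintype L] [Fintype E] (G : QuantumGraph V L E) (R : ℝ) : Type _ :=
  PiLp 2 (fun m : L ⊕ E => Lp ℂ 2 (volume.restrict (G.truncDom R m)))

/-- `F : ℂ → 𝓛(H_R)` is a meromorphic continuation to `ℂ` of the cut-off resolvent
`1_{x ≤ R} (P - μ²)⁻¹ 1_{x ≤ R}`, `Im μ > 0`. -/
def IsCutoffResolvent {V L E : Type*} [DecidableEq V] [Fintype L] [Fintype E]
    (G : QuantumGraph V L E) (R : ℝ) (F : ℂ → (G.HR R →L[ℂ] G.HR R)) : Prop :=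
  MeromorphicOn F univ ∧
  ∀ μ : ℂ, 0 < μ.im → ∀ f : G.HR R,
    ∃ w, G.ResolventEq (μ ^ 2) w (fun m => (G.truncDom R m).indicator (f m)) ∧
      ∀ m, (F μ f m : ℝ → ℂ) =ᵐ[volume.restrict (G.truncDom R m)] w m

/-- `ζ` is a resonance of `P`: a pole of the meromorphic continuation of `μ ↦ (P - μ²)⁻¹` from
`Im μ > 0` to `ℂ` as an operator `L²_comp → L²_loc`, that is, a pole of the continuation of
`1_{x ≤ R} (P - μ²)⁻¹ 1_{x ≤ R}` for some `R`. -/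
def IsResonance {V L E : Type*} [DecidableEq V] [Fintype L] [Fintype E]
    (G : QuantumGraph V L E) (ζ : ℂ) : Prop :=
  ∃ R : ℝ, 0 ≤ R ∧ ∃ F : ℂ → (G.HR R →L[ℂ] G.HR R),
    G.IsCutoffResolvent R F ∧ meromorphicOrderAt F ζ < 0

/-- `e ∈ D_loc(P)`, `(P - μ²) e = 0`, and `e_j(x) = δ_{jk} exp(-iμx) + s_j exp(iμx)` on the leads. -/
def IsScatteringSolution {V L E : Type*} [DecidableEq V] [DecidableEq L] [Fintype L] [Fintype E]
    (G : QuantumGraph V L E) (k : L) (μ : ℂ) (e : L ⊕ E → ℝ → ℂ) : Prop :=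
  G.IsDomLoc e (fun m x => -(μ ^ 2 * e m x)) ∧
  ∃ s : L → ℂ, ∀ j, ∀ x : ℝ, 0 ≤ x →
    e (.inl j) x = (if j = k then Complex.exp (-(Complex.I * μ * x)) else 0) +
      s j * Complex.exp (Complex.I * μ * x)

/-- `e` is the generalized eigenfunction `e^k(μ₀)`: the value at `μ₀` of a family `Φ`, holomorphic
near `μ₀`, that for real `μ` with `μ² ∉ Spec_pp(P)` consists of the scattering solutions. (For
real `μ ≠ 0` with `μ² ∉ Spec_pp(P)` the scattering solution is unique; at the exceptional points
the holomorphic extension defines `e^k(μ₀)`.) -/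
def IsGeneralizedEigenfunction {V L E : Type*} [DecidableEq V] [DecidableEq L] [Fintype L]
    [Fintype E] (G : QuantumGraph V L E) (k : L) (μ₀ : ℝ) (e : L ⊕ E → ℝ → ℂ) : Prop :=
  ∃ U : Set ℂ, IsOpen U ∧ (μ₀ : ℂ) ∈ U ∧ ∃ Φ : ℂ → L ⊕ E → ℝ → ℂ,
    (∀ m, ∀ x ∈ G.dom m, DifferentiableOn ℂ (fun μ => Φ μ m x) U) ∧
    (∀ μ : ℝ, (μ : ℂ) ∈ U → ¬ G.IsEigenvalue ((μ : ℂ) ^ 2) → G.IsScatteringSolution k μ (Φ μ)) ∧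
    ∀ m, ∀ x ∈ G.dom m, e m x = Φ μ₀ m x

/-- `⟨c u, e⟩ = ∑_m c_m ∫ u_m conj(e_m)` for edgewise constants `c`. -/
def weightedInner {V L E : Type*} [Fintype L] [Fintype E] (G : QuantumGraph V L E)
    (c : L ⊕ E → ℝ) (u e : L ⊕ E → ℝ → ℂ) : ℂ :=
  ∑ m, (c m : ℂ) * ∫ x in G.dom m, u m x * conj (e m x)

/-- `∑_v ∑_{e_m ∋ v} (1/4) c_m (3 ∂_ν u_m(v) conj(e(v)) - u(v) conj(∂_ν e_m(v)))`. -/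
def boundaryTerm {V L E : Type*} [Fintype V] [DecidableEq V] [Fintype L] [Fintype E]
    (G : QuantumGraph V L E) (c : L ⊕ E → ℝ) (u e : L ⊕ E → ℝ → ℂ) : ℂ :=
  ∑ v, ∑ p with G.endVertex p = v, (1 / 4 : ℂ) * (c (endEdge p) : ℂ) *
    (3 * G.endNormalDeriv u p * conj (G.endValue e p) -
      G.endValue u p * conj (G.endNormalDeriv e p))

end QuantumGraph

/-- The derivatives `ȧ_m` at `t = 0`; the leads are not deformed. -/
def rateAtZero {L E : Type*} (a : E → ℝ → ℝ) : L ⊕ E → ℝ :=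
  Sum.elim (fun _ => 0) (fun e => deriv (a e) 0)

end

set_option linter.unusedSectionVars false

noncomputable section

/-! ### Trigonometric solutions on one edge -/

namespace QuantumGraph

/-! On a finite edge the solutions of `-w'' = μ² w`, `μ ≠ 0`, are `A cos μx + B sin μx`. Hence the
solutions on the graph with outgoing waves on the leads form the kernel of a finite matrix,
`secular`, which sees the lengths only through the phases `μ ℓ_e`. The whole argument is linear
algebra with this matrix.

A kernel vector at `ζ ≠ 0` with a nonzero sine coefficient makes `ζ` a resonance
(`isResonance_of_secular_eq_zero`). To see this, the continued resolvent, cut off to the finite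
edges (`R = 0`), is written down explicitly (`isCutoffResolvent`): a particular solution obtained by
inverting a Volterra operator, entire in `μ`, plus a homogeneous solution whose coefficients come
from the inverse of the secular matrix. That inverse is meromorphic because a flux argument excludes
outgoing solutions for `Im μ > 0`. Without a pole at `ζ` the coefficients would converge there, and
Green's identity against the kernel vector would make every source orthogonal to it, which is false.

If all `λ ℓ_e` lie in `π ℤ`, then kernel vectors at `λ` vanish at the vertices, so by simplicity the
kernel is spanned by the eigenfunction `u = B_e sin λx` (`exists_isEmbedded`). In the boundary terms
the values of `u` vanish, and the two derivative terms of each edge cancel. Moreover the secular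
matrix at `λ` has an explicit left null vector. Dividing its pairing with the matrix by `μ - λ`
yields a rank-one modification that is invertible at `λ` and still solves the scattering problem. So
the `e^k` extend holomorphically to `λ`, and `e^k(λ)` is orthogonal to `u`.

The implicit function theorem, applied to the secular equation normalized against `u`, continues
`(u, λ)` analytically in the length factors `e^{-a_m}` (`exists_outgoing`). Let `y` be the first
derivative of the coefficients. The first-order equations show that the first derivative of `λ(t)`
is real and express the jumps of `y` along the edges. The second-order ones, paired with the left
null vector, give `Im λ̈ = -∑ |y(base k)|²`, the flux that leaves through the leads. Green's
identity between `y` and `e^k(λ)` identifies `λ ⟨ȧu, e^k(λ)⟩` with `-i y(base k)` (`golden_rule`).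
-/

/-- The solution `A cos μx + B sin μx` of `-w'' = μ² w`. -/
def edgeFun (μ A B : ℂ) (x : ℝ) : ℂ :=
  A * Complex.cos (μ * x) + B * Complex.sin (μ * x)

theorem edgeFun_zero (μ A B : ℂ) : edgeFun μ A B 0 = A := by simp [edgeFun]

theorem hasDerivAt_edgeFun (μ A B : ℂ) (x : ℝ) :
    HasDerivAt (edgeFun μ A B) (μ * edgeFun μ B (-A) x) x := by
  have h : HasDerivAt (fun z : ℂ => μ * z) μ (x : ℂ) := by
    simpa using (hasDerivAt_id (x : ℂ)).const_mul μ
  convert! ((h.ccos.const_mul A).add (h.csin.const_mul B)).comp_ofReal using 1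
  simp only [edgeFun]; ring

theorem continuous_edgeFun (μ A B : ℂ) : Continuous (edgeFun μ A B) := by
  unfold edgeFun; fun_prop

/-- The pair `(w, w'/μ)` at `x` arises from `(A, B)` by a matrix of determinant `cos² + sin² = 1`,
also for complex `μ`. -/
theorem edgeFun_sq_add_sq (μ A B : ℂ) (x : ℝ) (hW : edgeFun μ A B x = 0)
    (hY : edgeFun μ B (-A) x = 0) : A = 0 ∧ B = 0 := by
  have hs := Complex.sin_sq_add_cos_sq (μ * x)
  simp only [edgeFun] at hW hY
  constructor
  · linear_combination (-A) * hs + Complex.cos (μ * x) * hW - Complex.sin (μ * x) * hY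
  · linear_combination (-B) * hs + Complex.sin (μ * x) * hW + Complex.cos (μ * x) * hY

/-- For `Im μ > 0` the flux `Im (w' conj w / μ)` of a nonzero solution strictly decreases. -/
theorem flux_lt {μ A B : ℂ} (hμ : 0 < μ.im) (hAB : ¬(A = 0 ∧ B = 0)) {ℓ : ℝ} (hℓ : 0 < ℓ) :
    (edgeFun μ B (-A) ℓ * conj (edgeFun μ A B ℓ)).im < (B * conj A).im := by
  -- With `y = w'/μ` one has `w' = μ y` and `y' = -μ w`, so `(y conj w)' = -μ |w|² + conj μ |y|²`,
  -- whose imaginary part is `-Im μ (|w|² + |y|²)`.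
  have hd : ∀ x : ℝ, HasDerivAt (fun x => (edgeFun μ B (-A) x * conj (edgeFun μ A B x)).im)
      (-(μ.im * (Complex.normSq (edgeFun μ A B x) + Complex.normSq (edgeFun μ B (-A) x)))) x := by
    intro x
    have h1 := (hasDerivAt_edgeFun μ B (-A) x).mul (hasDerivAt_edgeFun μ A B x).star
    have h2 := Complex.imCLM.hasFDerivAt.comp_hasDerivAt x h1
    convert! h2 using 1
    have : edgeFun μ (-A) (-B) x = - edgeFun μ A B x := by simp only [edgeFun]; ring
    rw [this]
    simp [Complex.normSq_apply]
    ring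
  have hanti := strictAnti_of_hasDerivAt_neg hd (fun x => by
    have : 0 < Complex.normSq (edgeFun μ A B x) + Complex.normSq (edgeFun μ B (-A) x) := by
      by_contra hn
      have h1 := Complex.normSq_nonneg (edgeFun μ A B x)
      have h2 := Complex.normSq_nonneg (edgeFun μ B (-A) x)
      exact hAB (edgeFun_sq_add_sq μ A B x (Complex.normSq_eq_zero.1 (by linarith))
        (Complex.normSq_eq_zero.1 (by linarith)))
    nlinarith)
  simpa [edgeFun_zero] using hanti hℓ

/-! ### The secular equation; no outgoing solutions in the upper half-plane -/

section Secular

variable {V L E : Type*} [DecidableEq V] [Fintype L] [Fintype E]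

/-- A function that agrees at the two ends of every finite edge of a connected graph is constant. -/
theorem Connected.eq_of_edges {V L E α : Type*} {G : QuantumGraph V L E} (hG : G.Connected)
    (φ : V → α) (h : ∀ e, φ (G.src e) = φ (G.tgt e)) (v w : V) : φ v = φ w := by
  obtain ⟨p⟩ := hG.preconnected v w
  induction p with
  | nil => rfl
  | cons hadj _ ih =>
    rw [← ih]
    rw [SimpleGraph.fromRel_adj] at hadj
    rcases hadj.2 with ⟨e, rfl, rfl⟩ | ⟨e, rfl, rfl⟩
    · exact h e
    · exact (h e).symm

/-- The phases `μ ℓ_e` of the finite edges. -/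
def phase {V L E : Type*} (G : QuantumGraph V L E) (μ : ℂ) (e : E) : ℂ := μ * G.len e

/-- The secular map. A vector `x` holds the vertex values `x (inl v)` and the coefficients
`x (inr e)` of the solutions `x (inl (src e)) cos μx + x (inr e) sin μx` on the finite edges; its
image holds the defects of continuity at the ends `tgt e`, and `1 / μ` times the sums of outward
derivatives at the vertices, for the phases `θ e = μ ℓ_e` and outgoing waves on the leads. -/
def secular (G : QuantumGraph V L E) (θ : E → ℂ) : (V ⊕ E → ℂ) →ₗ[ℂ] (V ⊕ E → ℂ) where
  toFun x := Sum.elim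
    (fun v => (∑ e, if G.tgt e = v then
        -(x (.inl (G.src e)) * Complex.sin (θ e)) + x (.inr e) * Complex.cos (θ e) else 0)
      - (∑ e, if G.src e = v then x (.inr e) else 0)
      - Complex.I * ∑ j, if G.base j = v then x (.inl (G.base j)) else 0)
    (fun e => x (.inl (G.src e)) * Complex.cos (θ e) + x (.inr e) * Complex.sin (θ e)
      - x (.inl (G.tgt e)))
  map_add' x y := by
    ext (v | e)
    · simp only [Sum.elim_inl, Pi.add_apply, add_mul, neg_add]
      have h1 : ∀ (p : Prop) [Decidable p] (a b : ℂ),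
        (if p then a + b else 0) = (if p then a else 0) + (if p then b else 0) := by
        intro p _ a b; split_ifs <;> simp
      simp only [h1, Finset.sum_add_distrib]
      ring
    · simp only [Sum.elim_inr, Pi.add_apply]; ring
  map_smul' c x := by
    ext (v | e)
    · simp only [Sum.elim_inl, Pi.smul_apply, smul_eq_mul, RingHom.id_apply, mul_sub,
        Finset.mul_sum, mul_ite, mul_zero]
      congr 1
      · congr 1
        exact Finset.sum_congr rfl fun e _ => by split_ifs <;> ring
      · exact Finset.sum_congr rfl fun e _ => by split_ifs <;> ring
    · simp only [Sum.elim_inr, Pi.smul_apply, smul_eq_mul, RingHom.id_apply]; ring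

theorem secular_inl (G : QuantumGraph V L E) (θ : E → ℂ) (x : V ⊕ E → ℂ) (v : V) :
    G.secular θ x (.inl v) = (∑ e, if G.tgt e = v then
        -(x (.inl (G.src e)) * Complex.sin (θ e)) + x (.inr e) * Complex.cos (θ e) else 0)
      - (∑ e, if G.src e = v then x (.inr e) else 0)
      - Complex.I * ∑ j, if G.base j = v then x (.inl (G.base j)) else 0 := rfl

theorem secular_inr (G : QuantumGraph V L E) (θ : E → ℂ) (x : V ⊕ E → ℂ) (e : E) :
    G.secular θ x (.inr e) =
      x (.inl (G.src e)) * Complex.cos (θ e) + x (.inr e) * Complex.sin (θ e)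
        - x (.inl (G.tgt e)) := rfl

variable [Fintype V]

/-- Discrete Green identity: a sum over vertices of contributions of incident edges is a sum over
edges. All flux and orthogonality arguments below test the vertex conditions in this way, with
different `y`. -/
theorem sum_mul_secular_inl (G : QuantumGraph V L E) (θ : E → ℂ) (x : V ⊕ E → ℂ) (y : V → ℂ) :
    ∑ v, y v * G.secular θ x (.inl v) =
      ∑ e, (y (G.tgt e) * (-(x (.inl (G.src e)) * Complex.sin (θ e)) +
        x (.inr e) * Complex.cos (θ e)) - y (G.src e) * x (.inr e))
      - Complex.I * ∑ j, y (G.base j) * x (.inl (G.base j)) := by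
  simp only [secular_inl, mul_sub, Finset.mul_sum, mul_ite, mul_zero, Finset.sum_sub_distrib]
  congr 1
  · congr 1
    · rw [Finset.sum_comm]; simp
    · rw [Finset.sum_comm]; simp
  · rw [Finset.sum_comm]
    simp only [Finset.sum_ite_eq, Finset.mem_univ, if_true]
    exact Finset.sum_congr rfl fun j _ => by ring

/-- There are no outgoing solutions for `Im μ > 0`. -/
theorem eq_zero_of_secular_eq_zero [Nonempty L] {G : QuantumGraph V L E} (hG : G.Connected)
    {μ : ℂ} (hμ : 0 < μ.im) {x : V ⊕ E → ℂ} (hx : G.secular (G.phase μ) x = 0) : x = 0 := by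
  have hcont : ∀ e, x (.inl (G.tgt e)) =
      edgeFun μ (x (.inl (G.src e))) (x (.inr e)) (G.len e) := fun e => by
    have := congrFun hx (.inr e)
    rw [secular_inr, Pi.zero_apply, sub_eq_zero] at this
    exact this.symm
  -- Testing with the conjugate vertex values and taking imaginary parts balances the flux lost on
  -- the edges against the flux into the leads. Both are nonnegative, so both vanish.
  have hsum := G.sum_mul_secular_inl (G.phase μ) x (fun v => conj (x (.inl v)))
  simp only [hx, Pi.zero_apply, mul_zero, Finset.sum_const_zero] at hsum
  have him : ∑ e, ((x (.inr e) * conj (x (.inl (G.src e)))).im -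
      (edgeFun μ (x (.inr e)) (-x (.inl (G.src e))) (G.len e) *
        conj (edgeFun μ (x (.inl (G.src e))) (x (.inr e)) (G.len e))).im) +
      ∑ j, Complex.normSq (x (.inl (G.base j))) = 0 := by
    have := congrArg Complex.im hsum
    simp only [Complex.zero_im, Complex.sub_im, Complex.im_sum, Complex.mul_im, Complex.I_re,
      Complex.I_im, Complex.re_sum, zero_mul, one_mul, zero_add] at this
    rw [eq_comm, sub_eq_zero] at this
    have h2 : ∑ j, Complex.normSq (x (.inl (G.base j))) =
      ∑ j, (conj (x (.inl (G.base j))) * x (.inl (G.base j))).re :=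
      Finset.sum_congr rfl fun j _ => by simp [Complex.normSq_apply]
    rw [h2, ← this, ← Finset.sum_add_distrib]
    refine Finset.sum_eq_zero fun e _ => ?_
    rw [← hcont]
    simp only [edgeFun, phase, Complex.mul_im, Complex.mul_re, Complex.conj_re, Complex.conj_im,
      Complex.add_re, Complex.add_im, Complex.neg_re, Complex.neg_im]
    ring
  have hnn : ∀ e, 0 ≤ (x (.inr e) * conj (x (.inl (G.src e)))).im -
      (edgeFun μ (x (.inr e)) (-x (.inl (G.src e))) (G.len e) *
        conj (edgeFun μ (x (.inl (G.src e))) (x (.inr e)) (G.len e))).im := fun e => by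
    by_cases h : x (.inl (G.src e)) = 0 ∧ x (.inr e) = 0
    · simp [h.1, h.2, edgeFun]
    · exact (sub_pos.2 (flux_lt hμ h (G.len_pos e))).le
  have hj : ∀ j, x (.inl (G.base j)) = 0 := by
    have h1 := Finset.sum_nonneg fun e (_ : e ∈ Finset.univ) => hnn e
    have h2 := Finset.sum_nonneg fun j (_ : j ∈ Finset.univ) =>
      Complex.normSq_nonneg (x (.inl (G.base j)))
    have h3 : ∑ j, Complex.normSq (x (.inl (G.base j))) = 0 := by linarith
    intro j
    exact Complex.normSq_eq_zero.1 ((Finset.sum_eq_zero_iff_of_nonneg fun j _ =>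
      Complex.normSq_nonneg _).1 h3 j (Finset.mem_univ j))
  have he : ∀ e, x (.inl (G.src e)) = 0 ∧ x (.inr e) = 0 := by
    simp only [hj, Complex.normSq_zero, Finset.sum_const_zero, add_zero] at him
    intro e
    by_contra h
    have := (Finset.sum_eq_zero_iff_of_nonneg fun e _ => hnn e).1 him e (Finset.mem_univ e)
    exact (sub_pos.2 (flux_lt hμ h (G.len_pos e))).ne' this
  -- All edge functions vanish, so vertex values agree along edges; a vertex that carries a lead
  -- supplies the value `0`. This also covers a graph without finite edges.
  have hv : ∀ v, x (.inl v) = 0 := fun v => by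
    rw [← hj (Classical.arbitrary L)]
    refine hG.eq_of_edges (fun v => x (.inl v)) (fun e => ?_) _ _
    simp [hcont, he, edgeFun]
  ext (v | e)
  · exact hv v
  · exact (he e).2

end Secular

/-! ### The Volterra operator and the inverse of `1 + μ² J²` -/

section Volterra

/-- `L²([0, ℓ])`. -/
abbrev L2 (ℓ : ℝ) : Type := Lp ℂ 2 (volume.restrict (Icc 0 ℓ))

/-- The primitive vanishing at `0`. -/
def prim (f : ℝ → ℂ) (x : ℝ) : ℂ := ∫ t in Ioc 0 x, f t

theorem prim_eq_intervalIntegral (f : ℝ → ℂ) {x : ℝ} (hx : 0 ≤ x) :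
    prim f x = ∫ t in (0 : ℝ)..x, f t := by
  rw [prim, intervalIntegral.integral_of_le hx]

theorem L2.integrableOn {ℓ : ℝ} (f : L2 ℓ) : IntegrableOn f (Icc 0 ℓ) :=
  (Lp.memLp f).integrable one_le_two

theorem continuousOn_prim {f : ℝ → ℂ} {ℓ : ℝ} (hf : IntegrableOn f (Icc 0 ℓ)) :
    ContinuousOn (prim f) (Icc 0 ℓ) :=
  intervalIntegral.continuousOn_primitive hf

theorem memLp_of_continuousOn {f : ℝ → ℂ} {ℓ : ℝ} (hf : ContinuousOn f (Icc 0 ℓ)) :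
    MemLp f 2 (volume.restrict (Icc 0 ℓ)) :=
  let ⟨C, hC⟩ := isCompact_Icc.exists_bound_of_continuousOn hf
  MemLp.of_bound (hf.aestronglyMeasurable measurableSet_Icc) C
    ((ae_restrict_iff' measurableSet_Icc).2 (ae_of_all _ hC))

theorem prim_congr {f g : ℝ → ℂ} {ℓ x : ℝ} (h : f =ᵐ[volume.restrict (Icc 0 ℓ)] g)
    (hx : x ∈ Icc 0 ℓ) : prim f x = prim g x :=
  integral_congr_ae (ae_restrict_of_ae_restrict_of_subset
    (Ioc_subset_Icc_self.trans (Icc_subset_Icc_right hx.2)) h)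

/-- `∫₀^ℓ |f|`. -/
def l1Norm {ℓ : ℝ} (f : L2 ℓ) : ℝ := ∫ t in Icc 0 ℓ, ‖f t‖

theorem l1Norm_le {ℓ : ℝ} (f : L2 ℓ) :
    l1Norm f ≤ ((volume (Icc 0 ℓ)) ^ (1 / 2 : ℝ)).toReal * ‖f‖ := by
  have h := eLpNorm_le_eLpNorm_mul_rpow_measure_univ (μ := volume.restrict (Icc 0 ℓ))
    (p := 1) (q := 2) one_le_two (Lp.aestronglyMeasurable f)
  have h1 : l1Norm f = (eLpNorm f 1 (volume.restrict (Icc 0 ℓ))).toReal := by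
    rw [l1Norm, integral_norm_eq_lintegral_enorm (Lp.aestronglyMeasurable f),
      eLpNorm_one_eq_lintegral_enorm]
  rw [h1, Lp.norm_def, mul_comm, ← ENNReal.toReal_mul]
  refine ENNReal.toReal_mono (ENNReal.mul_ne_top (Lp.eLpNorm_ne_top f) ?_) ?_
  · exact ENNReal.rpow_ne_top_of_nonneg (by norm_num) (by simp)
  · convert! h using 3
    · simp
    · norm_num

theorem norm_prim_le {ℓ : ℝ} (f : L2 ℓ) {x : ℝ} (hx : x ∈ Icc 0 ℓ) : ‖prim f x‖ ≤ l1Norm f :=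
  (norm_integral_le_integral_norm _).trans
    (setIntegral_mono_set f.integrableOn.norm (ae_of_all _ fun _ => norm_nonneg _)
      (Ioc_subset_Icc_self.trans (Icc_subset_Icc_right hx.2)).eventuallyLE)

theorem prim_add {f g : ℝ → ℂ} {ℓ x : ℝ} (hf : IntegrableOn f (Icc 0 ℓ))
    (hg : IntegrableOn g (Icc 0 ℓ)) (hx : x ∈ Icc 0 ℓ) :
    prim (f + g) x = prim f x + prim g x := by
  have hs : Ioc 0 x ⊆ Icc 0 ℓ := Ioc_subset_Icc_self.trans (Icc_subset_Icc_right hx.2)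
  exact integral_add (hf.mono_set hs) (hg.mono_set hs)

theorem prim_smul (c : ℂ) (f : ℝ → ℂ) (x : ℝ) : prim (c • f) x = c * prim f x :=
  integral_const_mul c f

/-- The operator `f ↦ ∫₀^x f` on `L²([0, ℓ])`. -/
def volterra (ℓ : ℝ) : L2 ℓ →L[ℂ] L2 ℓ :=
  LinearMap.mkContinuous
    { toFun := fun f => (memLp_of_continuousOn (continuousOn_prim f.integrableOn)).toLp
      map_add' := fun f g => by
        rw [← MemLp.toLp_add, MemLp.toLp_eq_toLp_iff]
        refine (ae_restrict_iff' measurableSet_Icc).2 (ae_of_all _ fun x hx => ?_)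
        rw [Pi.add_apply, ← prim_add f.integrableOn g.integrableOn hx]
        exact prim_congr (Lp.coeFn_add f g) hx
      map_smul' := fun c f => by
        rw [RingHom.id_apply, ← MemLp.toLp_const_smul, MemLp.toLp_eq_toLp_iff]
        refine (ae_restrict_iff' measurableSet_Icc).2 (ae_of_all _ fun x hx => ?_)
        rw [Pi.smul_apply, smul_eq_mul, ← prim_smul]
        exact prim_congr (Lp.coeFn_smul c f) hx }
    (((volume (Icc 0 ℓ)) ^ (1 / 2 : ℝ)).toReal * ((volume (Icc 0 ℓ)) ^ (1 / 2 : ℝ)).toReal)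
    (fun f => by
      have hm : MemLp (prim f) 2 (volume.restrict (Icc 0 ℓ)) :=
        memLp_of_continuousOn (continuousOn_prim f.integrableOn)
      have h := Lp.norm_le_of_ae_bound (f := hm.toLp)
         (C := l1Norm f) (integral_nonneg fun _ => norm_nonneg _) (by
          filter_upwards [hm.coeFn_toLp, ae_restrict_mem measurableSet_Icc] with x hx hx'
          rw [hx]
          exact norm_prim_le f hx')
      refine h.trans ?_
      rw [mul_assoc]
      convert! mul_le_mul_of_nonneg_left (l1Norm_le f) ENNReal.toReal_nonneg using 1
      congr 1
      simp [measureUnivNNReal, ENNReal.coe_toNNReal_eq_toReal, ← ENNReal.toReal_rpow])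

theorem coeFn_volterra {ℓ : ℝ} (f : L2 ℓ) :
    volterra ℓ f =ᵐ[volume.restrict (Icc 0 ℓ)] prim f :=
  MemLp.coeFn_toLp (memLp_of_continuousOn (continuousOn_prim f.integrableOn))

theorem volterra_toLp {ℓ : ℝ} {f g : ℝ → ℂ} (hf : ContinuousOn f (Icc 0 ℓ))
    (hg : ContinuousOn g (Icc 0 ℓ)) (h : ∀ x ∈ Icc 0 ℓ, prim f x = g x) :
    volterra ℓ (memLp_of_continuousOn hf).toLp = (memLp_of_continuousOn hg).toLp := by
  refine Lp.ext ?_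
  filter_upwards [coeFn_volterra (memLp_of_continuousOn hf).toLp,
    (memLp_of_continuousOn hg).coeFn_toLp, ae_restrict_mem measurableSet_Icc] with x h1 h2 hx
  rw [h1, h2, ← h x hx]
  exact prim_congr (memLp_of_continuousOn hf).coeFn_toLp hx

/-- Iterated integration produces the factorial. The power is `n + 1` because the first application
only turns the `L¹` norm into a uniform bound. -/
theorem norm_volterra_pow_apply_le {ℓ : ℝ} (f : L2 ℓ) (n : ℕ) :
    ∀ᵐ x ∂(volume.restrict (Icc 0 ℓ)),
      ‖(volterra ℓ ^ (n + 1)) f x‖ ≤ l1Norm f * (x ^ n / n.factorial) := by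
  induction n with
  | zero =>
    filter_upwards [coeFn_volterra f, ae_restrict_mem measurableSet_Icc] with x hx hx'
    simpa [hx] using norm_prim_le f hx'
  | succ n ih =>
    rw [pow_succ']
    filter_upwards [coeFn_volterra ((volterra ℓ ^ (n + 1)) f),
      ae_restrict_mem measurableSet_Icc] with x hx hx'
    rw [mul_apply_eq_comp, hx, prim_eq_intervalIntegral _ hx'.1]
    have hs : Ioc 0 x ⊆ Icc 0 ℓ := Ioc_subset_Icc_self.trans (Icc_subset_Icc_right hx'.2)
    have h := intervalIntegral.norm_integral_le_of_norm_le (μ := volume) hx'.1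
      (f := ((volterra ℓ ^ (n + 1)) f : ℝ → ℂ))
      (g := fun t => l1Norm f * (t ^ n / n.factorial))
      (by
        rw [← ae_restrict_iff' measurableSet_Ioc]
        exact ae_restrict_of_ae_restrict_of_subset hs ih)
      (by apply Continuous.intervalIntegrable; fun_prop)
    refine h.trans (le_of_eq ?_)
    rw [intervalIntegral.integral_const_mul, intervalIntegral.integral_div, integral_pow,
      Nat.factorial_succ]
    push_cast
    field_simp
    simp

theorem norm_volterra_pow_le {ℓ : ℝ} (hℓ : 0 ≤ ℓ) :
    ∃ C : ℝ, ∀ n : ℕ, ‖volterra ℓ ^ (n + 1)‖ ≤ C * (ℓ ^ n / n.factorial) := by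
  refine ⟨(volume (Icc 0 ℓ)).toReal ^ (1 / 2 : ℝ) *
    ((volume (Icc 0 ℓ)) ^ (1 / 2 : ℝ)).toReal, fun n => ?_⟩
  refine ContinuousLinearMap.opNorm_le_bound _ (by positivity) fun f => ?_
  have hN : 0 ≤ l1Norm f := integral_nonneg fun _ => norm_nonneg _
  have h : ‖(volterra ℓ ^ (n + 1)) f‖ ≤ _ :=
    Lp.norm_le_of_ae_bound (C := l1Norm f * (ℓ ^ n / n.factorial)) (by positivity) (by
      filter_upwards [norm_volterra_pow_apply_le f n, ae_restrict_mem measurableSet_Icc]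
        with x hx hx'
      refine hx.trans ?_
      have := hx'.1
      have := hx'.2
      gcongr)
  refine h.trans ?_
  have h2 := l1Norm_le f
  have h3 : ((measureUnivNNReal (volume.restrict (Icc 0 ℓ)) : ℝ)) = (volume (Icc 0 ℓ)).toReal := by
    simp [measureUnivNNReal, ENNReal.coe_toNNReal_eq_toReal]
  simp only [h3]
  calc _ ≤ (volume (Icc 0 ℓ)).toReal ^ (2 : ℝ≥0∞).toReal⁻¹ *
        ((((volume (Icc 0 ℓ)) ^ (1 / 2 : ℝ)).toReal * ‖f‖) * (ℓ ^ n / n.factorial)) := by gcongr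
    _ = _ := by norm_num; ring

/-- The Volterra operator is quasinilpotent: some power of `T = w J` has norm below `1`. Then `1 -
T^(n+1)` is invertible, and `1 - T` is one of its commuting factors. -/
theorem isUnit_one_sub_smul_volterra {ℓ : ℝ} (hℓ : 0 ≤ ℓ) (w : ℂ) :
    IsUnit (1 - w • volterra ℓ) := by
  obtain ⟨C, hC⟩ := norm_volterra_pow_le hℓ
  have hlim : Tendsto (fun n : ℕ => (‖w‖ * C) * ((‖w‖ * ℓ) ^ n / n.factorial)) atTop (𝓝 0) := by
    simpa using (FloorSemiring.tendsto_pow_div_factorial_atTop (‖w‖ * ℓ)).const_mul (‖w‖ * C)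
  obtain ⟨n, hn⟩ := (hlim.eventually (gt_mem_nhds one_pos)).exists
  have hlt : ‖(w • volterra ℓ) ^ (n + 1)‖ < 1 := by
    refine lt_of_le_of_lt ?_ hn
    rw [smul_pow, norm_smul, norm_pow]
    refine (mul_le_mul_of_nonneg_left (hC n) (by positivity)).trans (le_of_eq ?_)
    rw [mul_pow, pow_succ]; ring
  have hu := isUnit_one_sub_of_norm_lt_one hlt
  have hcomm : Commute (1 - w • volterra ℓ)
      (∑ i ∈ Finset.range (n + 1), (w • volterra ℓ) ^ i) :=
    (mul_neg_geom_sum _ _).trans (geom_sum_mul_neg _ _).symm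
  rw [← mul_neg_geom_sum] at hu
  exact (hcomm.isUnit_mul_iff.1 hu).1

/-- The operator `1 + μ² J²`, where `J` is the Volterra operator. -/
def volterraHelmholtz (ℓ : ℝ) (μ : ℂ) : L2 ℓ →L[ℂ] L2 ℓ :=
  1 + μ ^ 2 • (volterra ℓ * volterra ℓ)

/-- `1 + μ² J² = (1 - iμJ)(1 + iμJ)`. The operator matters because a solution of `w'' + μ² w = g`
with `w(0) = w'(0) = 0` is `w = J² h` with `(1 + μ² J²) h = g`. -/
theorem isUnit_volterraHelmholtz {ℓ : ℝ} (hℓ : 0 ≤ ℓ) (μ : ℂ) :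
    IsUnit (volterraHelmholtz ℓ μ) := by
  have h : volterraHelmholtz ℓ μ =
      (1 - (Complex.I * μ) • volterra ℓ) * (1 - (-(Complex.I * μ)) • volterra ℓ) := by
    have : -(Complex.I * μ) * (Complex.I * μ) = μ ^ 2 := by
      linear_combination (-μ ^ 2) * Complex.I_sq
    rw [volterraHelmholtz, sub_mul, mul_sub, mul_sub, one_mul, mul_one, one_mul,
      smul_mul_smul_comm, mul_comm (Complex.I * μ) (-_), this, neg_smul]
    abel
  rw [h]
  exact (isUnit_one_sub_smul_volterra hℓ _).mul (isUnit_one_sub_smul_volterra hℓ _)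

/-- The inverse of `1 + μ² J²`. -/
def helmholtzInv (ℓ : ℝ) (μ : ℂ) : L2 ℓ →L[ℂ] L2 ℓ := Ring.inverse (volterraHelmholtz ℓ μ)

theorem volterraHelmholtz_helmholtzInv {ℓ : ℝ} (hℓ : 0 ≤ ℓ) (μ : ℂ) (f : L2 ℓ) :
    volterraHelmholtz ℓ μ (helmholtzInv ℓ μ f) = f := by
  have := Ring.mul_inverse_cancel _ (isUnit_volterraHelmholtz hℓ μ)
  exact congrArg (fun T : L2 ℓ →L[ℂ] L2 ℓ => T f) this

theorem helmholtzInv_volterraHelmholtz {ℓ : ℝ} (hℓ : 0 ≤ ℓ) (μ : ℂ) (f : L2 ℓ) :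
    helmholtzInv ℓ μ (volterraHelmholtz ℓ μ f) = f := by
  have := Ring.inverse_mul_cancel _ (isUnit_volterraHelmholtz hℓ μ)
  exact congrArg (fun T : L2 ℓ →L[ℂ] L2 ℓ => T f) this

theorem differentiable_volterraHelmholtz (ℓ : ℝ) : Differentiable ℂ (volterraHelmholtz ℓ) := by
  unfold volterraHelmholtz
  fun_prop

/-- Invertibility at every `μ` makes the inverse entire, so away from `μ = 0` all poles of the
resolvent come from the secular matrix. -/
theorem differentiable_helmholtzInv {ℓ : ℝ} (hℓ : 0 ≤ ℓ) :
    Differentiable ℂ (helmholtzInv ℓ) := fun μ =>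
  (differentiableAt_inverse (isUnit_volterraHelmholtz hℓ μ)).comp μ
    (differentiable_volterraHelmholtz ℓ μ)

theorem volterraHelmholtz_apply (ℓ : ℝ) (μ : ℂ) (f : L2 ℓ) :
    volterraHelmholtz ℓ μ f = f + μ ^ 2 • volterra ℓ (volterra ℓ f) := rfl

/-- The functional `f ↦ ∫₀^ℓ f` on `L²([0, ℓ])`. -/
def primEnd (ℓ : ℝ) : L2 ℓ →L[ℂ] ℂ :=
  LinearMap.mkContinuous
    { toFun := fun f => prim f ℓ
      map_add' := fun f g => by
        rcases lt_or_ge ℓ 0 with hℓ | hℓ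
        · simp [prim, Ioc_eq_empty (not_lt.2 hℓ.le)]
        · rw [← prim_add f.integrableOn g.integrableOn ⟨hℓ, le_rfl⟩]
          exact prim_congr (Lp.coeFn_add f g) ⟨hℓ, le_rfl⟩
      map_smul' := fun c f => by
        rcases lt_or_ge ℓ 0 with hℓ | hℓ
        · simp [prim, Ioc_eq_empty (not_lt.2 hℓ.le)]
        · rw [RingHom.id_apply, smul_eq_mul, ← prim_smul]
          exact prim_congr (Lp.coeFn_smul c f) ⟨hℓ, le_rfl⟩ }
    ((volume (Icc 0 ℓ)) ^ (1 / 2 : ℝ)).toReal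
    (fun f => by
      rcases lt_or_ge ℓ 0 with hℓ | hℓ
      · simp only [LinearMap.coe_mk, AddHom.coe_mk, prim, Ioc_eq_empty (not_lt.2 hℓ.le),
          Measure.restrict_empty, integral_zero_measure, norm_zero]
        positivity
      · exact (norm_prim_le f ⟨hℓ, le_rfl⟩).trans (l1Norm_le f))

theorem primEnd_apply {ℓ : ℝ} (f : L2 ℓ) : primEnd ℓ f = prim f ℓ := rfl

theorem primEnd_volterra {ℓ : ℝ} (hℓ : 0 ≤ ℓ) (f : L2 ℓ) :
    primEnd ℓ (volterra ℓ f) = prim (prim f) ℓ :=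
  prim_congr (coeFn_volterra f) ⟨hℓ, le_rfl⟩

theorem prim_eq_sub {f F : ℝ → ℂ} (hf : Continuous f) (hF : ∀ x, HasDerivAt F (f x) x) {x : ℝ}
    (hx : 0 ≤ x) : prim f x = F x - F 0 := by
  rw [prim_eq_intervalIntegral f hx]
  exact intervalIntegral.integral_eq_sub_of_hasDerivAt (fun y _ => hF y)
    (hf.intervalIntegrable _ _)

/-- The constant function `1` in `L²([0, ℓ])`. -/
def oneL2 (ℓ : ℝ) : L2 ℓ :=
  (memLp_of_continuousOn (f := fun _ => 1) (ℓ := ℓ) continuousOn_const).toLp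

theorem volterra_oneL2 (ℓ : ℝ) : volterra ℓ (oneL2 ℓ) =
    (memLp_of_continuousOn (f := fun x => (x : ℂ)) (ℓ := ℓ)
      Complex.continuous_ofReal.continuousOn).toLp :=
  volterra_toLp continuousOn_const Complex.continuous_ofReal.continuousOn fun x hx => by
    rw [prim_eq_sub continuous_const (F := fun x => (x : ℂ))
      (fun x => by simpa using (hasDerivAt_id x).ofReal_comp) hx.1]
    simp

/-- This moment and the next two, `ℓ`, `ℓ²/2` and `ℓ³/6`, serve to recover `a` and `b` from two
functionals of `a + b x`. -/
theorem primEnd_oneL2 {ℓ : ℝ} (hℓ : 0 ≤ ℓ) : primEnd ℓ (oneL2 ℓ) = ℓ := by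
  rw [primEnd_apply, oneL2, prim_congr (MemLp.coeFn_toLp _) ⟨hℓ, le_rfl⟩,
    prim_eq_sub continuous_const (F := fun x => (x : ℂ))
      (fun x => by simpa using (hasDerivAt_id x).ofReal_comp) hℓ]
  simp

theorem primEnd_volterra_oneL2 {ℓ : ℝ} (hℓ : 0 ≤ ℓ) :
    primEnd ℓ (volterra ℓ (oneL2 ℓ)) = (ℓ : ℂ) ^ 2 / 2 := by
  rw [volterra_oneL2, primEnd_apply, prim_congr (MemLp.coeFn_toLp _) ⟨hℓ, le_rfl⟩,
    prim_eq_sub Complex.continuous_ofReal (F := fun x => (x : ℂ) ^ 2 / 2)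
      (fun x => by
        convert! (((hasDerivAt_id x).ofReal_comp.pow 2).div_const 2) using 1
        simp) hℓ]
  simp

theorem primEnd_volterra_volterra_oneL2 {ℓ : ℝ} (hℓ : 0 ≤ ℓ) :
    primEnd ℓ (volterra ℓ (volterra ℓ (oneL2 ℓ))) = (ℓ : ℂ) ^ 3 / 6 := by
  have h : volterra ℓ (volterra ℓ (oneL2 ℓ)) =
    (memLp_of_continuousOn (f := fun x => (x : ℂ) ^ 2 / 2) (ℓ := ℓ)
      (by fun_prop)).toLp := by
    rw [volterra_oneL2]
    refine volterra_toLp Complex.continuous_ofReal.continuousOn (by fun_prop) fun x hx => ?_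
    rw [prim_eq_sub Complex.continuous_ofReal (F := fun x => (x : ℂ) ^ 2 / 2)
      (fun x => by
        convert! (((hasDerivAt_id x).ofReal_comp.pow 2).div_const 2) using 1
        simp) hx.1]
    simp
  rw [h, primEnd_apply, prim_congr (MemLp.coeFn_toLp _) ⟨hℓ, le_rfl⟩,
    prim_eq_sub (by fun_prop) (F := fun x => (x : ℂ) ^ 3 / 6)
      (fun x => by
        convert! (((hasDerivAt_id x).ofReal_comp.pow 3).div_const 6) using 1
        simp; ring) hℓ]
  simp

/-- Integrating `w'' = -μ² w` twice gives `w + μ² J² w = w(0) + w'(0) x`. Thus a homogeneous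
solution is `helmholtzInv` applied to an affine function, a form in which holomorphy in `μ` as an
element of `L²` is immediate. -/
theorem volterraHelmholtz_edgeFun {ℓ : ℝ} {μ : ℂ} (hμ : μ ≠ 0) (A B : ℂ) :
    volterraHelmholtz ℓ μ
        (memLp_of_continuousOn (ℓ := ℓ) (continuous_edgeFun μ A B).continuousOn).toLp =
      A • oneL2 ℓ + (μ * B) • volterra ℓ (oneL2 ℓ) := by
  have h1 := volterra_toLp (ℓ := ℓ) (f := edgeFun μ A B)
    (g := fun x => (edgeFun μ (-B) A x + B) / μ)
    (continuous_edgeFun μ A B).continuousOn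
    (((continuous_edgeFun μ (-B) A).add continuous_const).div_const μ).continuousOn
    (fun x hx => by
      rw [prim_eq_sub (continuous_edgeFun μ A B) (F := fun x => edgeFun μ (-B) A x / μ)
        (fun x => by
          convert! (hasDerivAt_edgeFun μ (-B) A x).div_const μ using 1
          rw [neg_neg]; field_simp) hx.1, edgeFun_zero]
      ring)
  have h2 := volterra_toLp (ℓ := ℓ) (f := fun x => (edgeFun μ (-B) A x + B) / μ)
    (g := fun x => ((edgeFun μ (-A) (-B) x + A) / μ + B * x) / μ)
    (((continuous_edgeFun μ (-B) A).add continuous_const).div_const μ).continuousOn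
    (by have := continuous_edgeFun μ (-A) (-B); fun_prop)
    (fun x hx => by
      rw [prim_eq_sub (by have := continuous_edgeFun μ (-B) A; fun_prop)
        (F := fun x => (edgeFun μ (-A) (-B) x / μ + B * x) / μ)
        (fun x => by
          convert! (((hasDerivAt_edgeFun μ (-A) (-B) x).div_const μ).add
            ((hasDerivAt_id x).ofReal_comp.const_mul B)).div_const μ using 1
          rw [neg_neg]; field_simp; simp) hx.1, edgeFun_zero]
      simp; ring)
  rw [volterraHelmholtz_apply, h1, h2, volterra_oneL2, oneL2, ← MemLp.toLp_const_smul,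
    ← MemLp.toLp_const_smul, ← MemLp.toLp_const_smul, ← MemLp.toLp_add, ← MemLp.toLp_add,
    MemLp.toLp_eq_toLp_iff]
  refine ae_of_all _ fun x => ?_
  simp only [Pi.add_apply, Pi.smul_apply, smul_eq_mul, edgeFun]
  field_simp
  ring

theorem helmholtzInv_edge {ℓ : ℝ} (hℓ : 0 ≤ ℓ) {μ : ℂ} (hμ : μ ≠ 0) (A B : ℂ) :
    helmholtzInv ℓ μ (A • oneL2 ℓ + (μ * B) • volterra ℓ (oneL2 ℓ)) =
      (memLp_of_continuousOn (ℓ := ℓ) (continuous_edgeFun μ A B).continuousOn).toLp := by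
  rw [← volterraHelmholtz_edgeFun hμ, helmholtzInv_volterraHelmholtz hℓ]

end Volterra

/-! ### Solutions of the edge equation in `H²_loc` -/

section ODE

variable {V L E : Type*}

theorem uniqueDiffOn_dom (G : QuantumGraph V L E) (m : L ⊕ E) : UniqueDiffOn ℝ (G.dom m) := by
  rcases m with j | e
  · exact uniqueDiffOn_Ici 0
  · exact uniqueDiffOn_Icc (G.len_pos e)

theorem convex_dom (G : QuantumGraph V L E) (m : L ⊕ E) : Convex ℝ (G.dom m) := by
  rcases m with j | e
  · exact convex_Ici 0
  · exact convex_Icc 0 _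

theorem zero_mem_dom (G : QuantumGraph V L E) (m : L ⊕ E) : (0 : ℝ) ∈ G.dom m := by
  rcases m with j | e
  · exact self_mem_Ici
  · exact left_mem_Icc.2 (G.len_pos e).le

theorem len_mem_dom (G : QuantumGraph V L E) (e : E) : G.len e ∈ G.dom (.inr e) :=
  right_mem_Icc.2 (G.len_pos e).le

theorem measurableSet_dom (G : QuantumGraph V L E) (m : L ⊕ E) : MeasurableSet (G.dom m) := by
  rcases m with j | e
  · exact measurableSet_Ici
  · exact measurableSet_Icc

/-- Composing with the retraction extends a continuous function on the interval to the line, so that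
the two-sided fundamental theorem of calculus can be used at endpoints too. -/
theorem exists_retraction_dom (G : QuantumGraph V L E) (m : L ⊕ E) :
    ∃ π : ℝ → ℝ, Continuous π ∧ (∀ s, π s ∈ G.dom m) ∧ ∀ s ∈ G.dom m, π s = s := by
  rcases m with j | e
  · exact ⟨fun s => max 0 s, by fun_prop, fun s => mem_Ici.2 (le_max_left _ _),
      fun s hs => max_eq_right hs⟩
  · refine ⟨fun s => max 0 (min s (G.len e)), by fun_prop, fun s => ⟨le_max_left _ _, ?_⟩,
      fun s hs => ?_⟩
    · exact max_le (G.len_pos e).le (min_le_right _ _)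
    · simp [min_eq_left hs.2, max_eq_right hs.1]

theorem IsH2Loc.hasDerivWithinAt {I : Set ℝ} {u g : ℝ → ℂ} (h : IsH2Loc I u g) {x : ℝ}
    (hx : x ∈ I) : HasDerivWithinAt u (derivWithin u I x) I x :=
  (h.1 x hx).hasDerivWithinAt

theorem isH2Loc_of_hasDerivWithinAt {I : Set ℝ} (hI : UniqueDiffOn ℝ I) {u u' g : ℝ → ℂ}
    (hu : ∀ x ∈ I, HasDerivWithinAt u (u' x) I x)
    (hg : ∀ R : ℝ, MemLp g 2 (volume.restrict (I ∩ Icc (-R) R)))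
    (h : ∀ x ∈ I, ∀ y ∈ I, u' y - u' x = ∫ s in x..y, g s) : IsH2Loc I u g :=
  ⟨fun x hx => (hu x hx).differentiableWithinAt, hg, fun x hx y hy => by
    rw [(hu x hx).derivWithin (hI x hx), (hu y hy).derivWithin (hI y hy), h x hx y hy]⟩

theorem isH2Loc_of_hasDerivAt (G : QuantumGraph V L E) (m : L ⊕ E) {u u' g : ℝ → ℂ}
    (hu : ∀ x, HasDerivAt u (u' x) x) (hu' : ∀ x, HasDerivAt u' (g x) x) (hg : Continuous g) :
    IsH2Loc (G.dom m) u g := by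
  refine isH2Loc_of_hasDerivWithinAt (G.uniqueDiffOn_dom m) (fun x _ => (hu x).hasDerivWithinAt)
    (fun R => ?_) (fun x _ y _ => ?_)
  · have : MemLp g 2 (volume.restrict (Icc (-R) R)) := by
      obtain ⟨C, hC⟩ := isCompact_Icc.exists_bound_of_continuousOn (hg.continuousOn (s := Icc (-R) R))
      exact MemLp.of_bound hg.aestronglyMeasurable C
        ((ae_restrict_iff' measurableSet_Icc).2 (ae_of_all _ hC))
    exact this.mono_measure (Measure.restrict_mono inter_subset_right le_rfl)
  · exact (intervalIntegral.integral_eq_sub_of_hasDerivAt (fun z _ => hu' z)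
      (hg.intervalIntegrable _ _)).symm

/-- Bootstrapping: `u'` is the integral of `-z u`, which is continuous because `u` is
differentiable. -/
theorem hasDerivWithinAt_derivWithin (G : QuantumGraph V L E) {m : L ⊕ E} {u : ℝ → ℂ} {z : ℂ}
    (h : IsH2Loc (G.dom m) u (fun x => -(z * u x))) {x : ℝ} (hx : x ∈ G.dom m) :
    HasDerivWithinAt (derivWithin u (G.dom m)) (-(z * u x)) (G.dom m) x := by
  obtain ⟨π, hπ, hπm, hπe⟩ := G.exists_retraction_dom m
  have hc : Continuous fun s => -(z * u (π s)) := by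
    have : Continuous fun s => u (π s) := h.1.continuousOn.comp_continuous hπ hπm
    exact (this.const_smul z).neg
  have hd : HasDerivAt (fun y => derivWithin u (G.dom m) x + ∫ s in x..y, -(z * u (π s)))
      (-(z * u (π x))) x :=
    (intervalIntegral.integral_hasDerivAt_right (hc.intervalIntegrable _ _)
      (hc.stronglyMeasurableAtFilter _ _) hc.continuousAt).const_add _
  rw [hπe x hx] at hd
  have heq : ∀ y ∈ G.dom m, derivWithin u (G.dom m) y =
      derivWithin u (G.dom m) x + ∫ s in x..y, -(z * u (π s)) := fun y hy => by
    rw [← sub_eq_iff_eq_add', h.2.2 x hx y hy]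
    refine intervalIntegral.integral_congr fun s hs => ?_
    have := (G.convex_dom m).ordConnected.uIcc_subset hx hy hs
    simp only [hπe s this]
  exact hd.hasDerivWithinAt.congr heq (heq x hx)

/-- The solutions of `-u'' = μ² u` on an edge are the functions `A cos μx + B sin μx`. -/
theorem eq_edgeFun (G : QuantumGraph V L E) {m : L ⊕ E} {u : ℝ → ℂ} {μ : ℂ} (hμ : μ ≠ 0)
    (h : IsH2Loc (G.dom m) u (fun x => -(μ ^ 2 * u x))) :
    EqOn u (edgeFun μ (u 0) (derivWithin u (G.dom m) 0 / μ)) (G.dom m) := by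
  set u' := derivWithin u (G.dom m) with hu'
  have hcd : ∀ x : ℝ, HasDerivAt (fun x : ℝ => Complex.cos (μ * x))
      (-Complex.sin (μ * x) * μ) x := fun x => by
    convert! hasDerivAt_edgeFun μ 1 0 x using 1 <;> simp [edgeFun, funext_iff] <;> ring
  have hsd : ∀ x : ℝ, HasDerivAt (fun x : ℝ => Complex.sin (μ * x))
      (Complex.cos (μ * x) * μ) x := fun x => by
    convert! hasDerivAt_edgeFun μ 0 1 x using 1 <;> simp [edgeFun, funext_iff] <;> ring
  have hconst : ∀ F : ℝ → ℂ, (∀ x ∈ G.dom m, HasDerivWithinAt F 0 (G.dom m) x) →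
      ∀ x ∈ G.dom m, F x = F 0 := fun F hF x hx => by
    have := (G.convex_dom m).norm_image_sub_le_of_norm_hasDerivWithin_le (C := 0) hF
      (fun _ _ => by simp) (G.zero_mem_dom m) hx
    simpa [sub_eq_zero] using this
  -- Variation of constants: this quantity and the one in `hQ` are conserved and equal `u(0)` and
  -- `u'(0)/μ`. Rotating back by the angle `μx` recovers `u`.
  have hP := hconst (fun x => u x * Complex.cos (μ * x) - u' x * Complex.sin (μ * x) / μ)
    (fun x hx => by
      convert! ((h.hasDerivWithinAt hx).mul (hcd x).hasDerivWithinAt).sub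
        (((G.hasDerivWithinAt_derivWithin h hx).mul
          (hsd x).hasDerivWithinAt).div_const μ) using 1
      field_simp; ring)
  have hQ := hconst (fun x => u x * Complex.sin (μ * x) + u' x * Complex.cos (μ * x) / μ)
    (fun x hx => by
      convert! ((h.hasDerivWithinAt hx).mul (hsd x).hasDerivWithinAt).add
        (((G.hasDerivWithinAt_derivWithin h hx).mul
          (hcd x).hasDerivWithinAt).div_const μ) using 1
      field_simp; ring)
  intro x hx
  have h1 := hP x hx
  have h2 := hQ x hx
  have hs := Complex.sin_sq_add_cos_sq (μ * x)
  simp only [Complex.ofReal_zero, mul_zero, Complex.cos_zero, Complex.sin_zero, mul_one, zero_div,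
    sub_zero, zero_add] at h1 h2
  simp only [edgeFun]
  rw [← h2, ← h1]
  linear_combination (-(u x)) * hs

theorem derivWithin_of_eqOn_edgeFun (G : QuantumGraph V L E) {m : L ⊕ E} {u : ℝ → ℂ} {μ A B : ℂ}
    (h : EqOn u (edgeFun μ A B) (G.dom m)) {x : ℝ} (hx : x ∈ G.dom m) :
    derivWithin u (G.dom m) x = μ * edgeFun μ B (-A) x := by
  rw [derivWithin_congr h (h hx)]
  exact (hasDerivAt_edgeFun μ A B x).hasDerivWithinAt.derivWithin (G.uniqueDiffOn_dom m x hx)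

theorem isH2Loc_edgeFun (G : QuantumGraph V L E) (m : L ⊕ E) (μ A B : ℂ) :
    IsH2Loc (G.dom m) (edgeFun μ A B) (fun x => -(μ ^ 2 * edgeFun μ A B x)) := by
  refine G.isH2Loc_of_hasDerivAt m (hasDerivAt_edgeFun μ A B) (fun x => ?_)
    (by have := continuous_edgeFun μ A B; fun_prop)
  convert! (hasDerivAt_edgeFun μ B (-A) x).const_mul μ using 1
  simp only [edgeFun]; ring

/-- For real `μ ≠ 0` an `H²` solution on a lead vanishes. -/
theorem eq_zero_of_memLp_lead {μ : ℝ} (hμ : μ ≠ 0) {A B : ℂ}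
    (h : MemLp (edgeFun μ A B) 2 (volume.restrict (Ici 0)))
    (h' : MemLp (fun x => μ * edgeFun μ B (-A) x) 2 (volume.restrict (Ici 0))) :
    A = 0 ∧ B = 0 := by
  have h'' : MemLp (edgeFun μ B (-A)) 2 (volume.restrict (Ici 0)) := by
    have hμ' : (μ : ℂ) ≠ 0 := Complex.ofReal_ne_zero.2 hμ
    convert! h'.const_mul ((μ : ℂ)⁻¹) using 2
    field_simp
  have hi := ((memLp_two_iff_integrable_sq_norm h.1).1 h).add
    ((memLp_two_iff_integrable_sq_norm h''.1).1 h'')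
  -- For real `μ` the matrix from `(A, B)` to `(w, w'/μ)` is a real rotation, so this sum is
  -- constant; a constant is integrable on a half-line only if it is zero.
  have hc : ∀ x : ℝ, ‖edgeFun μ A B x‖ ^ 2 + ‖edgeFun μ B (-A) x‖ ^ 2 =
      Complex.normSq A + Complex.normSq B := fun x => by
    have hs := Real.sin_sq_add_cos_sq (μ * x)
    simp only [← Complex.normSq_eq_norm_sq, edgeFun, ← Complex.ofReal_mul, ← Complex.ofReal_cos,
      ← Complex.ofReal_sin, Complex.normSq_apply, Complex.add_re, Complex.add_im, Complex.mul_re,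
      Complex.mul_im, Complex.ofReal_re, Complex.ofReal_im, Complex.neg_re, Complex.neg_im]
    linear_combination (A.re ^ 2 + A.im ^ 2 + B.re ^ 2 + B.im ^ 2) * hs
  have hi' : IntegrableOn (fun _ : ℝ => Complex.normSq A + Complex.normSq B) (Ici 0) := by
    refine hi.congr (ae_of_all _ fun x => ?_)
    simpa using hc x
  have h0 : Complex.normSq A + Complex.normSq B = 0 := by
    by_contra hne
    have := (integrableOn_const_iff (by simp)).1 hi'
    simp [hne] at this
  have h1 := Complex.normSq_nonneg A
  have h2 := Complex.normSq_nonneg B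
  exact ⟨Complex.normSq_eq_zero.1 (by linarith), Complex.normSq_eq_zero.1 (by linarith)⟩

end ODE

/-! ### Vertex conditions in coordinates -/

section Vertex

variable {V L E : Type*} [DecidableEq V] [Fintype L] [Fintype E]

theorem sum_endNormalDeriv (G : QuantumGraph V L E) (u : L ⊕ E → ℝ → ℂ) (v : V) :
    ∑ p with G.endVertex p = v, G.endNormalDeriv u p =
      (∑ e, if G.tgt e = v then derivWithin (u (.inr e)) (G.dom (.inr e)) (G.len e) else 0)
      - (∑ e, if G.src e = v then derivWithin (u (.inr e)) (G.dom (.inr e)) 0 else 0)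
      - ∑ j, if G.base j = v then derivWithin (u (.inl j)) (G.dom (.inl j)) 0 else 0 := by
  have h : ∀ (p : Prop) [Decidable p] (a : ℂ),
      (if p then -a else 0) = -(if p then a else 0) := by
    intro p _ a; split_ifs <;> simp
  rw [Finset.sum_filter, Fintype.sum_sum_type, Fintype.sum_sum_type]
  simp only [endVertex, endNormalDeriv, endSign, endEdge, endPos, neg_one_mul, one_mul, h,
    Finset.sum_neg_distrib]
  ring

theorem isDomLoc_iff (G : QuantumGraph V L E) (u g : L ⊕ E → ℝ → ℂ) :
    G.IsDomLoc u g ↔ (∀ m, IsH2Loc (G.dom m) (u m) (g m)) ∧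
      (∃ c : V → ℂ, (∀ j, u (.inl j) 0 = c (G.base j)) ∧ (∀ e, u (.inr e) 0 = c (G.src e)) ∧
        ∀ e, u (.inr e) (G.len e) = c (G.tgt e)) ∧
      ∀ v, (∑ e, if G.tgt e = v then derivWithin (u (.inr e)) (G.dom (.inr e)) (G.len e) else 0)
        - (∑ e, if G.src e = v then derivWithin (u (.inr e)) (G.dom (.inr e)) 0 else 0)
        - (∑ j, if G.base j = v then derivWithin (u (.inl j)) (G.dom (.inl j)) 0 else 0) = 0 := by
  simp only [IsDomLoc, sum_endNormalDeriv]
  refine and_congr_right fun _ => and_congr_left fun _ => ⟨fun h => ?_, ?_⟩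
  · have hf : (G.endValue u).FactorsThrough G.endVertex := fun p q hpq => h p q hpq
    -- Vertices at which no edge ends receive the value `0`.
    refine ⟨Function.extend G.endVertex (G.endValue u) 0, fun j => ?_, fun e => ?_, fun e => ?_⟩
    · exact (hf.extend_apply 0 (.inl j)).symm
    · exact (hf.extend_apply 0 (.inr (.inl e))).symm
    · exact (hf.extend_apply 0 (.inr (.inr e))).symm
  · rintro ⟨c, hl, hs, ht⟩ p q hpq
    have : ∀ p, G.endValue u p = c (G.endVertex p) := by
      rintro (j | e | e)
      exacts [hl j, hs e, ht e]
    rw [this, this, hpq]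

/-- The coefficients of a solution of `-u'' = μ² u` on the graph, where `μ κ j` is the derivative
at the end of the lead `j`. -/
theorem exists_coeff_of_isDomLoc (G : QuantumGraph V L E) {u : L ⊕ E → ℝ → ℂ} {μ : ℂ}
    (hμ : μ ≠ 0) (h : G.IsDomLoc u (fun m x => -(μ ^ 2 * u m x))) (κ : L → ℂ)
    (hκ : ∀ j, derivWithin (u (.inl j)) (G.dom (.inl j)) 0 = μ * κ j) :
    ∃ x : V ⊕ E → ℂ, (∀ j, u (.inl j) 0 = x (.inl (G.base j))) ∧
      (∀ e, EqOn (u (.inr e)) (edgeFun μ (x (.inl (G.src e))) (x (.inr e))) (G.dom (.inr e))) ∧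
      (∀ e, G.secular (G.phase μ) x (.inr e) = 0) ∧
      ∀ v, G.secular (G.phase μ) x (.inl v) =
        ∑ j, if G.base j = v then κ j - Complex.I * x (.inl (G.base j)) else 0 := by
  obtain ⟨hH, ⟨c, hl, hs, ht⟩, hk⟩ := (G.isDomLoc_iff u _).1 h
  obtain ⟨D, hD⟩ : ∃ D : E → ℂ, ∀ e, derivWithin (u (.inr e)) (G.dom (.inr e)) 0 = μ * D e :=
    ⟨fun e => derivWithin (u (.inr e)) (G.dom (.inr e)) 0 / μ, fun e => by field_simp⟩
  have hE : ∀ e, EqOn (u (.inr e)) (edgeFun μ (c (G.src e)) (D e)) (G.dom (.inr e)) := fun e => by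
    have := G.eq_edgeFun hμ (hH (.inr e))
    rwa [hs e, hD e, mul_div_cancel_left₀ _ hμ] at this
  refine ⟨Sum.elim c D, hl, hE, fun e => ?_, fun v => ?_⟩
  · rw [secular_inr, sub_eq_zero]
    simp only [Sum.elim_inl, Sum.elim_inr]
    rw [← ht, hE e (G.len_mem_dom e)]
    rfl
  · have h1 : ∀ e, derivWithin (u (.inr e)) (G.dom (.inr e)) (G.len e) =
        μ * (-(c (G.src e) * Complex.sin (G.phase μ e)) + D e * Complex.cos (G.phase μ e)) :=
      fun e => by
        rw [G.derivWithin_of_eqOn_edgeFun (hE e) (G.len_mem_dom e)]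
        simp only [edgeFun, phase]; ring
    have hk' := hk v
    simp only [h1, hκ, hD] at hk'
    simp only [secular_inl, Sum.elim_inl, Sum.elim_inr]
    apply mul_left_cancel₀ hμ
    have h3 : ∀ (p : Prop) [Decidable p] (a b : ℂ),
        (if p then a - b else 0) = (if p then a else 0) - (if p then b else 0) := by
      intro p _ a b; split_ifs <;> simp
    simp only [h3, Finset.sum_sub_distrib, mul_sub, Finset.mul_sum, mul_ite, mul_zero] at hk' ⊢
    linear_combination hk'

end Vertex

/-! ### Solutions with a source on the finite edges -/

section Inhomogeneous

theorem intervalIntegrable_of_integrableOn_Icc {f : ℝ → ℂ} {ℓ x y : ℝ}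
    (hf : IntegrableOn f (Icc 0 ℓ)) (hx : x ∈ Icc 0 ℓ) (hy : y ∈ Icc 0 ℓ) :
    IntervalIntegrable f volume x y :=
  (hf.mono_set ((convex_Icc 0 ℓ).ordConnected.uIcc_subset hx hy)).intervalIntegrable

theorem prim_sub_prim {f : ℝ → ℂ} {ℓ x y : ℝ} (hf : IntegrableOn f (Icc 0 ℓ))
    (hx : x ∈ Icc 0 ℓ) (hy : y ∈ Icc 0 ℓ) : prim f y - prim f x = ∫ s in x..y, f s := by
  have h0 : (0 : ℝ) ∈ Icc 0 ℓ := ⟨le_rfl, hx.1.trans hx.2⟩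
  rw [prim_eq_intervalIntegral f hx.1, prim_eq_intervalIntegral f hy.1]
  exact intervalIntegral.integral_interval_sub_left
    (intervalIntegrable_of_integrableOn_Icc hf h0 hy)
    (intervalIntegrable_of_integrableOn_Icc hf h0 hx)

theorem hasDerivWithinAt_prim {f : ℝ → ℂ} {ℓ x : ℝ} (hf : ContinuousOn f (Icc 0 ℓ))
    (hx : x ∈ Icc 0 ℓ) : HasDerivWithinAt (prim f) (f x) (Icc 0 ℓ) x := by
  have hℓ : 0 ≤ ℓ := hx.1.trans hx.2
  have hc : Continuous fun s => f (max 0 (min s ℓ)) :=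
    hf.comp_continuous (by fun_prop) fun s => ⟨le_max_left _ _, max_le hℓ (min_le_right _ _)⟩
  have he : ∀ s ∈ Icc 0 ℓ, max 0 (min s ℓ) = s := fun s hs => by
    simp [min_eq_left hs.2, max_eq_right hs.1]
  have hd : HasDerivAt (fun y => ∫ s in (0 : ℝ)..y, f (max 0 (min s ℓ)))
      (f (max 0 (min x ℓ))) x :=
    intervalIntegral.integral_hasDerivAt_right (hc.intervalIntegrable _ _)
      (hc.stronglyMeasurableAtFilter _ _) hc.continuousAt
  rw [he x hx] at hd
  have heq : ∀ y ∈ Icc 0 ℓ, prim f y = ∫ s in (0 : ℝ)..y, f (max 0 (min s ℓ)) := fun y hy => by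
    rw [prim_eq_intervalIntegral f hy.1]
    refine intervalIntegral.integral_congr fun s hs => ?_
    have := (convex_Icc 0 ℓ).ordConnected.uIcc_subset ⟨le_rfl, hℓ⟩ hy hs
    simp only [he s this]
  exact hd.hasDerivWithinAt.congr heq (heq x hx)

variable {V L E : Type*}

/-- The function with value `x (inl (base j))` and derivative `μ κ j` at the end of the lead `j`,
and with second derivative `h e - μ² (homogeneous part)` on the finite edges. -/
def graphFun (G : QuantumGraph V L E) (μ : ℂ) (x : V ⊕ E → ℂ) (κ : L → ℂ) (h : E → ℝ → ℂ) :
    L ⊕ E → ℝ → ℂ :=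
  Sum.elim (fun j => edgeFun μ (x (.inl (G.base j))) (κ j))
    (fun e y => prim (prim (h e)) y + edgeFun μ (x (.inl (G.src e))) (x (.inr e)) y)

/-- The second derivative of `graphFun`. -/
def graphFunDeriv2 (G : QuantumGraph V L E) (μ : ℂ) (x : V ⊕ E → ℂ) (κ : L → ℂ)
    (h : E → ℝ → ℂ) : L ⊕ E → ℝ → ℂ :=
  Sum.elim (fun j y => -(μ ^ 2 * edgeFun μ (x (.inl (G.base j))) (κ j) y))
    (fun e y => h e y - μ ^ 2 * edgeFun μ (x (.inl (G.src e))) (x (.inr e)) y)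

theorem hasDerivWithinAt_graphFun_inr (G : QuantumGraph V L E) (μ : ℂ) (x : V ⊕ E → ℂ)
    (κ : L → ℂ) {h : E → ℝ → ℂ} {e : E} (hh : IntegrableOn (h e) (Icc 0 (G.len e))) {y : ℝ}
    (hy : y ∈ G.dom (.inr e)) :
    HasDerivWithinAt (G.graphFun μ x κ h (.inr e))
      (prim (h e) y + μ * edgeFun μ (x (.inr e)) (-x (.inl (G.src e))) y) (G.dom (.inr e)) y :=
  (hasDerivWithinAt_prim (continuousOn_prim hh) hy).add
    (hasDerivAt_edgeFun _ _ _ y).hasDerivWithinAt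

theorem isH2Loc_graphFun (G : QuantumGraph V L E) (μ : ℂ) (x : V ⊕ E → ℂ) (κ : L → ℂ)
    {h : E → ℝ → ℂ} (hh : ∀ e, MemLp (h e) 2 (volume.restrict (Icc 0 (G.len e)))) (m : L ⊕ E) :
    IsH2Loc (G.dom m) (G.graphFun μ x κ h m) (G.graphFunDeriv2 μ x κ h m) := by
  rcases m with j | e
  · exact G.isH2Loc_edgeFun _ μ _ _
  · have hi : IntegrableOn (h e) (Icc 0 (G.len e)) := (hh e).integrable one_le_two
    have hc : Continuous fun y => μ ^ 2 * edgeFun μ (x (.inl (G.src e))) (x (.inr e)) y :=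
      continuous_const.mul (continuous_edgeFun _ _ _)
    refine isH2Loc_of_hasDerivWithinAt (G.uniqueDiffOn_dom _)
      (fun y hy => G.hasDerivWithinAt_graphFun_inr μ x κ hi hy) (fun R => ?_)
      (fun y hy z hz => ?_)
    · have : MemLp (G.graphFunDeriv2 μ x κ h (.inr e)) 2 (volume.restrict (G.dom (.inr e))) :=
        (hh e).sub (memLp_of_continuousOn hc.continuousOn)
      exact this.mono_measure (Measure.restrict_mono inter_subset_left le_rfl)
    · have h2 : ∀ y : ℝ, HasDerivAt
          (fun y => -(μ * edgeFun μ (x (.inr e)) (-x (.inl (G.src e))) y))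
          (μ ^ 2 * edgeFun μ (x (.inl (G.src e))) (x (.inr e)) y) y := fun y => by
        convert! ((hasDerivAt_edgeFun μ (x (.inr e)) (-x (.inl (G.src e))) y).const_mul μ).neg
          using 1
        simp only [edgeFun]; ring
      simp only [graphFunDeriv2, Sum.elim_inr]
      rw [intervalIntegral.integral_sub (intervalIntegrable_of_integrableOn_Icc hi hy hz)
        (hc.intervalIntegrable _ _), ← prim_sub_prim hi hy hz,
        intervalIntegral.integral_eq_sub_of_hasDerivAt (fun w _ => h2 w)
        (hc.intervalIntegrable _ _)]
      ring

variable [DecidableEq V] [Fintype L] [Fintype E]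

/-- `J² h` vanishes to first order at `src e`, so it disturbs the conditions only at `tgt e`: by `J²
h(ℓ)` in the value and `J h(ℓ)` in the derivative. The hypotheses say that the homogeneous part
compensates both. -/
theorem isDomLoc_graphFun (G : QuantumGraph V L E) {μ : ℂ} {x : V ⊕ E → ℂ} {κ : L → ℂ}
    {h : E → ℝ → ℂ} (hh : ∀ e, MemLp (h e) 2 (volume.restrict (Icc 0 (G.len e))))
    (hE : ∀ e, G.secular (G.phase μ) x (.inr e) = -prim (prim (h e)) (G.len e))
    (hV : ∀ v, μ * G.secular (G.phase μ) x (.inl v) =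
      μ * (∑ j, if G.base j = v then κ j - Complex.I * x (.inl (G.base j)) else 0) -
        ∑ e, if G.tgt e = v then prim (h e) (G.len e) else 0) :
    G.IsDomLoc (G.graphFun μ x κ h) (G.graphFunDeriv2 μ x κ h) := by
  have hi : ∀ e, IntegrableOn (h e) (Icc 0 (G.len e)) := fun e => (hh e).integrable one_le_two
  have h0 : ∀ f : ℝ → ℂ, prim f 0 = 0 := fun f => by simp [prim]
  refine (G.isDomLoc_iff _ _).2 ⟨G.isH2Loc_graphFun μ x κ hh, ⟨fun v => x (.inl v), fun j => ?_,
    fun e => ?_, fun e => ?_⟩, fun v => ?_⟩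
  · exact edgeFun_zero _ _ _
  · simp [graphFun, h0, edgeFun_zero]
  · have := hE e
    rw [secular_inr] at this
    simp only [graphFun, Sum.elim_inr, edgeFun]
    rw [phase] at this
    linear_combination this
  · have h1 : ∀ e, ∀ y ∈ G.dom (.inr e),
        derivWithin (G.graphFun μ x κ h (.inr e)) (G.dom (.inr e)) y =
        prim (h e) y + μ * edgeFun μ (x (.inr e)) (-x (.inl (G.src e))) y := fun e y hy =>
      (G.hasDerivWithinAt_graphFun_inr μ x κ (hi e) hy).derivWithin (G.uniqueDiffOn_dom _ y hy)
    have h2 : ∀ j, derivWithin (G.graphFun μ x κ h (.inl j)) (G.dom (.inl j)) 0 = μ * κ j :=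
      fun j => by
        have := G.derivWithin_of_eqOn_edgeFun (m := .inl j) (u := G.graphFun μ x κ h (.inl j))
          (A := x (.inl (G.base j))) (B := κ j) (fun _ _ => rfl) (G.zero_mem_dom _)
        rwa [edgeFun_zero] at this
    have h3 : ∀ e, derivWithin (G.graphFun μ x κ h (.inr e)) (G.dom (.inr e)) (G.len e) =
        prim (h e) (G.len e) + μ * (-(x (.inl (G.src e)) * Complex.sin (G.phase μ e)) +
          x (.inr e) * Complex.cos (G.phase μ e)) := fun e => by
      rw [h1 e _ (G.len_mem_dom e)]
      simp only [edgeFun, phase]; ring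
    have h4 : ∀ e, derivWithin (G.graphFun μ x κ h (.inr e)) (G.dom (.inr e)) 0 =
        μ * x (.inr e) := fun e => by
      rw [h1 e _ (G.zero_mem_dom _), h0, edgeFun_zero, zero_add]
    have h5 : ∀ (p : Prop) [Decidable p] (a b : ℂ),
        (if p then a - b else 0) = (if p then a else 0) - (if p then b else 0) := by
      intro p _ a b; split_ifs <;> simp
    have h6 : ∀ (p : Prop) [Decidable p] (a b : ℂ),
        (if p then a + b else 0) = (if p then a else 0) + (if p then b else 0) := by
      intro p _ a b; split_ifs <;> simp
    have hv := hV v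
    simp only [secular_inl, h2, h3, h4, h5, h6, mul_add, mul_sub, Finset.sum_sub_distrib,
      Finset.sum_add_distrib, Finset.mul_sum, mul_ite, mul_zero] at hv ⊢
    linear_combination hv

end Inhomogeneous

/-! ### The secular matrix and its meromorphic inverse -/

section Matrix

variable {V L E : Type*} [Fintype V] [DecidableEq V] [Fintype L] [Fintype E]

theorem differentiable_det {n : Type*} [Fintype n] [DecidableEq n] {A : ℂ → Matrix n n ℂ}
    (hA : ∀ i j, Differentiable ℂ fun μ => A μ i j) : Differentiable ℂ fun μ => (A μ).det := by
  simp only [Matrix.det_apply]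
  refine Differentiable.fun_sum fun σ _ => ?_
  refine Differentiable.const_smul (R := ℤˣ) ?_ _
  exact Differentiable.fun_finsetProd fun i _ => hA _ _

theorem differentiable_adjugate {n : Type*} [Fintype n] [DecidableEq n] {A : ℂ → Matrix n n ℂ}
    (hA : ∀ i j, Differentiable ℂ fun μ => A μ i j) (i j : n) :
    Differentiable ℂ fun μ => (A μ).adjugate i j := by
  simp only [Matrix.adjugate_apply]
  refine differentiable_det fun k l => ?_
  simp only [Matrix.updateRow_apply]
  split_ifs
  · exact differentiable_const _
  · exact hA k l

theorem differentiable_secular_apply (G : QuantumGraph V L E) (x : V ⊕ E → ℂ) (i : V ⊕ E) :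
    Differentiable ℂ fun μ => G.secular (G.phase μ) x i := by
  have hp : ∀ e, Differentiable ℂ fun μ => G.phase μ e := fun e => by unfold phase; fun_prop
  rcases i with v | e
  · simp only [secular_inl]
    refine ((Differentiable.fun_sum fun e _ => ?_).sub (differentiable_const _)).sub
      (differentiable_const _)
    have := hp e
    split_ifs <;> fun_prop
  · simp only [secular_inr]
    have := hp e
    fun_prop

open Classical in
/-- The matrix of the secular map. -/
def secularMatrix (G : QuantumGraph V L E) (μ : ℂ) : Matrix (V ⊕ E) (V ⊕ E) ℂ :=
  LinearMap.toMatrix' (G.secular (G.phase μ))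

open Classical in
theorem secularMatrix_mulVec (G : QuantumGraph V L E) (μ : ℂ) (x : V ⊕ E → ℂ) :
    (G.secularMatrix μ).mulVec x = G.secular (G.phase μ) x :=
  LinearMap.toMatrix'_mulVec _ _

open Classical in
theorem differentiable_secularMatrix (G : QuantumGraph V L E) (i j : V ⊕ E) :
    Differentiable ℂ fun μ => G.secularMatrix μ i j := by
  simp only [secularMatrix, LinearMap.toMatrix'_apply]
  exact G.differentiable_secular_apply _ i

open Classical in
theorem det_secularMatrix_ne_zero_iff (G : QuantumGraph V L E) (μ : ℂ) :
    (G.secularMatrix μ).det ≠ 0 ↔ ∀ x, G.secular (G.phase μ) x = 0 → x = 0 := by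
  rw [Ne, ← Matrix.exists_mulVec_eq_zero_iff]
  simp only [secularMatrix_mulVec]
  push Not
  exact forall_congr' fun x => ⟨fun h hx => by_contra fun hne => h hne hx, fun h hne hx => hne (h hx)⟩

-- The determinant is entire and does not vanish at `i`, where outgoing solutions are excluded; by
-- the identity theorem its zeros are isolated.
open Classical in
theorem eventually_det_ne_zero [Nonempty L] {G : QuantumGraph V L E} (hG : G.Connected) (ζ : ℂ) :
    ∀ᶠ μ in 𝓝[≠] ζ, (G.secularMatrix μ).det ≠ 0 := by
  by_contra hcon
  rw [Filter.not_eventually] at hcon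
  have hd : Differentiable ℂ fun μ => (G.secularMatrix μ).det :=
    differentiable_det G.differentiable_secularMatrix
  have ha : AnalyticOnNhd ℂ (fun μ => (G.secularMatrix μ).det) univ :=
    fun μ _ => hd.analyticAt μ
  have := ha.eqOn_zero_of_preconnected_of_frequently_eq_zero isPreconnected_univ (mem_univ ζ)
    (hcon.mono fun _ h => not_not.1 h) (mem_univ Complex.I)
  exact (G.det_secularMatrix_ne_zero_iff Complex.I).2
    (fun x hx => eq_zero_of_secular_eq_zero hG (by simp) hx) this

open Classical in
/-- The coefficients of the inverse of the secular matrix, with the columns that belong to the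
vertices divided by `μ`. -/
def secularInv (G : QuantumGraph V L E) (i j : V ⊕ E) (μ : ℂ) : ℂ :=
  (G.secularMatrix μ)⁻¹ i j * Sum.elim (fun _ => μ⁻¹) (fun _ => 1) j

theorem meromorphicAt_secularInv (G : QuantumGraph V L E) (i j : V ⊕ E) (μ : ℂ) :
    MeromorphicAt (G.secularInv i j) μ := by
  classical
  have hA := G.differentiable_secularMatrix
  have h1 : MeromorphicAt (fun μ => (G.secularMatrix μ)⁻¹ i j) μ := by
    simp only [Matrix.inv_def, Ring.inverse_eq_inv', Matrix.smul_apply, smul_eq_mul]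
    exact ((differentiable_det hA).analyticAt μ).meromorphicAt.fun_inv.fun_mul
      ((differentiable_adjugate hA i j).analyticAt μ).meromorphicAt
  refine h1.fun_mul ?_
  rcases j with v | e
  · exact (MeromorphicAt.id μ).inv
  · exact MeromorphicAt.const 1 μ

end Matrix

/-! ### An explicit continuation of the cut-off resolvent -/

section Resolvent

variable {V L E : Type*} [Fintype V] [DecidableEq V] [Fintype L] [Fintype E]

/-- The component on a finite edge. -/
def edgeProj (G : QuantumGraph V L E) (e : E) : G.HR 0 →L[ℂ] L2 (G.len e) :=
  PiLp.proj 2 (𝕜 := ℂ) (fun m : L ⊕ E => Lp ℂ 2 (volume.restrict (G.truncDom 0 m))) (.inr e)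

open Classical in
/-- The inclusion of the functions on a finite edge. -/
def edgeIncl (G : QuantumGraph V L E) (e : E) : L2 (G.len e) →L[ℂ] G.HR 0 :=
  (PiLp.continuousLinearEquiv 2 ℂ
    (fun m : L ⊕ E => Lp ℂ 2 (volume.restrict (G.truncDom 0 m)))).symm.toContinuousLinearMap ∘L
  ContinuousLinearMap.single ℂ
    (fun m : L ⊕ E => Lp ℂ 2 (volume.restrict (G.truncDom 0 m))) (.inr e)

theorem edgeProj_edgeIncl (G : QuantumGraph V L E) (e : E) (f : L2 (G.len e)) :
    G.edgeProj e (G.edgeIncl e f) = f := by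
  classical
  exact Pi.single_eq_same (M := fun m : L ⊕ E => Lp ℂ 2 (volume.restrict (G.truncDom 0 m)))
    (.inr e) f

theorem edgeProj_edgeIncl_of_ne (G : QuantumGraph V L E) {e e' : E} (h : e' ≠ e)
    (f : L2 (G.len e)) : G.edgeProj e' (G.edgeIncl e f) = 0 := by
  classical
  exact Pi.single_eq_of_ne (M := fun m : L ⊕ E => Lp ℂ 2 (volume.restrict (G.truncDom 0 m)))
    (fun hh => h (Sum.inr_injective hh)) f

/-- The second derivative of the solution of `-w'' - μ² w = f` with `w = w' = 0` at `src e`. -/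
def particular (G : QuantumGraph V L E) (μ : ℂ) (e : E) : G.HR 0 →L[ℂ] L2 (G.len e) :=
  -(helmholtzInv (G.len e) μ ∘L G.edgeProj e)

/-- The defects at `tgt e` and the (non-normalized) defects at the vertices that the particular
solutions cause. -/
def load (G : QuantumGraph V L E) (μ : ℂ) : V ⊕ E → G.HR 0 →L[ℂ] ℂ :=
  Sum.elim (fun v => ∑ e, if G.tgt e = v then primEnd (G.len e) ∘L G.particular μ e else 0)
    (fun e => primEnd (G.len e) ∘L volterra (G.len e) ∘L G.particular μ e)

/-- The coefficients of the homogeneous part of the resolvent. -/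
def resolventCoeff (G : QuantumGraph V L E) (μ : ℂ) (f : G.HR 0) (i : V ⊕ E) : ℂ :=
  -∑ j, G.secularInv i j μ * G.load μ j f

/-- The continuation of the resolvent, cut off to the finite edges. -/
def cutoffResolvent (G : QuantumGraph V L E) (μ : ℂ) : G.HR 0 →L[ℂ] G.HR 0 :=
  ∑ e, (G.edgeIncl e ∘L volterra (G.len e) ∘L volterra (G.len e) ∘L G.particular μ e
    - ∑ j, (G.secularInv (.inl (G.src e)) j μ •
          (G.edgeIncl e ∘L ContinuousLinearMap.smulRightL ℂ _ _ (G.load μ j)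
            (helmholtzInv (G.len e) μ (oneL2 (G.len e))))
        + G.secularInv (.inr e) j μ •
          (G.edgeIncl e ∘L ContinuousLinearMap.smulRightL ℂ _ _ (G.load μ j)
            (μ • helmholtzInv (G.len e) μ (volterra (G.len e) (oneL2 (G.len e)))))))

/-- Particular solution plus homogeneous solution. Applying `1 + μ² J²` to the latter exposes its
two coefficients, which is how bounds on the resolvent later become bounds on coefficients. -/
theorem edgeProj_cutoffResolvent (G : QuantumGraph V L E) (μ : ℂ) (f : G.HR 0) (e : E) :
    G.edgeProj e (G.cutoffResolvent μ f) =
      volterra (G.len e) (volterra (G.len e) (G.particular μ e f)) +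
      helmholtzInv (G.len e) μ (G.resolventCoeff μ f (.inl (G.src e)) • oneL2 (G.len e) +
        (μ * G.resolventCoeff μ f (.inr e)) • volterra (G.len e) (oneL2 (G.len e))) := by
  classical
  have h : G.cutoffResolvent μ f = ∑ e, G.edgeIncl e
      (volterra (G.len e) (volterra (G.len e) (G.particular μ e f)) +
      helmholtzInv (G.len e) μ (G.resolventCoeff μ f (.inl (G.src e)) • oneL2 (G.len e) +
        (μ * G.resolventCoeff μ f (.inr e)) • volterra (G.len e) (oneL2 (G.len e)))) := by
    have hs : ∀ e (c : G.HR 0 →L[ℂ] ℂ) (y : L2 (G.len e)),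
        ContinuousLinearMap.smulRightL ℂ _ _ c y f = c f • y := fun _ _ _ => rfl
    simp only [cutoffResolvent, _root_.sum_apply]
    refine Finset.sum_congr rfl fun e _ => ?_
    simp only [sub_apply, _root_.sum_apply, add_apply, smul_apply,
      ContinuousLinearMap.comp_apply, hs, resolventCoeff, map_add, map_smul, map_neg, map_sum,
      neg_smul, mul_neg, Finset.sum_add_distrib, smul_smul, Finset.mul_sum, Finset.sum_smul]
    rw [sub_eq_add_neg, neg_add]
    congr 3
    refine Finset.sum_congr rfl fun j _ => ?_
    congr 1
    ring
  rw [h, map_sum, Finset.sum_eq_single e, edgeProj_edgeIncl]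
  · exact fun e' _ hne => G.edgeProj_edgeIncl_of_ne hne.symm _
  · simp

theorem differentiable_particular (G : QuantumGraph V L E) (e : E) :
    Differentiable ℂ fun μ => G.particular μ e :=
  ((differentiable_helmholtzInv (G.len_pos e).le).clm_comp (differentiable_const _)).neg

theorem differentiable_load (G : QuantumGraph V L E) (j : V ⊕ E) :
    Differentiable ℂ fun μ => G.load μ j := by
  have hp := G.differentiable_particular
  rcases j with v | e
  · simp only [load, Sum.elim_inl]
    refine Differentiable.fun_sum fun e _ => ?_
    have := hp e
    split_ifs <;> fun_prop
  · simp only [load, Sum.elim_inr]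
    have := hp e
    fun_prop

/-- All operators involved are entire in norm; only the scalars `secularInv` can have poles. -/
theorem meromorphicOn_cutoffResolvent (G : QuantumGraph V L E) :
    MeromorphicOn G.cutoffResolvent univ := by
  intro μ _
  have hp := G.differentiable_particular
  have hl := G.differentiable_load
  have hH : ∀ e, Differentiable ℂ (helmholtzInv (G.len e)) := fun e =>
    differentiable_helmholtzInv (G.len_pos e).le
  refine MeromorphicAt.fun_sum fun e _ => ?_
  refine MeromorphicAt.fun_sub ?_ (MeromorphicAt.fun_sum fun j _ => ?_)
  · refine (Differentiable.analyticAt ?_ μ).meromorphicAt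
    have := hp e
    fun_prop
  · have := hl j
    have := hH e
    refine MeromorphicAt.fun_add ?_ ?_
    · refine (G.meromorphicAt_secularInv _ _ μ).fun_smul
        (Differentiable.analyticAt ?_ μ).meromorphicAt
      fun_prop
    · refine (G.meromorphicAt_secularInv _ _ μ).fun_smul
        (Differentiable.analyticAt ?_ μ).meromorphicAt
      fun_prop

open Classical in
theorem secular_resolventCoeff (G : QuantumGraph V L E) {μ : ℂ}
    (hdet : (G.secularMatrix μ).det ≠ 0) (f : G.HR 0) (i : V ⊕ E) :
    G.secular (G.phase μ) (G.resolventCoeff μ f) i =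
      -(Sum.elim (fun _ => μ⁻¹) (fun _ => 1) i * G.load μ i f) := by
  have h : G.resolventCoeff μ f = -((G.secularMatrix μ)⁻¹).mulVec
      (fun j => Sum.elim (fun _ => μ⁻¹) (fun _ => 1) j * G.load μ j f) := by
    ext i
    simp only [resolventCoeff, secularInv, Pi.neg_apply, Matrix.mulVec, dotProduct, mul_assoc]
  rw [← secularMatrix_mulVec, h, Matrix.mulVec_neg, Matrix.mulVec_mulVec,
    Matrix.mul_nonsing_inv _ (Ne.isUnit hdet), Matrix.one_mulVec]
  rfl

end Resolvent

/-! ### Outgoing solutions are resonances -/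

section Resonance

variable {V L E : Type*} [Fintype V] [DecidableEq V] [Fintype L] [Fintype E]

/-- `c cos μx + i c sin μx = c e^{iμx}` decays exponentially when `Im μ > 0`. -/
theorem memLp_outgoing {μ : ℂ} (hμ : 0 < μ.im) (c : ℂ) :
    MemLp (edgeFun μ c (Complex.I * c)) 2 (volume.restrict (Ici 0)) := by
  have hm : AEStronglyMeasurable (edgeFun μ c (Complex.I * c)) (volume.restrict (Ici 0)) :=
    (continuous_edgeFun _ _ _).aestronglyMeasurable
  rw [memLp_two_iff_integrable_sq_norm hm]
  have he : ∀ x : ℝ, ‖edgeFun μ c (Complex.I * c) x‖ ^ 2 =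
      ‖c‖ ^ 2 * Real.exp (-(2 * μ.im) * x) := fun x => by
    have : edgeFun μ c (Complex.I * c) x = c * Complex.exp (μ * x * Complex.I) := by
      rw [Complex.exp_mul_I, edgeFun]; ring
    rw [this, norm_mul, mul_pow, Complex.norm_exp, ← Real.exp_nat_mul]
    congr 2
    simp
    ring
  simp only [he]
  have := (exp_neg_integrableOn_Ioi 0 (b := 2 * μ.im) (by positivity)).const_mul (‖c‖ ^ 2)
  rwa [← IntegrableOn, ← integrableOn_Ici_iff_integrableOn_Ioi] at this

theorem isDom_graphFun (G : QuantumGraph V L E) {μ : ℂ} (hμ : 0 < μ.im) {x : V ⊕ E → ℂ}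
    {h : E → ℝ → ℂ} (hh : ∀ e, MemLp (h e) 2 (volume.restrict (Icc 0 (G.len e))))
    (hD : G.IsDomLoc (G.graphFun μ x (fun j => Complex.I * x (.inl (G.base j))) h)
      (G.graphFunDeriv2 μ x (fun j => Complex.I * x (.inl (G.base j))) h)) :
    G.IsDom (G.graphFun μ x (fun j => Complex.I * x (.inl (G.base j))) h)
      (G.graphFunDeriv2 μ x (fun j => Complex.I * x (.inl (G.base j))) h) := by
  refine ⟨hD, ?_⟩
  rintro (j | e)
  · have hw := memLp_outgoing hμ (x (.inl (G.base j)))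
    refine ⟨hw, ?_, (hw.const_mul (μ ^ 2)).neg⟩
    refine (hw.const_mul (μ * Complex.I)).ae_eq ?_
    refine (ae_restrict_iff' (G.measurableSet_dom (.inl j))).2 (ae_of_all _ fun y hy => ?_)
    have := G.derivWithin_of_eqOn_edgeFun (m := .inl j)
      (u := G.graphFun μ x (fun j => Complex.I * x (.inl (G.base j))) h (.inl j))
      (A := x (.inl (G.base j))) (B := Complex.I * x (.inl (G.base j))) (fun _ _ => rfl) hy
    rw [this]
    simp only [edgeFun]
    linear_combination (μ * x (.inl (G.base j)) * Complex.sin (μ * y)) * Complex.I_sq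
  · have hi : IntegrableOn (h e) (Icc 0 (G.len e)) := (hh e).integrable one_le_two
    have hc : ∀ A B : ℂ, MemLp (edgeFun μ A B) 2 (volume.restrict (Icc 0 (G.len e))) :=
      fun A B => memLp_of_continuousOn (continuous_edgeFun _ _ _).continuousOn
    have hp := continuousOn_prim hi
    have hpp : ContinuousOn (prim (prim (h e))) (Icc 0 (G.len e)) := fun y hy =>
      (hasDerivWithinAt_prim hp hy).continuousWithinAt
    refine ⟨(memLp_of_continuousOn hpp).add (hc _ _), ?_, (hh e).sub ((hc _ _).const_mul (μ ^ 2))⟩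
    refine ((memLp_of_continuousOn hp).add
      ((hc (x (.inr e)) (-x (.inl (G.src e)))).const_mul μ)).ae_eq ?_
    refine (ae_restrict_iff' (G.measurableSet_dom (.inr e))).2 (ae_of_all _ fun y hy => ?_)
    exact ((G.hasDerivWithinAt_graphFun_inr μ x _ hi hy).derivWithin
      (G.uniqueDiffOn_dom _ y hy)).symm

theorem volterraHelmholtz_particular (G : QuantumGraph V L E) (μ : ℂ) (e : E) (f : G.HR 0) :
    G.particular μ e f + μ ^ 2 • volterra (G.len e) (volterra (G.len e) (G.particular μ e f)) =
      -G.edgeProj e f := by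
  rw [← volterraHelmholtz_apply]
  change volterraHelmholtz _ μ (-(helmholtzInv _ μ (G.edgeProj e f))) = _
  rw [map_neg, volterraHelmholtz_helmholtzInv (G.len_pos e).le]

/-- `cutoffResolvent` continues the cut-off resolvent meromorphically. -/
theorem isCutoffResolvent [Nonempty L] {G : QuantumGraph V L E} (hG : G.Connected) :
    G.IsCutoffResolvent 0 G.cutoffResolvent := by
  classical
  refine ⟨G.meromorphicOn_cutoffResolvent, fun μ hμ f => ?_⟩
  have hμ0 : μ ≠ 0 := by rintro rfl; simp at hμ
  have hdet : (G.secularMatrix μ).det ≠ 0 := (G.det_secularMatrix_ne_zero_iff μ).2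
    fun x hx => eq_zero_of_secular_eq_zero hG hμ hx
  set x := G.resolventCoeff μ f with hx
  have hsec := G.secular_resolventCoeff hdet f
  rw [← hx] at hsec
  set h : E → ℝ → ℂ := fun e => G.particular μ e f with hh
  have hhm : ∀ e, MemLp (h e) 2 (volume.restrict (Icc 0 (G.len e))) := fun e => Lp.memLp _
  have hD := G.isDom_graphFun hμ hhm (x := x) (G.isDomLoc_graphFun hhm
    (fun e => by
      rw [hsec, Sum.elim_inr, one_mul, ← primEnd_volterra (G.len_pos e).le]
      rfl)
    (fun v => by
      rw [hsec, Sum.elim_inl, load, Sum.elim_inl]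
      have : (∑ e, if G.tgt e = v then primEnd (G.len e) ∘L G.particular μ e else 0) f =
          ∑ e, if G.tgt e = v then prim (h e) (G.len e) else 0 := by
        rw [_root_.sum_apply]
        refine Finset.sum_congr rfl fun e _ => ?_
        split_ifs <;> rfl
      rw [this]
      simp only [sub_self, ite_self, Finset.sum_const_zero, mul_zero, zero_sub]
      field_simp))
  refine ⟨_, ⟨_, hD, ?_⟩, ?_⟩
  · rintro (j | e)
    · have h0 : ∀ᵐ y : ℝ ∂(volume.restrict (G.dom (.inl j))), y ≠ 0 :=
        ae_restrict_of_ae (Measure.ae_ne volume 0)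
      filter_upwards [h0] with y hy
      have : y ∉ G.truncDom 0 (.inl j) := fun hy' => hy (le_antisymm hy'.2 hy'.1)
      rw [indicator_of_notMem this]
      simp [graphFun, graphFunDeriv2]
    · have h1 := G.volterraHelmholtz_particular μ e f
      have h2 : (fun y => h e y + μ ^ 2 * prim (prim (h e)) y)
          =ᵐ[volume.restrict (Icc 0 (G.len e))] fun y => -(G.edgeProj e f : ℝ → ℂ) y := by
        have h3 := congrArg (fun g : L2 (G.len e) => (g : ℝ → ℂ)) h1
        have h4 := coeFn_volterra (volterra (G.len e) (G.particular μ e f))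
        filter_upwards [Lp.coeFn_add (G.particular μ e f)
          (μ ^ 2 • volterra (G.len e) (volterra (G.len e) (G.particular μ e f))),
          Lp.coeFn_smul (μ ^ 2) (volterra (G.len e) (volterra (G.len e) (G.particular μ e f))),
          Lp.coeFn_neg (G.edgeProj e f), h4, ae_restrict_mem measurableSet_Icc]
          with y h5 h6 h7 h8 hy
        have h9 := congrFun h3 y
        simp only [h5, h7, Pi.add_apply, h6, Pi.smul_apply, h8, Pi.neg_apply, smul_eq_mul] at h9
        rw [← h9, prim_congr (coeFn_volterra (G.particular μ e f)) hy]
      have h3 : ∀ᵐ y ∂(volume.restrict (G.dom (.inr e))), y ∈ Icc 0 (G.len e) :=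
        ae_restrict_mem measurableSet_Icc
      filter_upwards [h2, h3] with y hy hy'
      have : y ∈ G.truncDom 0 (.inr e) := hy'
      rw [indicator_of_mem this]
      have h4 : (f (.inr e) : ℝ → ℂ) y = -(h e y + μ ^ 2 * prim (prim (h e)) y) := by
        rw [hy, neg_neg]; rfl
      rw [h4]
      simp only [graphFun, graphFunDeriv2, Sum.elim_inr]
      ring
  · rintro (j | e)
    · have : (volume.restrict (G.truncDom 0 (.inl j)) : Measure ℝ) = 0 := by
        rw [Measure.restrict_eq_zero]
        simp [truncDom]
      have h0 : ∀ p : ℝ → Prop, ∀ᵐ y ∂(volume.restrict (G.truncDom 0 (.inl j))), p y := by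
        rw [this]; simp
      exact h0 _
    · have h1 := G.edgeProj_cutoffResolvent μ f e
      rw [helmholtzInv_edge (G.len_pos e).le hμ0] at h1
      have h2 : (G.edgeProj e (G.cutoffResolvent μ f) : ℝ → ℂ)
          =ᵐ[volume.restrict (Icc 0 (G.len e))] G.graphFun μ x
            (fun j => Complex.I * x (.inl (G.base j))) h (.inr e) := by
        rw [h1]
        filter_upwards [Lp.coeFn_add (volterra (G.len e) (volterra (G.len e)
          (G.particular μ e f))) (memLp_of_continuousOn (ℓ := G.len e) (continuous_edgeFun μ
            (x (.inl (G.src e))) (x (.inr e))).continuousOn).toLp,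
          coeFn_volterra (volterra (G.len e) (G.particular μ e f)),
          (memLp_of_continuousOn (ℓ := G.len e) (continuous_edgeFun μ
            (x (.inl (G.src e))) (x (.inr e))).continuousOn).coeFn_toLp,
          ae_restrict_mem measurableSet_Icc] with y h3 h4 h5 hy
        rw [h3, Pi.add_apply, h4, h5, prim_congr (coeFn_volterra (G.particular μ e f)) hy]
        rfl
      exact h2

theorem tendsto_clm_apply {α H H' : Type*} [NormedAddCommGroup H] [NormedSpace ℂ H]
    [NormedAddCommGroup H'] [NormedSpace ℂ H'] {l : Filter α} {T : α → H →L[ℂ] H'}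
    {T₀ : H →L[ℂ] H'} {y : α → H} {y₀ : H} (hT : Tendsto T l (𝓝 T₀)) (hy : Tendsto y l (𝓝 y₀)) :
    Tendsto (fun a => T a (y a)) l (𝓝 (T₀ y₀)) :=
  (isBoundedBilinearMap_apply.continuous.tendsto (T₀, y₀)).comp (hT.prodMk_nhds hy)

/-- The pairing of a solution `x` of the homogeneous secular equation with the secular map. -/
theorem sum_pairing_secular (G : QuantumGraph V L E) {ζ : ℂ} {x : V ⊕ E → ℂ}
    (hx : G.secular (G.phase ζ) x = 0) (θ : E → ℂ) (d : V ⊕ E → ℂ) :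
    ∑ e, edgeFun ζ (x (.inr e)) (-x (.inl (G.src e))) (G.len e) * G.secular θ d (.inr e)
      - ∑ v, x (.inl v) * G.secular θ d (.inl v) =
    ∑ e, (d (.inl (G.src e)) *
        (edgeFun ζ (x (.inr e)) (-x (.inl (G.src e))) (G.len e) * Complex.cos (θ e)
          + x (.inl (G.tgt e)) * Complex.sin (θ e) - x (.inr e))
      + d (.inr e) *
        (edgeFun ζ (x (.inr e)) (-x (.inl (G.src e))) (G.len e) * Complex.sin (θ e)
          - x (.inl (G.tgt e)) * Complex.cos (θ e) + x (.inl (G.src e)))) := by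
  -- The pairing is bilinear, without conjugates: testing `x` with `d` and `d` with `x` gives the
  -- same lead terms, which cancel even for complex `ζ`.
  have h1 := G.sum_mul_secular_inl (G.phase ζ) x (fun v => d (.inl v))
  rw [hx] at h1
  simp only [Pi.zero_apply, mul_zero, Finset.sum_const_zero] at h1
  rw [G.sum_mul_secular_inl θ d (fun v => x (.inl v))]
  have h2 : ∑ j, d (.inl (G.base j)) * x (.inl (G.base j)) =
      ∑ j, x (.inl (G.base j)) * d (.inl (G.base j)) :=
    Finset.sum_congr rfl fun j _ => mul_comm _ _
  rw [h2, eq_comm, sub_eq_zero] at h1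
  rw [← h1, sub_sub_eq_add_sub, ← Finset.sum_add_distrib, ← Finset.sum_sub_distrib]
  refine Finset.sum_congr rfl fun e _ => ?_
  simp only [secular_inr, edgeFun, phase]
  ring

/-- If the functional vanished on the two sources `1` and `x`, the Cauchy data of the kernel
solution at `tgt e` would be zero, and so would both its coefficients on the edge. -/
theorem exists_load_ne_zero (G : QuantumGraph V L E) {ζ : ℂ} (hζ : ζ ≠ 0) {x : V ⊕ E → ℂ}
    (hx : G.secular (G.phase ζ) x = 0) {e : E} (he : x (.inr e) ≠ 0) :
    ∃ h : L2 (G.len e), edgeFun ζ (x (.inr e)) (-x (.inl (G.src e))) (G.len e) *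
        primEnd (G.len e) (volterra (G.len e) h)
      - x (.inl (G.tgt e)) * (ζ⁻¹ * primEnd (G.len e) h) ≠ 0 := by
  by_contra! hcon
  have hl := (G.len_pos e).le
  have hne : (G.len e : ℂ) ≠ 0 := Complex.ofReal_ne_zero.2 (G.len_pos e).ne'
  have h1 := hcon (oneL2 _)
  have h2 := hcon (volterra _ (oneL2 _))
  rw [primEnd_oneL2 hl, primEnd_volterra_oneL2 hl] at h1
  rw [primEnd_volterra_oneL2 hl, primEnd_volterra_volterra_oneL2 hl] at h2
  set p := edgeFun ζ (x (.inr e)) (-x (.inl (G.src e))) (G.len e) with hp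
  have hp0 : p = 0 := by
    have : p * (G.len e : ℂ) ^ 3 = 0 := by linear_combination 6 * (G.len e : ℂ) * h1 - 12 * h2
    exact (mul_eq_zero.1 this).resolve_right (pow_ne_zero _ hne)
  rw [hp0] at h1
  have ht : x (.inl (G.tgt e)) = 0 := by
    field_simp at h1
    simpa [hζ, hne] using h1
  have hw : edgeFun ζ (x (.inl (G.src e))) (x (.inr e)) (G.len e) = 0 := by
    have := congrFun hx (.inr e)
    rw [secular_inr, ht, sub_zero] at this
    exact this
  exact he (edgeFun_sq_add_sq _ _ _ _ hw (hp ▸ hp0)).2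

/-- A nontrivial outgoing solution at `ζ ≠ 0` makes `ζ` a resonance. -/
theorem isResonance_of_secular_eq_zero [Nonempty L] {G : QuantumGraph V L E} (hG : G.Connected)
    {ζ : ℂ} (hζ : ζ ≠ 0) {x : V ⊕ E → ℂ} (hx : G.secular (G.phase ζ) x = 0) {e₀ : E}
    (he₀ : x (.inr e₀) ≠ 0) : G.IsResonance ζ := by
  classical
  refine ⟨0, le_rfl, G.cutoffResolvent, isCutoffResolvent hG, ?_⟩
  by_contra hord
  obtain ⟨F₀, hF⟩ := tendsto_nhds_of_meromorphicOrderAt_nonneg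
    (G.meromorphicOn_cutoffResolvent ζ (mem_univ _)) (not_lt.1 hord)
  obtain ⟨h₀, hh₀⟩ := G.exists_load_ne_zero hζ hx he₀
  -- The source is chosen so that at `μ = ζ` the particular solution has second derivative `h₀` on
  -- `e₀` and vanishes on all other edges.
  set f : G.HR 0 := G.edgeIncl e₀ (-(volterraHelmholtz (G.len e₀) ζ h₀)) with hf
  have hpart : G.particular ζ e₀ f = h₀ := by
    change -(helmholtzInv _ ζ (G.edgeProj e₀ f)) = _
    rw [hf, edgeProj_edgeIncl, map_neg, neg_neg,
      helmholtzInv_volterraHelmholtz (G.len_pos _).le]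
  have hpart' : ∀ e, e ≠ e₀ → G.particular ζ e f = 0 := fun e he => by
    change -(helmholtzInv _ ζ (G.edgeProj e f)) = _
    rw [hf, edgeProj_edgeIncl_of_ne _ he, map_zero, neg_zero]
  set d : ℂ → V ⊕ E → ℂ := fun μ => G.resolventCoeff μ f with hd
  set p : E → ℂ := fun e => edgeFun ζ (x (.inr e)) (-x (.inl (G.src e))) (G.len e) with hp
  -- A limit of the resolvent yields limits of the homogeneous coefficients: `1 + μ² J²` turns the
  -- homogeneous part into an affine function, whose coefficients are recovered from two moments.
  have hcoeff : ∀ e, (∃ a, Tendsto (fun μ => d μ (.inl (G.src e))) (𝓝[≠] ζ) (𝓝 a)) ∧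
      ∃ b, Tendsto (fun μ => d μ (.inr e)) (𝓝[≠] ζ) (𝓝 b) := fun e => by
    have hl := (G.len_pos e).le
    have hne : (G.len e : ℂ) ≠ 0 := Complex.ofReal_ne_zero.2 (G.len_pos e).ne'
    set y : ℂ → L2 (G.len e) := fun μ => d μ (.inl (G.src e)) • oneL2 (G.len e) +
      (μ * d μ (.inr e)) • volterra (G.len e) (oneL2 (G.len e)) with hy
    have hyeq : ∀ μ, y μ = volterraHelmholtz (G.len e) μ (G.edgeProj e (G.cutoffResolvent μ f) -
        volterra (G.len e) (volterra (G.len e) (G.particular μ e f))) := fun μ => by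
      rw [G.edgeProj_cutoffResolvent, add_sub_cancel_left, volterraHelmholtz_helmholtzInv hl]
    obtain ⟨y₀, hy₀⟩ : ∃ y₀, Tendsto y (𝓝[≠] ζ) (𝓝 y₀) := by
      have h1 : Tendsto (volterraHelmholtz (G.len e)) (𝓝[≠] ζ)
          (𝓝 (volterraHelmholtz (G.len e) ζ)) :=
        (differentiable_volterraHelmholtz _).continuous.continuousAt.tendsto.mono_left
          nhdsWithin_le_nhds
      have h2 : Tendsto (fun μ => G.particular μ e) (𝓝[≠] ζ) (𝓝 (G.particular ζ e)) :=
        (G.differentiable_particular e).continuous.continuousAt.tendsto.mono_left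
          nhdsWithin_le_nhds
      have h3 : Tendsto (fun μ => G.edgeProj e (G.cutoffResolvent μ f)) (𝓝[≠] ζ)
          (𝓝 (G.edgeProj e (F₀ f))) :=
        ((G.edgeProj e).continuous.tendsto _).comp (tendsto_clm_apply hF tendsto_const_nhds)
      have h4 : Tendsto (fun μ => volterra (G.len e) (volterra (G.len e) (G.particular μ e f)))
          (𝓝[≠] ζ) (𝓝 (volterra (G.len e) (volterra (G.len e) (G.particular ζ e f)))) :=
        ((volterra (G.len e)).continuous.tendsto _).comp
          (((volterra (G.len e)).continuous.tendsto _).comp (tendsto_clm_apply h2 tendsto_const_nhds))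
      refine ⟨_, Tendsto.congr (fun μ => (hyeq μ).symm) (tendsto_clm_apply h1 (h3.sub h4))⟩
    have hI : Tendsto (fun μ => primEnd (G.len e) (y μ)) (𝓝[≠] ζ) (𝓝 (primEnd (G.len e) y₀)) :=
      ((primEnd (G.len e)).continuous.tendsto _).comp hy₀
    have hJ : Tendsto (fun μ => primEnd (G.len e) (volterra (G.len e) (y μ))) (𝓝[≠] ζ)
        (𝓝 (primEnd (G.len e) (volterra (G.len e) y₀))) :=
      ((primEnd (G.len e)).continuous.tendsto _).comp
        (((volterra (G.len e)).continuous.tendsto _).comp hy₀)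
    have hI' : ∀ μ, primEnd (G.len e) (y μ) =
        d μ (.inl (G.src e)) * G.len e + μ * d μ (.inr e) * ((G.len e : ℂ) ^ 2 / 2) := fun μ => by
      simp only [hy, map_add, map_smul, smul_eq_mul, primEnd_oneL2 hl, primEnd_volterra_oneL2 hl]
    have hJ' : ∀ μ, primEnd (G.len e) (volterra (G.len e) (y μ)) =
        d μ (.inl (G.src e)) * ((G.len e : ℂ) ^ 2 / 2) +
          μ * d μ (.inr e) * ((G.len e : ℂ) ^ 3 / 6) := fun μ => by
      simp only [hy, map_add, map_smul, smul_eq_mul, primEnd_volterra_oneL2 hl,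
        primEnd_volterra_volterra_oneL2 hl]
    simp only [hI'] at hI
    simp only [hJ'] at hJ
    have hinv : Tendsto (fun μ : ℂ => μ⁻¹) (𝓝[≠] ζ) (𝓝 ζ⁻¹) :=
      (continuousAt_inv₀ hζ).tendsto.mono_left nhdsWithin_le_nhds
    have hne0 : ∀ᶠ μ in 𝓝[≠] ζ, μ ≠ 0 := nhdsWithin_le_nhds (isOpen_ne.mem_nhds hζ)
    constructor
    · refine ⟨_, Tendsto.congr (fun μ => ?_) ((hJ.const_mul (6 / (G.len e : ℂ) ^ 2)).sub
        (hI.const_mul (2 / (G.len e : ℂ))))⟩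
      field_simp
      ring
    · refine ⟨_, Tendsto.congr' ?_ (hinv.mul ((hI.const_mul (6 / (G.len e : ℂ) ^ 2)).sub
        (hJ.const_mul (12 / (G.len e : ℂ) ^ 3))))⟩
      filter_upwards [hne0] with μ hμ
      field_simp
      ring
  -- At `μ = ζ` the weights form a left null vector of the secular map. In the rearranged pairing
  -- only sine coefficients and vertex values at `src e` occur, exactly those that `hcoeff`
  -- controls.
  have hzero : Tendsto (fun μ => ∑ e, p e * G.secular (G.phase μ) (d μ) (.inr e)
      - ∑ v, x (.inl v) * G.secular (G.phase μ) (d μ) (.inl v)) (𝓝[≠] ζ) (𝓝 0) := by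
    simp only [hp, G.sum_pairing_secular hx]
    rw [← Finset.sum_const_zero (s := (Finset.univ : Finset E))]
    refine tendsto_finsetSum _ fun e _ => ?_
    obtain ⟨⟨a, ha⟩, b, hb⟩ := hcoeff e
    have hs := Complex.sin_sq_add_cos_sq (ζ * G.len e)
    have ht : x (.inl (G.tgt e)) = edgeFun ζ (x (.inl (G.src e))) (x (.inr e)) (G.len e) := by
      have := congrFun hx (.inr e)
      rw [secular_inr, Pi.zero_apply, sub_eq_zero] at this
      exact this.symm
    have h1 : Tendsto (fun μ => p e * Complex.cos (G.phase μ e)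
        + x (.inl (G.tgt e)) * Complex.sin (G.phase μ e) - x (.inr e)) (𝓝[≠] ζ) (𝓝 0) := by
      have hc : Continuous fun μ => p e * Complex.cos (G.phase μ e)
        + x (.inl (G.tgt e)) * Complex.sin (G.phase μ e) - x (.inr e) := by
        unfold phase; fun_prop
      convert! (hc.tendsto ζ).mono_left nhdsWithin_le_nhds using 2
      rw [ht]
      simp only [hp, edgeFun, phase]
      linear_combination (-(x (.inr e))) * hs
    have h2 : Tendsto (fun μ => p e * Complex.sin (G.phase μ e)
        - x (.inl (G.tgt e)) * Complex.cos (G.phase μ e) + x (.inl (G.src e)))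
        (𝓝[≠] ζ) (𝓝 0) := by
      have hc : Continuous fun μ => p e * Complex.sin (G.phase μ e)
        - x (.inl (G.tgt e)) * Complex.cos (G.phase μ e) + x (.inl (G.src e)) := by
        unfold phase; fun_prop
      convert! (hc.tendsto ζ).mono_left nhdsWithin_le_nhds using 2
      rw [ht]
      simp only [hp, edgeFun, phase]
      linear_combination (x (.inl (G.src e))) * hs
    simpa using (ha.mul h1).add (hb.mul h2)
  -- The same pairing, evaluated by the secular equation where the determinant is nonzero, tends to
  -- the functional of `exists_load_ne_zero` at `h₀`, up to sign.
  have hlim : Tendsto (fun μ => ∑ e, p e * G.secular (G.phase μ) (d μ) (.inr e)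
      - ∑ v, x (.inl v) * G.secular (G.phase μ) (d μ) (.inl v)) (𝓝[≠] ζ)
      (𝓝 (-∑ e, p e * G.load ζ (.inr e) f + ∑ v, x (.inl v) * (ζ⁻¹ * G.load ζ (.inl v) f))) := by
    have hload : ∀ j, Tendsto (fun μ => G.load μ j f) (𝓝[≠] ζ) (𝓝 (G.load ζ j f)) := fun j =>
      tendsto_clm_apply
        (((G.differentiable_load j).continuous.tendsto ζ).mono_left nhdsWithin_le_nhds)
        tendsto_const_nhds
    have hinv : Tendsto (fun μ : ℂ => μ⁻¹) (𝓝[≠] ζ) (𝓝 ζ⁻¹) :=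
      (continuousAt_inv₀ hζ).tendsto.mono_left nhdsWithin_le_nhds
    refine Tendsto.congr' ?_ ((tendsto_finsetSum _ fun e _ =>
      (hload (.inr e)).const_mul (p e)).neg.add (tendsto_finsetSum _ fun v _ =>
      (hinv.mul (hload (.inl v))).const_mul (x (.inl v))))
    filter_upwards [eventually_det_ne_zero hG ζ] with μ hμ
    simp only [hd, G.secular_resolventCoeff hμ, Sum.elim_inl, Sum.elim_inr, one_mul, mul_neg,
      Finset.sum_neg_distrib, sub_neg_eq_add]
  have heq := tendsto_nhds_unique hlim hzero
  have h1 : ∑ e, p e * G.load ζ (.inr e) f =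
      p e₀ * primEnd (G.len e₀) (volterra (G.len e₀) h₀) := by
    have : ∀ e, G.load ζ (.inr e) f =
      primEnd (G.len e) (volterra (G.len e) (G.particular ζ e f)) := fun _ => rfl
    simp only [this]
    rw [Finset.sum_eq_single e₀ (fun e _ he => by simp [hpart' e he]) (by simp), hpart]
  have h2 : ∑ v, x (.inl v) * (ζ⁻¹ * G.load ζ (.inl v) f) =
      x (.inl (G.tgt e₀)) * (ζ⁻¹ * primEnd (G.len e₀) h₀) := by
    have : ∀ v, G.load ζ (.inl v) f = if G.tgt e₀ = v then primEnd (G.len e₀) h₀ else 0 :=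
      fun v => by
        simp only [load, Sum.elim_inl, _root_.sum_apply]
        rw [Finset.sum_eq_single e₀ (fun e _ he => ?_) (by simp)]
        · split_ifs
          · rw [← hpart]; rfl
          · rfl
        · split_ifs
          · change primEnd _ (G.particular ζ e f) = 0
            rw [hpart' e he, map_zero]
          · rfl
    simp [this]
  rw [h1, h2] at heq
  exact hh₀ (by linear_combination -heq)

end Resonance

/-! ### The embedded eigenvalue -/

section Embedded

/-- When `sin λℓ = 0`, `sin λx cos λx` integrates to `0` and `sin² λx` to `ℓ/2`. So only sine
coefficients enter norms and inner products with the eigenfunction. -/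
theorem integral_edgeFun_mul_conj {lam ℓ : ℝ} (hlam : lam ≠ 0) (hℓ : 0 ≤ ℓ)
    (hs : Complex.sin (lam * ℓ) = 0) (B C β : ℂ) :
    ∫ x in Icc 0 ℓ, edgeFun lam 0 B x * conj (edgeFun lam C β x) = B * conj β * ℓ / 2 := by
  have hl : (lam : ℂ) ≠ 0 := Complex.ofReal_ne_zero.2 hlam
  have hcc : ∀ x : ℝ, conj (Complex.cos (lam * x)) = Complex.cos (lam * x) := fun x => by
    rw [← Complex.cos_conj]; simp
  have hsc : ∀ x : ℝ, conj (Complex.sin (lam * x)) = Complex.sin (lam * x) := fun x => by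
    rw [← Complex.sin_conj]; simp
  have h1 := hasDerivAt_edgeFun (lam : ℂ) 0 1
  have h2 := hasDerivAt_edgeFun (lam : ℂ) 1 0
  have hd : ∀ x : ℝ, HasDerivAt (fun x : ℝ => B * (conj C * (edgeFun lam 0 1 x) ^ 2 / (2 * lam) +
      conj β * ((x : ℂ) / 2 - edgeFun lam 0 1 x * edgeFun lam 1 0 x / (2 * lam))))
      (edgeFun lam 0 B x * conj (edgeFun lam C β x)) x := fun x => by
    convert! (((((h1 x).pow 2).const_mul (conj C)).div_const (2 * (lam : ℂ))).add
      ((((hasDerivAt_id x).ofReal_comp.div_const 2).sub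
        (((h1 x).mul (h2 x)).div_const (2 * (lam : ℂ)))).const_mul (conj β))).const_mul B using 1
    have hq := Complex.sin_sq_add_cos_sq (lam * x)
    simp only [edgeFun, map_add, map_mul, hcc, hsc]
    field_simp
    simp
    linear_combination (B * conj β) * hq
  have hc : Continuous fun x => edgeFun lam 0 B x * conj (edgeFun lam C β x) :=
    (continuous_edgeFun _ _ _).mul (Complex.continuous_conj.comp (continuous_edgeFun _ _ _))
  rw [integral_Icc_eq_integral_Ioc, ← intervalIntegral.integral_of_le hℓ,
    intervalIntegral.integral_eq_sub_of_hasDerivAt (fun x _ => hd x) (hc.intervalIntegrable _ _)]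
  simp [edgeFun, hs]
  ring

variable {V L E : Type*} [Fintype V] [DecidableEq V] [Fintype L] [Fintype E]

/-- The coefficients of an eigenvector with eigenvalue `μ² > 0`. -/
theorem IsEigenvector.exists_coeff {G : QuantumGraph V L E} {μ : ℝ} (hμ : μ ≠ 0)
    {u : L ⊕ E → ℝ → ℂ} (hu : G.IsEigenvector ((μ : ℂ) ^ 2) u) :
    ∃ x : V ⊕ E → ℂ, G.secular (G.phase μ) x = 0 ∧ (∀ j, EqOn (u (.inl j)) 0 (G.dom (.inl j))) ∧
      ∀ e, EqOn (u (.inr e)) (edgeFun μ (x (.inl (G.src e))) (x (.inr e))) (G.dom (.inr e)) := by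
  have hμ' : (μ : ℂ) ≠ 0 := Complex.ofReal_ne_zero.2 hμ
  have hlead : ∀ j, EqOn (u (.inl j)) (edgeFun μ 0 0) (G.dom (.inl j)) := fun j => by
    have h1 := G.eq_edgeFun hμ' (hu.1.1 (.inl j))
    set A := u (.inl j) 0
    set B := derivWithin (u (.inl j)) (G.dom (.inl j)) 0 / μ
    have h2 : ∀ᵐ y ∂(volume.restrict (G.dom (.inl j))), u (.inl j) y = edgeFun μ A B y :=
      (ae_restrict_iff' (G.measurableSet_dom _)).2 (ae_of_all _ fun y hy => h1 hy)
    have h3 : ∀ᵐ y ∂(volume.restrict (G.dom (.inl j))),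
        derivWithin (u (.inl j)) (G.dom (.inl j)) y = μ * edgeFun μ B (-A) y :=
      (ae_restrict_iff' (G.measurableSet_dom _)).2
        (ae_of_all _ fun y hy => G.derivWithin_of_eqOn_edgeFun h1 hy)
    obtain ⟨hA, hB⟩ := eq_zero_of_memLp_lead hμ (((hu.2 (.inl j)).1).ae_eq h2)
      (((hu.2 (.inl j)).2.1).ae_eq h3)
    rwa [hA, hB] at h1
  have hzero : ∀ j, EqOn (u (.inl j)) 0 (G.dom (.inl j)) := fun j y hy => by
    rw [hlead j hy]; simp [edgeFun]
  obtain ⟨x, hx0, hx1, hx2, hx3⟩ := G.exists_coeff_of_isDomLoc hμ' hu.1 0 (fun j => by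
    rw [G.derivWithin_of_eqOn_edgeFun (hlead j) (G.zero_mem_dom _)]
    simp [edgeFun])
  have hb : ∀ j, x (.inl (G.base j)) = 0 := fun j => by
    rw [← hx0, hzero j (G.zero_mem_dom _)]; rfl
  refine ⟨x, ?_, hzero, hx1⟩
  ext (v | e)
  · simp [hx3, hb]
  · exact hx2 e

theorem prim_zero : prim 0 = 0 := by ext x; simp [prim]

theorem graphFunDeriv2_zero (G : QuantumGraph V L E) (μ : ℂ) (x : V ⊕ E → ℂ) (κ : L → ℂ) :
    G.graphFunDeriv2 μ x κ 0 = fun m y => -(μ ^ 2 * G.graphFun μ x κ 0 m y) := by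
  ext m y
  rcases m with j | e
  · rfl
  · simp [graphFunDeriv2, graphFun, prim_zero]

theorem isDomLoc_graphFun_zero (G : QuantumGraph V L E) {μ : ℂ} {x : V ⊕ E → ℂ} {κ : L → ℂ}
    (hE : ∀ e, G.secular (G.phase μ) x (.inr e) = 0)
    (hV : ∀ v, G.secular (G.phase μ) x (.inl v) =
      ∑ j, if G.base j = v then κ j - Complex.I * x (.inl (G.base j)) else 0) :
    G.IsDomLoc (G.graphFun μ x κ 0) (fun m y => -(μ ^ 2 * G.graphFun μ x κ 0 m y)) := by
  rw [← graphFunDeriv2_zero]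
  refine G.isDomLoc_graphFun (fun e => MemLp.zero) (fun e => ?_) (fun v => ?_)
  · simp [hE, prim_zero]
  · simp [hV, prim_zero]

/-- A solution of the secular equation that vanishes at the vertices gives an eigenvector. -/
theorem isEigenvector_graphFun (G : QuantumGraph V L E) {μ : ℂ} {x : V ⊕ E → ℂ}
    (hx : G.secular (G.phase μ) x = 0) (hv : ∀ v, x (.inl v) = 0) :
    G.IsEigenvector (μ ^ 2) (G.graphFun μ x 0 0) := by
  refine ⟨G.isDomLoc_graphFun_zero (fun e => by rw [hx]; rfl) (fun v => by simp [hx, hv]), ?_⟩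
  have hD : ∀ m, ∃ A B, G.graphFun μ x 0 0 m = edgeFun μ A B ∧
      (∀ j, m = .inl j → A = 0 ∧ B = 0) := by
    rintro (j | e)
    · exact ⟨0, 0, by simp [graphFun, hv], fun _ _ => ⟨rfl, rfl⟩⟩
    · exact ⟨x (.inl (G.src e)), x (.inr e), by ext y; simp [graphFun, prim_zero],
        fun j hj => by simp at hj⟩
  have hmem : ∀ m A B, (∀ j, m = Sum.inl j → A = 0 ∧ B = 0) →
      MemLp (edgeFun μ A B) 2 (volume.restrict (G.dom m)) := by
    rintro (j | e) A B hAB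
    · have : edgeFun μ A B = 0 := by
        ext y; simp [edgeFun, (hAB j rfl).1, (hAB j rfl).2]
      rw [this]; exact MemLp.zero
    · exact memLp_of_continuousOn (continuous_edgeFun _ _ _).continuousOn
  intro m
  obtain ⟨A, B, hAB, h0⟩ := hD m
  simp only [hAB]
  have h1 := hmem m A B h0
  refine ⟨h1, ?_, (h1.const_mul (μ ^ 2)).neg⟩
  have h2 := (hmem m B (-A) (fun j hj => ⟨(h0 j hj).2, by simp [(h0 j hj).1]⟩)).const_mul μ
  refine h2.ae_eq ((ae_restrict_iff' (G.measurableSet_dom _)).2 (ae_of_all _ fun y hy => ?_))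
  exact (G.derivWithin_of_eqOn_edgeFun (fun _ _ => rfl) hy).symm

/-- If the phases of the finite edges lie in `π ℤ`, then the solutions of the secular equation
vanish at the vertices. -/
theorem secular_ker_vertex_eq_zero [Nonempty L] {G : QuantumGraph V L E} (hG : G.Connected)
    {θ : E → ℂ} (hs : ∀ e, Complex.sin (θ e) = 0) (hθ : ∀ e, conj (Complex.cos (θ e)) = Complex.cos (θ e))
    {x : V ⊕ E → ℂ} (hx : G.secular θ x = 0) (v : V) : x (.inl v) = 0 := by
  have hσ : ∀ e, Complex.cos (θ e) * Complex.cos (θ e) = 1 := fun e => by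
    have := Complex.sin_sq_add_cos_sq (θ e)
    rw [hs] at this
    linear_combination this
  have ht : ∀ e, x (.inl (G.tgt e)) = x (.inl (G.src e)) * Complex.cos (θ e) := fun e => by
    have := congrFun hx (.inr e)
    rw [secular_inr, hs, Pi.zero_apply] at this
    linear_combination -this
  have h1 := G.sum_mul_secular_inl θ x (fun v => conj (x (.inl v)))
  -- Along an edge the value is multiplied by `cos θ = ±1`, and so is the sine coefficient in the
  -- derivative; the end terms cancel and only the leads remain.
  have h2 : ∑ e, (conj (x (.inl (G.tgt e))) * (-(x (.inl (G.src e)) * Complex.sin (θ e)) +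
      x (.inr e) * Complex.cos (θ e)) - conj (x (.inl (G.src e))) * x (.inr e)) = 0 :=
    Finset.sum_eq_zero fun e _ => by
      rw [ht, hs, map_mul, hθ]
      linear_combination (conj (x (.inl (G.src e))) * x (.inr e)) * hσ e
  rw [h2, hx] at h1
  have h3 : ∑ j, Complex.normSq (x (.inl (G.base j))) = 0 := by
    have h4 : Complex.I * ∑ j, conj (x (.inl (G.base j))) * x (.inl (G.base j)) = 0 := by
      simpa using h1
    have h5 := (mul_eq_zero.1 h4).resolve_left Complex.I_ne_zero
    simp only [← Complex.normSq_eq_conj_mul_self] at h5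
    exact_mod_cast h5
  have h4 := (Finset.sum_eq_zero_iff_of_nonneg fun j _ => Complex.normSq_nonneg _).1 h3
    (Classical.arbitrary L) (Finset.mem_univ _)
  -- The values may change sign along an edge, but their moduli agree over the connected graph and
  -- vanish at a vertex with a lead.
  have h5 := hG.eq_of_edges (fun v => Complex.normSq (x (.inl v))) (fun e => by
    have h6 : Complex.normSq (Complex.cos (θ e)) = 1 := by
      have : ((Complex.normSq (Complex.cos (θ e)) : ℝ) : ℂ) = 1 := by
        rw [Complex.normSq_eq_conj_mul_self, hθ, hσ]
      exact_mod_cast this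
    simp [ht, Complex.normSq_mul, h6]) v (G.base (Classical.arbitrary L))
  exact Complex.normSq_eq_zero.1 (h5.trans h4)

/-- The coefficient vector that vanishes at the vertices. -/
def edgeVec (B : E → ℂ) : V ⊕ E → ℂ := Sum.elim 0 B

/-- `lam²` is a simple eigenvalue with normalized eigenfunction `B e * sin (lam x)` on the finite
edges, and `lam * len e ∈ π ℤ`. -/
structure IsEmbedded (G : QuantumGraph V L E) (lam : ℝ) (B : E → ℂ) : Prop where
  ne_zero : lam ≠ 0
  sin_eq : ∀ e, Complex.sin (G.phase lam e) = 0
  secular_eq : G.secular (G.phase lam) (edgeVec B) = 0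
  ker : ∀ x, G.secular (G.phase lam) x = 0 → ∃ c : ℂ, x = c • edgeVec B
  norm_eq : ∑ e, (G.len e : ℂ) * (conj (B e) * B e) = 2

/-- Every kernel vector of the secular map at `λ` vanishes at the vertices, hence on the leads,
hence is an eigenvector. Simplicity makes the kernel a line; since `sin²` has mean `1/2`, the norm
condition acquires the constant `2`. -/
theorem exists_isEmbedded [Nonempty L] {G : QuantumGraph V L E} (hG : G.Connected) {lam : ℝ}
    (hlam : lam ≠ 0) (hsimple : G.IsSimpleEigenvalue ((lam : ℂ) ^ 2))
    (hlen : ∀ m : E, ∃ n : ℤ, lam * G.len m = Real.pi * n)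
    {u : L ⊕ E → ℝ → ℂ} (hu : G.IsEigenvector ((lam : ℂ) ^ 2) u)
    (hnorm : ∑ m, ∫ x in G.dom m, ‖u m x‖ ^ 2 = 1) :
    ∃ B : E → ℂ, G.IsEmbedded lam B ∧
      ∀ e, EqOn (u (.inr e)) (edgeFun lam 0 (B e)) (G.dom (.inr e)) := by
  have hl : (lam : ℂ) ≠ 0 := Complex.ofReal_ne_zero.2 hlam
  have hs : ∀ e, Complex.sin (G.phase lam e) = 0 := fun e => by
    obtain ⟨n, hn⟩ := hlen e
    rw [Complex.sin_eq_zero_iff]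
    refine ⟨n, ?_⟩
    rw [phase, ← Complex.ofReal_mul, hn]
    push_cast; ring
  have hc : ∀ e, conj (Complex.cos (G.phase lam e)) = Complex.cos (G.phase lam e) := fun e => by
    rw [← Complex.cos_conj, phase]; simp
  have hker := fun {x : V ⊕ E → ℂ} (hx : G.secular (G.phase lam) x = 0) =>
    secular_ker_vertex_eq_zero hG hs hc hx
  obtain ⟨y, hy, hy0, hy1⟩ := hu.exists_coeff hlam
  have hyv := hker hy
  simp only [hyv] at hy1
  have hye : y = edgeVec fun e => y (.inr e) := by
    ext (v | e)
    · exact hyv v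
    · rfl
  have hN : ∑ e, (G.len e : ℂ) * (conj (y (.inr e)) * y (.inr e)) = 2 := by
    have h1 : ∀ e, ((∫ x in G.dom (.inr e), ‖u (.inr e) x‖ ^ 2 : ℝ) : ℂ) =
        (G.len e : ℂ) * (conj (y (.inr e)) * y (.inr e)) / 2 := fun e => by
      rw [← integral_complex_ofReal]
      refine Eq.trans (setIntegral_congr_fun (G.measurableSet_dom _) fun x hx => ?_)
        (integral_edgeFun_mul_conj hlam (G.len_pos e).le (hs e) (y (.inr e)) 0 (y (.inr e)) |>.trans
          (by ring))
      simp only [hy1 e hx]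
      rw [Complex.mul_conj, Complex.normSq_eq_norm_sq]
    have h3 : ∀ j, ∫ x in G.dom (.inl j), ‖u (.inl j) x‖ ^ 2 = 0 := fun j => by
      rw [setIntegral_congr_fun (g := fun _ => 0) (G.measurableSet_dom _) fun x hx => by
        simp [hy0 j hx]]
      simp
    have h4 := congrArg (fun r : ℝ => (r : ℂ)) hnorm
    simp only [Fintype.sum_sum_type, h3, Finset.sum_const_zero, zero_add, Complex.ofReal_sum, h1,
      Complex.ofReal_one] at h4
    rw [← Finset.sum_div] at h4
    linear_combination 2 * h4
  have hu0 : ∃ m, ∃ x ∈ G.dom m, u m x ≠ 0 := by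
    by_contra! hcon
    have h0 : ∀ m, ∫ x in G.dom m, ‖u m x‖ ^ 2 = 0 := fun m => by
      rw [setIntegral_congr_fun (g := fun _ => 0) (G.measurableSet_dom _) fun x hx => by
        simp [hcon m x hx]]
      simp
    simp only [h0, Finset.sum_const_zero] at hnorm
    exact zero_ne_one hnorm
  refine ⟨fun e => y (.inr e), ⟨hlam, hs, by rw [← hye]; exact hy, fun x hx => ?_, hN⟩, hy1⟩
  have hxv := hker hx
  obtain ⟨c, hc⟩ := hsimple.2 u _ hu (G.isEigenvector_graphFun hx hxv) hu0
  refine ⟨c, ?_⟩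
  ext (v | e)
  · simp [hxv, edgeVec]
  · have h1 : EqOn (G.graphFun lam x 0 0 (.inr e)) (edgeFun lam 0 (c * y (.inr e)))
        (G.dom (.inr e)) := fun t ht => by
      rw [hc _ t ht, hy1 e ht]; simp only [edgeFun]; ring
    have h2 : EqOn (G.graphFun lam x 0 0 (.inr e)) (edgeFun lam 0 (x (.inr e)))
        (G.dom (.inr e)) := fun t _ => by simp [graphFun, prim_zero, hxv]
    have h3 := G.derivWithin_of_eqOn_edgeFun h1 (G.zero_mem_dom _)
    rw [G.derivWithin_of_eqOn_edgeFun h2 (G.zero_mem_dom _), edgeFun_zero, edgeFun_zero] at h3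
    exact mul_left_cancel₀ hl h3

end Embedded

/-! ### Generalized eigenfunctions near the embedded eigenvalue -/

section Scattering

variable {V L E : Type*} [Fintype V] [DecidableEq V] [Fintype L] [Fintype E]

namespace IsEmbedded

variable {G : QuantumGraph V L E} {lam : ℝ} {B : E → ℂ}

theorem cos_mul_cos (h : G.IsEmbedded lam B) (e : E) :
    Complex.cos (G.phase lam e) * Complex.cos (G.phase lam e) = 1 := by
  have := Complex.sin_sq_add_cos_sq (G.phase lam e)
  rw [h.sin_eq] at this
  linear_combination this

theorem conj_cos (_h : G.IsEmbedded lam B) (e : E) :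
    conj (Complex.cos (G.phase lam e)) = Complex.cos (G.phase lam e) := by
  rw [← Complex.cos_conj, phase]; simp

/-- The vertex conditions for the eigenfunction, tested with `y`. -/
theorem sum_vertex (h : G.IsEmbedded lam B) (y : V → ℂ) :
    ∑ e, B e * (y (G.tgt e) * Complex.cos (G.phase lam e) - y (G.src e)) = 0 := by
  have h1 := G.sum_mul_secular_inl (G.phase lam) (edgeVec B) y
  rw [h.secular_eq] at h1
  simp only [edgeVec, Sum.elim_inl, Sum.elim_inr, Pi.zero_apply, mul_zero, zero_mul, neg_zero,
    zero_add, Finset.sum_const_zero, sub_zero] at h1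
  rw [h1]
  exact Finset.sum_congr rfl fun e _ => by ring

theorem sum_vertex_conj (h : G.IsEmbedded lam B) (y : V → ℂ) :
    ∑ e, conj (B e) * (y (G.tgt e) * Complex.cos (G.phase lam e) - y (G.src e)) = 0 := by
  have h1 := congrArg conj (h.sum_vertex fun v => conj (y v))
  simpa [map_sum, h.conj_cos] using h1

/-- The pairing with the left null vector of the secular map, divided by `μ - lam`. -/
def slope (G : QuantumGraph V L E) (lam : ℝ) (B : E → ℂ) (μ : ℂ) : (V ⊕ E → ℂ) →ₗ[ℂ] ℂ :=
  ∑ e, (Complex.cos (G.phase lam e) * conj (B e)) •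
    (dslope (fun z => Complex.cos (G.phase z e)) lam μ • LinearMap.proj (.inl (G.src e)) +
      dslope (fun z => Complex.sin (G.phase z e)) lam μ • LinearMap.proj (.inr e))

theorem slope_apply (G : QuantumGraph V L E) (lam : ℝ) (B : E → ℂ) (μ : ℂ) (x : V ⊕ E → ℂ) :
    slope G lam B μ x = ∑ e, (Complex.cos (G.phase lam e) * conj (B e)) *
      (dslope (fun z => Complex.cos (G.phase z e)) lam μ * x (.inl (G.src e)) +
        dslope (fun z => Complex.sin (G.phase z e)) lam μ * x (.inr e)) := by
  simp [slope, LinearMap.sum_apply, mul_add]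

/-- The vertex conditions of the conjugate eigenfunction say that the weights `cos(λ ℓ_e) conj B_e`
on the continuity defects annihilate the secular map at `λ`. For other `μ` the pairing is divisible
by `μ - λ`, with a holomorphic quotient. -/
theorem sum_leftNull (h : G.IsEmbedded lam B) (μ : ℂ) (x : V ⊕ E → ℂ) :
    ∑ e, (Complex.cos (G.phase lam e) * conj (B e)) * G.secular (G.phase μ) x (.inr e) =
      (μ - lam) * slope G lam B μ x := by
  rw [slope_apply, Finset.mul_sum, ← sub_eq_zero, ← Finset.sum_sub_distrib]
  rw [← neg_eq_zero, ← h.sum_vertex_conj fun v => x (.inl v), ← Finset.sum_neg_distrib]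
  refine Finset.sum_congr rfl fun e _ => ?_
  have h1 := sub_smul_dslope (fun z => Complex.cos (G.phase z e)) (lam : ℂ) μ
  have h2 := sub_smul_dslope (fun z => Complex.sin (G.phase z e)) (lam : ℂ) μ
  simp only [smul_eq_mul, h.sin_eq, sub_zero] at h1 h2
  rw [secular_inr]
  linear_combination (Complex.cos (G.phase lam e) * conj (B e)) * (x (.inl (G.src e))) * h1 +
    (Complex.cos (G.phase lam e) * conj (B e)) * (x (.inr e)) * h2 -
    conj (B e) * x (.inl (G.src e)) * h.cos_mul_cos e

/-- At `λ` only the derivative of the sine survives. The value is twice the inner product of the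
solution with `u` on the finite edges, so `slope = 0` means orthogonality to `u`. -/
theorem slope_self (h : G.IsEmbedded lam B) (x : V ⊕ E → ℂ) :
    slope G lam B lam x = ∑ e, (G.len e : ℂ) * (conj (B e) * x (.inr e)) := by
  rw [slope_apply]
  refine Finset.sum_congr rfl fun e _ => ?_
  have hp : HasDerivAt (fun z : ℂ => G.phase z e) (G.len e) lam := by
    simpa [phase] using (hasDerivAt_id (lam : ℂ)).mul_const (G.len e : ℂ)
  rw [dslope_same, dslope_same, hp.ccos.deriv, hp.csin.deriv, h.sin_eq]
  linear_combination ((G.len e : ℂ) * conj (B e) * x (.inr e)) * h.cos_mul_cos e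

/-- A vector on which the left null vector of the secular map takes the value `1`. -/
def dualVec (G : QuantumGraph V L E) (lam : ℝ) (B : E → ℂ) : V ⊕ E → ℂ :=
  Sum.elim 0 fun e => Complex.cos (G.phase lam e) * (G.len e : ℂ) * B e / 2

theorem sum_leftNull_dualVec (h : G.IsEmbedded lam B) :
    ∑ e, (Complex.cos (G.phase lam e) * conj (B e)) * dualVec G lam B (.inr e) = 1 := by
  have := h.norm_eq
  rw [← div_eq_one_iff_eq two_ne_zero, Finset.sum_div] at this
  rw [← this]
  refine Finset.sum_congr rfl fun e _ => ?_
  simp only [dualVec, Sum.elim_inr]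
  linear_combination ((G.len e : ℂ) * (conj (B e) * B e) / 2) * h.cos_mul_cos e

/-- The secular map, modified so as to be invertible at the embedded eigenvalue. -/
def modified (G : QuantumGraph V L E) (lam : ℝ) (B : E → ℂ) (μ : ℂ) :
    (V ⊕ E → ℂ) →ₗ[ℂ] (V ⊕ E → ℂ) :=
  G.secular (G.phase μ) + (slope G lam B μ).smulRight (dualVec G lam B)

theorem modified_apply (G : QuantumGraph V L E) (lam : ℝ) (B : E → ℂ) (μ : ℂ)
    (x : V ⊕ E → ℂ) : modified G lam B μ x =
      G.secular (G.phase μ) x + slope G lam B μ x • dualVec G lam B := rfl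

theorem sum_leftNull_modified (h : G.IsEmbedded lam B) (μ : ℂ) (x : V ⊕ E → ℂ) :
    ∑ e, (Complex.cos (G.phase lam e) * conj (B e)) * modified G lam B μ x (.inr e) =
      (μ - lam + 1) * slope G lam B μ x := by
  simp only [modified_apply, Pi.add_apply, Pi.smul_apply, smul_eq_mul, mul_add,
    Finset.sum_add_distrib]
  rw [h.sum_leftNull]
  have h1 := h.sum_leftNull_dualVec
  have h2 : ∑ e, (Complex.cos (G.phase lam e) * conj (B e)) *
      (slope G lam B μ x * dualVec G lam B (.inr e)) = slope G lam B μ x * 1 := by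
    rw [← h1, Finset.mul_sum]
    exact Finset.sum_congr rfl fun e _ => by ring
  rw [h2]; ring

/-- The pairing with the left null vector first gives `slope = 0`; hence `x` is a multiple of the
eigenfunction, and as the latter has slope `2`, the multiple is zero. -/
theorem modified_self_injective (h : G.IsEmbedded lam B) {x : V ⊕ E → ℂ}
    (hx : modified G lam B lam x = 0) : x = 0 := by
  have h1 := h.sum_leftNull_modified lam x
  simp only [hx, Pi.zero_apply, mul_zero, Finset.sum_const_zero, sub_self, zero_add, one_mul] at h1
  rw [modified_apply, ← h1, zero_smul, add_zero] at hx
  obtain ⟨c, rfl⟩ := h.ker x hx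
  have h2 : (0 : ℂ) = c * 2 := by
    rw [h1, h.slope_self, ← h.norm_eq, Finset.mul_sum]
    refine Finset.sum_congr rfl fun e _ => ?_
    simp [edgeVec]; ring
  have : c = 0 := by simpa using h2.symm
  simp [this]

open Classical in
/-- The matrix of the modified secular map. -/
def modifiedMatrix (G : QuantumGraph V L E) (lam : ℝ) (B : E → ℂ) (μ : ℂ) :
    Matrix (V ⊕ E) (V ⊕ E) ℂ :=
  LinearMap.toMatrix' (modified G lam B μ)

theorem modifiedMatrix_mulVec (G : QuantumGraph V L E) (lam : ℝ) (B : E → ℂ) (μ : ℂ)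
    (x : V ⊕ E → ℂ) : (modifiedMatrix G lam B μ).mulVec x = modified G lam B μ x := by
  classical
  exact LinearMap.toMatrix'_mulVec _ _

theorem differentiable_modifiedMatrix (G : QuantumGraph V L E) (lam : ℝ) (B : E → ℂ)
    (i j : V ⊕ E) : Differentiable ℂ fun μ => modifiedMatrix G lam B μ i j := by
  classical
  simp only [modifiedMatrix, LinearMap.toMatrix'_apply, modified_apply, Pi.add_apply,
    Pi.smul_apply, smul_eq_mul, slope_apply]
  refine (G.differentiable_secular_apply _ i).add (Differentiable.mul_const ?_ _)
  refine Differentiable.fun_sum fun e _ => Differentiable.const_mul ?_ _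
  have hd : ∀ f : ℂ → ℂ, Differentiable ℂ f → Differentiable ℂ (dslope f lam) := fun f hf => by
    rw [← differentiableOn_univ, Complex.differentiableOn_dslope univ_mem]
    exact hf.differentiableOn
  have h1 := hd (fun z => Complex.cos (G.phase z e)) (by unfold phase; fun_prop)
  have h2 := hd (fun z => Complex.sin (G.phase z e)) (by unfold phase; fun_prop)
  exact (h1.mul_const _).add (h2.mul_const _)

open Classical in
/-- A neighbourhood of `lam` in which the modified secular map is invertible. -/
def goodSet (G : QuantumGraph V L E) (lam : ℝ) (B : E → ℂ) : Set ℂ :=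
  {μ | (modifiedMatrix G lam B μ).det ≠ 0 ∧ μ - lam + 1 ≠ 0 ∧ μ ≠ 0}

theorem isOpen_goodSet (G : QuantumGraph V L E) (lam : ℝ) (B : E → ℂ) :
    IsOpen (goodSet G lam B) := by
  classical
  have hd := (differentiable_det (differentiable_modifiedMatrix G lam B)).continuous
  refine IsOpen.inter ?_ (IsOpen.inter ?_ isOpen_ne)
  · exact isOpen_ne_fun hd continuous_const
  · exact isOpen_ne_fun (by fun_prop) continuous_const

theorem mem_goodSet (h : G.IsEmbedded lam B) : (lam : ℂ) ∈ goodSet G lam B := by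
  classical
  refine ⟨fun hdet => ?_, by simp, Complex.ofReal_ne_zero.2 h.ne_zero⟩
  obtain ⟨x, hx, hx0⟩ := Matrix.exists_mulVec_eq_zero_iff.2 hdet
  rw [modifiedMatrix_mulVec] at hx0
  exact hx (h.modified_self_injective hx0)

theorem eq_zero_of_modified {μ : ℂ} (hμ : μ ∈ goodSet G lam B) {x : V ⊕ E → ℂ}
    (hx : modified G lam B μ x = 0) : x = 0 := by
  classical
  by_contra hne
  exact hμ.1 (Matrix.exists_mulVec_eq_zero_iff.1 ⟨x, hne, by rwa [modifiedMatrix_mulVec]⟩)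

theorem slope_eq_zero (h : G.IsEmbedded lam B) {μ : ℂ} (hμ : μ ≠ lam) {x : V ⊕ E → ℂ}
    (hx : ∀ e, G.secular (G.phase μ) x (.inr e) = 0) : slope G lam B μ x = 0 := by
  have := h.sum_leftNull μ x
  simp only [hx, mul_zero, Finset.sum_const_zero] at this
  exact (mul_eq_zero.1 this.symm).resolve_left (sub_ne_zero.2 hμ)

/-- The secular map is injective near the embedded eigenvalue. -/
theorem secular_injective (h : G.IsEmbedded lam B) {μ : ℂ} (hμ : μ ∈ goodSet G lam B)
    (hne : μ ≠ lam) {x : V ⊕ E → ℂ} (hx : G.secular (G.phase μ) x = 0) : x = 0 := by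
  refine eq_zero_of_modified hμ ?_
  rw [modified_apply, hx, h.slope_eq_zero hne fun e => by rw [hx]; rfl]
  simp

end IsEmbedded

variable [DecidableEq L]

/-- The right-hand side of the secular equation for an incoming wave on the lead `k`. -/
def incoming (G : QuantumGraph V L E) (k : L) : V ⊕ E → ℂ :=
  Sum.elim (fun v => if G.base k = v then -2 * Complex.I else 0) 0

theorem sum_incoming (G : QuantumGraph V L E) (k : L) (v : V) :
    (∑ j, if G.base j = v then (if j = k then -2 * Complex.I else 0) else 0) =
      G.incoming k (.inl v) := by
  simp only [incoming, Sum.elim_inl]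
  rw [Finset.sum_eq_single k (fun j _ hj => by simp [hj]) (by simp)]
  simp

/-- On the lead `j` the value is `δ + s` and the derivative `iμ(s - δ)`, so `κ - i · value = -2iδ`:
the unknown scattering coefficients drop out and only the incoming wave remains as right-hand side.
-/
theorem IsScatteringSolution.exists_coeff {G : QuantumGraph V L E} {k : L} {μ : ℂ} (hμ : μ ≠ 0)
    {w : L ⊕ E → ℝ → ℂ} (hw : G.IsScatteringSolution k μ w) :
    ∃ x : V ⊕ E → ℂ, G.secular (G.phase μ) x = G.incoming k ∧
      ∀ e, EqOn (w (.inr e)) (edgeFun μ (x (.inl (G.src e))) (x (.inr e))) (G.dom (.inr e)) := by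
  obtain ⟨hD, s, hs⟩ := hw
  have hlead : ∀ j, EqOn (w (.inl j)) (edgeFun μ ((if j = k then 1 else 0) + s j)
      (Complex.I * (s j - if j = k then 1 else 0))) (G.dom (.inl j)) := fun j y hy => by
    rw [hs j y hy]
    have h1 : Complex.exp (Complex.I * μ * y) =
        Complex.cos (μ * y) + Complex.sin (μ * y) * Complex.I := by
      rw [← Complex.exp_mul_I]; ring_nf
    have h2 : Complex.exp (-(Complex.I * μ * y)) =
        Complex.cos (μ * y) - Complex.sin (μ * y) * Complex.I := by
      have := Complex.exp_mul_I (-(μ * y))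
      rw [Complex.cos_neg, Complex.sin_neg] at this
      rw [show -(Complex.I * μ * y) = -(μ * y) * Complex.I by ring, this]; ring
    rw [h1, h2, edgeFun]
    split_ifs <;> ring
  obtain ⟨x, hx0, hx1, hx2, hx3⟩ := G.exists_coeff_of_isDomLoc hμ hD
    (fun j => Complex.I * (s j - if j = k then 1 else 0)) (fun j => by
      rw [G.derivWithin_of_eqOn_edgeFun (hlead j) (G.zero_mem_dom _), edgeFun_zero])
  refine ⟨x, ?_, hx1⟩
  ext (v | e)
  · rw [hx3, ← sum_incoming]
    refine Finset.sum_congr rfl fun j _ => ?_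
    rw [← hx0, hlead j (G.zero_mem_dom _), edgeFun_zero]
    split_ifs <;> ring
  · rw [hx2]; rfl

theorem isScatteringSolution_graphFun (G : QuantumGraph V L E) {k : L} {μ : ℂ}
    {x : V ⊕ E → ℂ} (hx : G.secular (G.phase μ) x = G.incoming k) :
    G.IsScatteringSolution k μ (G.graphFun μ x
      (fun j => Complex.I * x (.inl (G.base j)) + if j = k then -2 * Complex.I else 0) 0) := by
  refine ⟨G.isDomLoc_graphFun_zero (fun e => by rw [hx]; rfl) (fun v => ?_),
    fun j => x (.inl (G.base j)) - if j = k then 1 else 0, fun j y _ => ?_⟩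
  · rw [hx, ← sum_incoming]
    exact Finset.sum_congr rfl fun j _ => by rw [add_sub_cancel_left]
  · have h1 : Complex.exp (Complex.I * μ * y) =
        Complex.cos (μ * y) + Complex.sin (μ * y) * Complex.I := by
      rw [← Complex.exp_mul_I]; ring_nf
    have h2 : Complex.exp (-(Complex.I * μ * y)) =
        Complex.cos (μ * y) - Complex.sin (μ * y) * Complex.I := by
      have := Complex.exp_mul_I (-(μ * y))
      rw [Complex.cos_neg, Complex.sin_neg] at this
      rw [show -(Complex.I * μ * y) = -(μ * y) * Complex.I by ring, this]; ring
    rw [h1, h2]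
    simp only [graphFun, Sum.elim_inl, edgeFun]
    split_ifs <;> ring

namespace IsEmbedded

variable {G : QuantumGraph V L E} {lam : ℝ} {B : E → ℂ}

open Classical in
/-- The coefficients of the generalized eigenfunctions near the embedded eigenvalue. -/
def scatteringCoeff (G : QuantumGraph V L E) (lam : ℝ) (B : E → ℂ) (k : L) (μ : ℂ) : V ⊕ E → ℂ :=
  (modifiedMatrix G lam B μ)⁻¹.mulVec (G.incoming k)

theorem differentiableOn_scatteringCoeff (G : QuantumGraph V L E) (lam : ℝ) (B : E → ℂ) (k : L)
    (i : V ⊕ E) :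
    DifferentiableOn ℂ (fun μ => scatteringCoeff G lam B k μ i) (goodSet G lam B) := by
  classical
  have hA := differentiable_modifiedMatrix G lam B
  simp only [scatteringCoeff, Matrix.mulVec, dotProduct, Matrix.inv_def, Ring.inverse_eq_inv',
    Matrix.smul_apply, smul_eq_mul]
  refine DifferentiableOn.fun_sum fun j _ => DifferentiableOn.mul_const ?_ _
  exact ((differentiable_det hA).differentiableOn.fun_inv fun μ hμ => hμ.1).fun_mul
    (differentiable_adjugate hA i j).differentiableOn

theorem modified_scatteringCoeff {μ : ℂ} (hμ : μ ∈ goodSet G lam B) (k : L) :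
    modified G lam B μ (scatteringCoeff G lam B k μ) = G.incoming k := by
  classical
  rw [← modifiedMatrix_mulVec, scatteringCoeff, Matrix.mulVec_mulVec,
    Matrix.mul_nonsing_inv _ (Ne.isUnit hμ.1), Matrix.one_mulVec]

/-- An incoming wave causes no continuity defect, so the pairing gives `(μ - λ + 1) · slope = 0`.
The modification is therefore invisible on these vectors, and at `λ` the extended `e^k` is
orthogonal to `u`. -/
theorem slope_scatteringCoeff (h : G.IsEmbedded lam B) {μ : ℂ} (hμ : μ ∈ goodSet G lam B)
    (k : L) : slope G lam B μ (scatteringCoeff G lam B k μ) = 0 := by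
  have h1 := h.sum_leftNull_modified μ (scatteringCoeff G lam B k μ)
  rw [modified_scatteringCoeff hμ] at h1
  simp only [incoming, Sum.elim_inr, Pi.zero_apply, mul_zero, Finset.sum_const_zero] at h1
  exact (mul_eq_zero.1 h1.symm).resolve_left hμ.2.1

theorem secular_scatteringCoeff (h : G.IsEmbedded lam B) {μ : ℂ} (hμ : μ ∈ goodSet G lam B)
    (k : L) : G.secular (G.phase μ) (scatteringCoeff G lam B k μ) = G.incoming k := by
  have h1 := modified_scatteringCoeff hμ k
  rwa [modified_apply, h.slope_scatteringCoeff hμ, zero_smul, add_zero] at h1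

theorem isScatteringSolution (h : G.IsEmbedded lam B) {μ : ℂ} (hμ : μ ∈ goodSet G lam B)
    (k : L) : G.IsScatteringSolution k μ (G.graphFun μ (scatteringCoeff G lam B k μ)
      (fun j => Complex.I * scatteringCoeff G lam B k μ (.inl (G.base j)) +
        if j = k then -2 * Complex.I else 0) 0) :=
  G.isScatteringSolution_graphFun (h.secular_scatteringCoeff hμ k)

theorem exists_isGeneralizedEigenfunction (h : G.IsEmbedded lam B) (k : L) :
    ∃ w, G.IsGeneralizedEigenfunction k lam w := by
  have hX := differentiableOn_scatteringCoeff G lam B k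
  refine ⟨_, goodSet G lam B, isOpen_goodSet G lam B, h.mem_goodSet,
    fun μ => G.graphFun μ (scatteringCoeff G lam B k μ)
      (fun j => Complex.I * scatteringCoeff G lam B k μ (.inl (G.base j)) +
        if j = k then -2 * Complex.I else 0) 0, ?_,
    fun μ hμ _ => h.isScatteringSolution hμ k, fun m x _ => rfl⟩
  rintro (j | e) x _
  · have := hX (.inl (G.base j))
    simp only [graphFun, Sum.elim_inl, edgeFun]
    fun_prop
  · have h1 := hX (.inl (G.src e))
    have h2 := hX (.inr e)
    simp only [graphFun, Sum.elim_inr, edgeFun, prim_zero, Pi.zero_apply]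
    fun_prop

/-- The definition of `e^k(λ)` constrains a family only off the eigenvalues; this provides a
punctured neighbourhood of `λ` where it does. -/
theorem not_isEigenvalue (h : G.IsEmbedded lam B) {μ : ℝ} (hμ : (μ : ℂ) ∈ goodSet G lam B)
    (hne : μ ≠ lam) : ¬ G.IsEigenvalue ((μ : ℂ) ^ 2) := by
  rintro ⟨w, hw, m, y, hy, hne0⟩
  have hμ0 : μ ≠ 0 := Complex.ofReal_ne_zero.1 hμ.2.2
  obtain ⟨x, hx, hl, he⟩ := hw.exists_coeff hμ0
  have hx0 := h.secular_injective hμ (by exact_mod_cast hne) hx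
  rcases m with j | e
  · exact hne0 (hl j hy)
  · exact hne0 (by rw [he e hy, hx0]; simp [edgeFun])

/-- The generalized eigenfunctions at the embedded eigenvalue on the finite edges. -/
theorem eqOn_of_isGeneralizedEigenfunction (h : G.IsEmbedded lam B) {k : L}
    {w : L ⊕ E → ℝ → ℂ} (hw : G.IsGeneralizedEigenfunction k lam w) (e : E) :
    EqOn (w (.inr e)) (edgeFun lam (scatteringCoeff G lam B k lam (.inl (G.src e)))
      (scatteringCoeff G lam B k lam (.inr e))) (G.dom (.inr e)) := by
  obtain ⟨U, hU, hlU, Φ, hΦd, hΦs, hΦe⟩ := hw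
  intro y hy
  rw [hΦe _ y hy]
  set X := scatteringCoeff G lam B k with hX
  have hreal : Tendsto (fun μ : ℝ => (μ : ℂ)) (𝓝[≠] lam) (𝓝 (lam : ℂ)) :=
    (Complex.continuous_ofReal.tendsto lam).mono_left nhdsWithin_le_nhds
  have h1 : Tendsto (fun μ : ℝ => Φ μ (.inr e) y) (𝓝[≠] lam) (𝓝 (Φ lam (.inr e) y)) :=
    ((hΦd _ y hy).continuousOn.continuousAt (hU.mem_nhds hlU)).tendsto.comp hreal
  have hXd := fun i => differentiableOn_scatteringCoeff G lam B k i
  have h2 : Tendsto (fun μ : ℝ => edgeFun μ (X μ (.inl (G.src e))) (X μ (.inr e)) y) (𝓝[≠] lam)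
      (𝓝 (edgeFun lam (X lam (.inl (G.src e))) (X lam (.inr e)) y)) := by
    have hd : DifferentiableOn ℂ (fun μ : ℂ => edgeFun μ (X μ (.inl (G.src e))) (X μ (.inr e)) y)
        (goodSet G lam B) := by
      have h3 := hXd (.inl (G.src e))
      have h4 := hXd (.inr e)
      simp only [edgeFun]
      fun_prop
    exact (hd.continuousOn.continuousAt ((isOpen_goodSet G lam B).mem_nhds
      h.mem_goodSet)).tendsto.comp hreal
  -- Any admissible family agrees with the explicit one at real `μ ≠ λ` near `λ`, by injectivity of
  -- the secular map; both are continuous at `λ`.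
  refine tendsto_nhds_unique h1 (h2.congr' ?_)
  filter_upwards [hreal (hU.mem_nhds hlU),
    hreal ((isOpen_goodSet G lam B).mem_nhds h.mem_goodSet), self_mem_nhdsWithin] with μ hμU hμ (hne : μ ≠ lam)
  obtain ⟨x, hx, hxe⟩ := (hΦs μ hμU (h.not_isEigenvalue hμ hne)).exists_coeff hμ.2.2
  have hxX : x = X μ := by
    rw [← sub_eq_zero]
    refine h.secular_injective (μ := (μ : ℂ)) hμ (by exact_mod_cast hne) ?_
    rw [map_sub, hx, h.secular_scatteringCoeff hμ, sub_self]
  rw [hxe e hy, hxX]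

/-- The boundary terms cancel on each finite edge. -/
theorem boundaryTerm_eq_zero (h : G.IsEmbedded lam B) {u : L ⊕ E → ℝ → ℂ}
    (hu : ∀ e, EqOn (u (.inr e)) (edgeFun lam 0 (B e)) (G.dom (.inr e))) {k : L}
    {w : L ⊕ E → ℝ → ℂ} (hw : G.IsGeneralizedEigenfunction k lam w) (c : E → ℝ) :
    G.boundaryTerm (Sum.elim (fun _ => 0) c) u w = 0 := by
  have hwe := h.eqOn_of_isGeneralizedEigenfunction hw
  have h1 : G.boundaryTerm (Sum.elim (fun _ => 0) c) u w =
      ∑ p, (1 / 4 : ℂ) * (((Sum.elim (fun _ => 0) c : L ⊕ E → ℝ) (endEdge p) : ℝ) : ℂ) *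
        (3 * G.endNormalDeriv u p * conj (G.endValue w p) -
          G.endValue u p * conj (G.endNormalDeriv w p)) := by
    rw [boundaryTerm]
    exact Finset.sum_fiberwise _ _ _
  rw [h1, Fintype.sum_sum_type, Fintype.sum_sum_type, ← Finset.sum_add_distrib]
  have h2 : ∀ e, edgeFun lam 0 (B e) (G.len e) = 0 := fun e => by
    have := h.sin_eq e
    rw [phase] at this
    simp [edgeFun, this]
  rw [Finset.sum_eq_zero (fun j _ => by simp [endEdge]), zero_add]
  refine Finset.sum_eq_zero fun e _ => ?_
  simp only [endNormalDeriv, endValue, endEdge, endPos, endSign, Sum.elim_inr,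
    hu e (G.zero_mem_dom _), hu e (G.len_mem_dom e), hwe e (G.zero_mem_dom _),
    hwe e (G.len_mem_dom e), G.derivWithin_of_eqOn_edgeFun (hu e) (G.zero_mem_dom _),
    G.derivWithin_of_eqOn_edgeFun (hu e) (G.len_mem_dom e), h2, edgeFun_zero]
  have h3 := h.sin_eq e
  have h4 := h.conj_cos e
  have h5 := h.cos_mul_cos e
  rw [phase] at h3 h4 h5
  simp only [edgeFun, h3, map_add, map_mul, h4]
  simp
  -- As `u` vanishes at both ends, only the terms with `∂_ν u` remain: `-λB conj A` at `src e` and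
  -- `λB σ · σ conj A` at `tgt e`, where `σ = cos λℓ`, `σ² = 1` and `A` is the value of `e^k` at
  -- `src e`.
  linear_combination (c e * 3 * lam * B e * conj (scatteringCoeff G lam B k lam
    (.inl (G.src e)))) / 4 * h5

theorem weightedInner_eq (h : G.IsEmbedded lam B) {u : L ⊕ E → ℝ → ℂ}
    (hu : ∀ e, EqOn (u (.inr e)) (edgeFun lam 0 (B e)) (G.dom (.inr e))) {k : L}
    {w : L ⊕ E → ℝ → ℂ} (hw : G.IsGeneralizedEigenfunction k lam w) (c : E → ℝ) :
    G.weightedInner (Sum.elim (fun _ => 0) c) u w =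
      ∑ e, (c e : ℂ) * (B e * conj (scatteringCoeff G lam B k lam (.inr e)) * G.len e / 2) := by
  have hwe := h.eqOn_of_isGeneralizedEigenfunction hw
  rw [weightedInner, Fintype.sum_sum_type, Finset.sum_eq_zero (fun j _ => by simp), zero_add]
  refine Finset.sum_congr rfl fun e _ => ?_
  rw [Sum.elim_inr]
  congr 1
  rw [← integral_edgeFun_mul_conj h.ne_zero (G.len_pos e).le (h.sin_eq e) (B e)
    (scatteringCoeff G lam B k lam (.inl (G.src e)))]
  refine setIntegral_congr_fun (G.measurableSet_dom _) fun x hx => ?_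
  simp only [hu e hx, hwe e hx]

end IsEmbedded

end Scattering

/-! ### Perturbation theory to second order -/

section Perturbation

variable {V L E : Type*} [Fintype V] [DecidableEq V] [Fintype L] [Fintype E]

theorem hasDerivAt_sin_comp {f : ℝ → ℂ} {f' : ℂ} {t : ℝ} (hf : HasDerivAt f f' t) :
    HasDerivAt (fun s => Complex.sin (f s)) (Complex.cos (f t) * f') t :=
  (Complex.hasDerivAt_sin (f t)).comp t hf

theorem hasDerivAt_cos_comp {f : ℝ → ℂ} {f' : ℂ} {t : ℝ} (hf : HasDerivAt f f' t) :
    HasDerivAt (fun s => Complex.cos (f s)) (-Complex.sin (f t) * f') t :=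
  (Complex.hasDerivAt_cos (f t)).comp t hf

theorem eventually_hasDerivAt_deriv {f : ℝ → ℂ} {t : ℝ} (hf : ContDiffAt ℝ 2 f t) :
    (∀ᶠ s in 𝓝 t, HasDerivAt f (deriv f s) s) ∧ HasDerivAt (deriv f) (deriv (deriv f) t) t := by
  constructor
  · filter_upwards [hf.eventually (by simp)] with s hs
    exact (hs.differentiableAt (by norm_num)).hasDerivAt
  · exact ((hf.derivWithin (m := 1) (by norm_num)).differentiableAt (by norm_num)).hasDerivAt

namespace IsEmbedded

variable {G : QuantumGraph V L E} {lam : ℝ} {B : E → ℂ}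

/-- As `x 0` vanishes at the vertices, the variation of the phase acts only through the sine term.
-/
theorem hasDerivAt_secular_inr (h : G.IsEmbedded lam B) {x : ℝ → V ⊕ E → ℂ} {θ : ℝ → E → ℂ}
    {y : V ⊕ E → ℂ} {η : E → ℂ} (hx0 : x 0 = edgeVec B) (hθ0 : θ 0 = G.phase lam)
    (hx : ∀ i, HasDerivAt (fun t => x t i) (y i) 0)
    (hθ : ∀ e, HasDerivAt (fun t => θ t e) (η e) 0) (e : E) :
    HasDerivAt (fun t => G.secular (θ t) (x t) (.inr e))
      (G.secular (G.phase lam) y (.inr e) + Complex.cos (G.phase lam e) * B e * η e) 0 := by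
  simp only [secular_inr]
  convert! (((hx (.inl (G.src e))).mul (hasDerivAt_cos_comp (hθ e))).add
    ((hx (.inr e)).mul (hasDerivAt_sin_comp (hθ e)))).sub (hx (.inl (G.tgt e))) using 1
  simp [hx0, hθ0, edgeVec, h.sin_eq]
  ring

/-- The phase derivative of `-A sin θ + B cos θ` is `-A cos θ - B sin θ`, which is zero for the
eigenfunction; to first order the vertex conditions do not see the phases. -/
theorem hasDerivAt_secular_inl (h : G.IsEmbedded lam B) {x : ℝ → V ⊕ E → ℂ} {θ : ℝ → E → ℂ}
    {y : V ⊕ E → ℂ} {η : E → ℂ} (hx0 : x 0 = edgeVec B) (hθ0 : θ 0 = G.phase lam)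
    (hx : ∀ i, HasDerivAt (fun t => x t i) (y i) 0)
    (hθ : ∀ e, HasDerivAt (fun t => θ t e) (η e) 0) (v : V) :
    HasDerivAt (fun t => G.secular (θ t) (x t) (.inl v)) (G.secular (G.phase lam) y (.inl v)) 0 := by
  have hite : ∀ (p : Prop) [Decidable p] {f : ℝ → ℂ} {f' : ℂ}, HasDerivAt f f' 0 →
      HasDerivAt (fun t => if p then f t else 0) (if p then f' else 0) 0 := by
    intro p _ f f' hf
    split_ifs
    · exact hf
    · exact hasDerivAt_const _ _
  simp only [secular_inl]
  refine ((HasDerivAt.fun_sum fun e _ => hite _ ?_).sub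
    (HasDerivAt.fun_sum fun e _ => hite _ (hx _))).sub
    ((HasDerivAt.fun_sum fun j _ => hite _ (hx _)).const_mul _)
  convert! ((hx (.inl (G.src e))).mul (hasDerivAt_sin_comp (hθ e))).neg.add
    ((hx (.inr e)).mul (hasDerivAt_cos_comp (hθ e))) using 1
  simp [hx0, hθ0, edgeVec, h.sin_eq]

/-- The linearized system at the embedded eigenvalue has no nontrivial solution. -/
theorem linearized_injective (h : G.IsEmbedded lam B) {y : V ⊕ E → ℂ} {ν : ℂ}
    (hv : ∀ v, G.secular (G.phase lam) y (.inl v) = 0)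
    (he : ∀ e, G.secular (G.phase lam) y (.inr e) +
      Complex.cos (G.phase lam e) * B e * (ν * G.len e) = 0)
    (hn : ∑ e, (G.len e : ℂ) * (conj (B e) * y (.inr e)) = 0) : y = 0 ∧ ν = 0 := by
  -- Pairing with the left null vector leaves `2ν = 0`. Then `y` is a multiple of the eigenfunction,
  -- and the normalization `hn` kills it.
  have h1 := h.sum_leftNull lam y
  rw [sub_self, zero_mul] at h1
  have hν : ν = 0 := by
    have h2 : ∑ e, (Complex.cos (G.phase lam e) * conj (B e)) *
        G.secular (G.phase lam) y (.inr e) = -(ν * 2) := by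
      rw [← h.norm_eq, Finset.mul_sum, ← Finset.sum_neg_distrib]
      refine Finset.sum_congr rfl fun e _ => ?_
      linear_combination (Complex.cos (G.phase lam e) * conj (B e)) * he e -
        (ν * G.len e * conj (B e) * B e) * h.cos_mul_cos e
    rw [h2] at h1
    simpa using h1
  refine ⟨?_, hν⟩
  obtain ⟨c, rfl⟩ := h.ker y (by
    ext (v | e)
    · exact hv v
    · simpa [hν] using he e)
  have h3 : c * 2 = 0 := by
    rw [← hn, ← h.norm_eq, Finset.mul_sum]
    refine Finset.sum_congr rfl fun e _ => ?_
    simp [edgeVec]; ring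
  have : c = 0 := by simpa using h3
  simp [this]

/-- The golden rule for a smooth family of outgoing solutions through the embedded eigenvalue. -/
theorem golden_rule [DecidableEq L] (h : G.IsEmbedded lam B) {x : ℝ → V ⊕ E → ℂ} {Λ : ℝ → ℂ}
    {r : E → ℝ → ℂ} {c b : E → ℝ} (hx : ∀ i, ContDiffAt ℝ 2 (fun t => x t i) 0)
    (hΛ : ContDiffAt ℝ 2 Λ 0) (hr : ∀ e, ContDiffAt ℝ 2 (r e) 0) (hx0 : x 0 = edgeVec B)
    (hΛ0 : Λ 0 = lam) (hr0 : ∀ e, r e 0 = 1) (hr1 : ∀ e, deriv (r e) 0 = -(c e : ℂ))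
    (hr2 : ∀ e, deriv (deriv (r e)) 0 = b e)
    (hsec : ∀ᶠ t in 𝓝 0, G.secular (fun e => Λ t * G.len e * r e t) (x t) = 0)
    {X : L → V ⊕ E → ℂ} (hX : ∀ k, G.secular (G.phase lam) (X k) = G.incoming k)
    (hXB : ∀ k, ∑ e, (G.len e : ℂ) * (conj (B e) * X k (.inr e)) = 0) :
    (deriv (deriv Λ) 0).im = -∑ k, ‖(lam : ℂ) *
      ∑ e, (c e : ℂ) * (B e * conj (X k (.inr e)) * G.len e / 2)‖ ^ 2 := by
  have hσ := h.cos_mul_cos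
  have hσc := h.conj_cos
  set y : V ⊕ E → ℂ := fun i => deriv (fun t => x t i) 0 with hy
  set z : V ⊕ E → ℂ := fun i => deriv (deriv fun t => x t i) 0 with hz
  set Λ₁ := deriv Λ 0 with hΛ₁
  set Λ₂ := deriv (deriv Λ) 0 with hΛ₂
  set θ : ℝ → E → ℂ := fun t e => Λ t * G.len e * r e t with hθ
  have hθ0 : θ 0 = G.phase lam := by ext e; simp [hθ, hΛ0, hr0, phase]
  obtain ⟨hΛd, hΛdd⟩ := eventually_hasDerivAt_deriv hΛ
  have hxd := fun i => eventually_hasDerivAt_deriv (hx i)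
  have hrd := fun e => eventually_hasDerivAt_deriv (hr e)
  have hθd : ∀ e, ∀ᶠ t in 𝓝 0, HasDerivAt (fun t => θ t e)
      (deriv Λ t * G.len e * r e t + Λ t * G.len e * deriv (r e) t) t := fun e => by
    filter_upwards [hΛd, (hrd e).1] with t h1 h2
    exact (h1.mul_const _).mul h2
  set η : E → ℂ := fun e => (G.len e : ℂ) * (Λ₁ - lam * c e) with hη
  have hθ1 : ∀ e, HasDerivAt (fun t => θ t e) (η e) 0 := fun e => by
    convert! (hθd e).self_of_nhds using 1
    rw [hΛ0, hr0, hr1, hη]; ring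
  have hx1 : ∀ i, HasDerivAt (fun t => x t i) (y i) 0 := fun i => (hxd i).1.self_of_nhds
  have hzero : ∀ i, HasDerivAt (fun t => G.secular (θ t) (x t) i) 0 0 := fun i =>
    (hasDerivAt_const (0 : ℝ) (0 : ℂ)).congr_of_eventuallyEq
      (hsec.mono fun t ht => congrFun ht i)
  -- first order
  have hE1 : ∀ e, y (.inl (G.src e)) * Complex.cos (G.phase lam e) - y (.inl (G.tgt e)) +
      Complex.cos (G.phase lam e) * B e * η e = 0 := fun e => by
    have h1 := (h.hasDerivAt_secular_inr hx0 hθ0 hx1 hθ1 e).unique (hzero (.inr e))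
    rw [secular_inr, h.sin_eq] at h1
    linear_combination h1
  have hV1 : ∀ v, G.secular (G.phase lam) y (.inl v) = 0 := fun v =>
    (h.hasDerivAt_secular_inl hx0 hθ0 hx1 hθ1 v).unique (hzero (.inl v))
  have hBη : ∀ e, B e * η e =
      y (.inl (G.tgt e)) * Complex.cos (G.phase lam e) - y (.inl (G.src e)) := fun e => by
    linear_combination Complex.cos (G.phase lam e) * hE1 e -
      (y (.inl (G.src e)) + B e * η e) * hσ e
  have hpair : ∀ w : V → ℂ, ∑ e, y (.inr e) *
      (w (G.tgt e) * Complex.cos (G.phase lam e) - w (G.src e)) =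
      Complex.I * ∑ j, w (G.base j) * y (.inl (G.base j)) := fun w => by
    have h1 := G.sum_mul_secular_inl (G.phase lam) y w
    simp only [hV1, mul_zero, Finset.sum_const_zero, h.sin_eq, neg_zero, zero_add] at h1
    rw [eq_comm, sub_eq_zero] at h1
    rw [← h1]
    exact Finset.sum_congr rfl fun e _ => by ring
  have hBB : ∀ e, conj (B e) * B e = (Complex.normSq (B e) : ℂ) := fun e =>
    (Complex.normSq_eq_conj_mul_self).symm
  -- Solvability of the first-order system: `2 Λ₁ = λ ∑ ℓ |B|² c`. Consequently the first variations
  -- `η` of the phases are real, which the flux identity `hflux` requires.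
  have hΛ₁im : Λ₁.im = 0 := by
    have h1 : ∑ e, conj (B e) * (B e * η e) = 0 := by
      simp only [hBη]
      exact h.sum_vertex_conj fun v => y (.inl v)
    have h2 : Λ₁ * 2 = ((∑ e, G.len e * Complex.normSq (B e) * (lam * c e) : ℝ) : ℂ) := by
      rw [← h.norm_eq, Finset.mul_sum, ← sub_eq_zero, Complex.ofReal_sum,
        ← Finset.sum_sub_distrib, ← h1]
      refine Finset.sum_congr rfl fun e _ => ?_
      push_cast
      rw [← hBB]
      simp only [hη]; ring
    have h3 := congrArg Complex.im h2
    simp only [Complex.ofReal_im, Complex.mul_im] at h3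
    simpa using h3
  have hηc : ∀ e, conj (η e) = η e := fun e => by
    have : conj Λ₁ = Λ₁ := Complex.conj_eq_iff_im.2 hΛ₁im
    simp only [hη, map_mul, map_sub, Complex.conj_ofReal, this]
  -- second order
  have hE2 : ∀ e, z (.inl (G.src e)) * Complex.cos (G.phase lam e) - z (.inl (G.tgt e)) +
      2 * Complex.cos (G.phase lam e) * y (.inr e) * η e +
      Complex.cos (G.phase lam e) * B e * ((G.len e : ℂ) * (Λ₂ - 2 * Λ₁ * c e + lam * b e)) = 0 :=
    fun e => by
    set θ' : ℝ → ℂ := fun t => deriv Λ t * G.len e * r e t + Λ t * G.len e * deriv (r e) t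
      with hθ'
    have h1 : ∀ᶠ t in 𝓝 (0 : ℝ), (deriv (fun t => x t (.inl (G.src e))) t * Complex.cos (θ t e) +
        x t (.inl (G.src e)) * (-Complex.sin (θ t e) * θ' t) +
        (deriv (fun t => x t (.inr e)) t * Complex.sin (θ t e) +
        x t (.inr e) * (Complex.cos (θ t e) * θ' t)) -
        deriv (fun t => x t (.inl (G.tgt e))) t) = 0 := by
      filter_upwards [(hxd (.inl (G.src e))).1, (hxd (.inr e)).1, (hxd (.inl (G.tgt e))).1, hθd e,
        hsec.eventually_nhds] with t h2 h3 h4 h5 h6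
      have h7 := ((h2.mul (hasDerivAt_cos_comp h5)).add (h3.mul (hasDerivAt_sin_comp h5))).sub h4
      have h8 : HasDerivAt (fun t => G.secular (θ t) (x t) (.inr e)) 0 t :=
        (hasDerivAt_const t (0 : ℂ)).congr_of_eventuallyEq
          (h6.mono fun s hs => congrFun hs (.inr e))
      exact h7.unique h8
    have hθ2 : HasDerivAt θ' ((G.len e : ℂ) * (Λ₂ - 2 * Λ₁ * c e + lam * b e)) 0 := by
      convert! ((hΛdd.mul_const (G.len e : ℂ)).mul ((hrd e).1.self_of_nhds)).add
        ((hΛd.self_of_nhds.mul_const (G.len e : ℂ)).mul (hrd e).2) using 1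
      rw [hΛ0, hr0, hr1, hr2]; ring
    have hθ'0 : θ' 0 = η e := by
      simp only [hθ', hΛ0, hr0, hr1, hη]; ring
    have h2 := ((((hxd (.inl (G.src e))).2.mul (hasDerivAt_cos_comp (hθ1 e))).add
      ((hx1 (.inl (G.src e))).mul ((hasDerivAt_sin_comp (hθ1 e)).neg.mul hθ2))).add
      (((hxd (.inr e)).2.mul (hasDerivAt_sin_comp (hθ1 e))).add
      ((hx1 (.inr e)).mul ((hasDerivAt_cos_comp (hθ1 e)).mul hθ2)))).sub (hxd (.inl (G.tgt e))).2
    have h3 := h2.unique ((hasDerivAt_const (0 : ℝ) (0 : ℂ)).congr_of_eventuallyEq h1)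
    have h4 : ∀ v, x 0 (.inl v) = 0 := fun v => by rw [hx0]; rfl
    have h5 : x 0 (.inr e) = B e := by rw [hx0]; rfl
    have h6 : θ 0 e = G.phase lam e := by rw [hθ0]
    simp only [Pi.mul_apply, Pi.neg_apply, h4, h5, h6, hθ'0, h.sin_eq] at h3
    simp only [hy, hz]
    linear_combination h3
  -- Since `η` is real, `conj B · η` is the jump of `conj y` along the edge by `hBη`; Green's
  -- identity tested with `conj y` converts the sum into the flux through the leads.
  have hflux : ∑ e, conj (B e) * y (.inr e) * η e =
      Complex.I * ((∑ j, ‖y (.inl (G.base j))‖ ^ 2 : ℝ) : ℂ) := by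
    have h1 := hpair fun v => conj (y (.inl v))
    have h2 : ∑ j, conj (y (.inl (G.base j))) * y (.inl (G.base j)) =
        ((∑ j, ‖y (.inl (G.base j))‖ ^ 2 : ℝ) : ℂ) := by
      rw [Complex.ofReal_sum]
      exact Finset.sum_congr rfl fun j _ => by
        rw [← Complex.normSq_eq_conj_mul_self, Complex.normSq_eq_norm_sq]
    rw [← h2, ← h1]
    refine Finset.sum_congr rfl fun e _ => ?_
    have h3 := congrArg conj (hBη e)
    simp only [map_mul, map_sub, hηc, hσc] at h3
    linear_combination y (.inr e) * h3
  -- The left null vector has no vertex components, so only the continuity conditions are needed to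
  -- second order. The pairing removes `z` and leaves `2i ∑ |y|² + 2 Λ₂ + (real) = 0`.
  have him : Λ₂.im = -∑ j, ‖y (.inl (G.base j))‖ ^ 2 := by
    have h1 : ∑ e, (conj (B e) * (2 * y (.inr e) * η e +
        B e * ((G.len e : ℂ) * (Λ₂ - 2 * Λ₁ * c e + lam * b e)))) = 0 := by
      rw [← h.sum_vertex_conj fun v => z (.inl v)]
      refine Finset.sum_congr rfl fun e _ => ?_
      linear_combination conj (B e) * (Complex.cos (G.phase lam e) * hE2 e -
        (z (.inl (G.src e)) + 2 * y (.inr e) * η e +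
          B e * ((G.len e : ℂ) * (Λ₂ - 2 * Λ₁ * c e + lam * b e))) * hσ e)
    have hΛ₁re : Λ₁ = (Λ₁.re : ℂ) := (Complex.conj_eq_iff_re.1
      (Complex.conj_eq_iff_im.2 hΛ₁im)).symm
    have h2 : 2 * (∑ e, conj (B e) * y (.inr e) * η e) + Λ₂ * 2 +
        ((∑ e, Complex.normSq (B e) * G.len e * (-2 * Λ₁.re * c e + lam * b e) : ℝ) : ℂ) = 0 := by
      rw [← h1, Finset.mul_sum, show Λ₂ * 2 = Λ₂ * ∑ e, (G.len e : ℂ) * (conj (B e) * B e) by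
        rw [h.norm_eq], Finset.mul_sum, Complex.ofReal_sum, ← Finset.sum_add_distrib,
        ← Finset.sum_add_distrib]
      refine Finset.sum_congr rfl fun e _ => ?_
      push_cast
      rw [← hBB, ← hΛ₁re]
      ring
    rw [hflux] at h2
    have h3 := congrArg Complex.im h2
    simp only [Complex.add_im, Complex.ofReal_im, Complex.mul_im, Complex.I_re, Complex.I_im,
      Complex.ofReal_re] at h3
    simp at h3
    linarith
  rw [him]
  congr 1
  refine Finset.sum_congr rfl fun k _ => ?_
  have hC : ∀ e, X k (.inl (G.tgt e)) = X k (.inl (G.src e)) * Complex.cos (G.phase lam e) :=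
    fun e => by
      have h1 := congrFun (hX k) (.inr e)
      simp only [secular_inr, h.sin_eq, incoming, Sum.elim_inr, Pi.zero_apply] at h1
      linear_combination -h1
  -- `X k` is continuous with unperturbed phases, so it has no jumps and Green's identity leaves
  -- only the lead terms.
  have horth : ∑ j, conj (X k (.inl (G.base j))) * y (.inl (G.base j)) = 0 := by
    have h1 := hpair fun v => conj (X k (.inl v))
    rw [Finset.sum_eq_zero fun e _ => ?_] at h1
    · exact (mul_eq_zero.1 h1.symm).resolve_left Complex.I_ne_zero
    · rw [hC, map_mul, hσc]
      linear_combination (y (.inr e) * conj (X k (.inl (G.src e)))) * hσ e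
  -- The vertex conditions of `X k` are tested with `conj y`: the incoming wave picks out `y(base
  -- k)` with the factor `2i`, and the outgoing lead terms drop out by `horth`.
  have hβ : ∑ e, conj (X k (.inr e)) * (B e * η e) = 2 * Complex.I * y (.inl (G.base k)) := by
    have h1 := G.sum_mul_secular_inl (G.phase lam) (X k) (fun v => conj (y (.inl v)))
    rw [hX] at h1
    simp only [incoming, Sum.elim_inl, mul_ite, mul_zero, Finset.sum_ite_eq, Finset.mem_univ,
      if_true, h.sin_eq, neg_zero, zero_add] at h1
    have h2 := congrArg conj h1
    simp only [map_mul, map_sub, map_sum, map_neg, Complex.conj_conj, Complex.conj_I, hσc,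
      map_ofNat] at h2
    have h3 : ∑ j, y (.inl (G.base j)) * conj (X k (.inl (G.base j))) = 0 := by
      rw [← horth]
      exact Finset.sum_congr rfl fun j _ => mul_comm _ _
    rw [h3] at h2
    have h4 : ∑ e, conj (X k (.inr e)) * (B e * η e) = ∑ e, (y (.inl (G.tgt e)) *
        (conj (X k (.inr e)) * Complex.cos (G.phase lam e)) -
          y (.inl (G.src e)) * conj (X k (.inr e))) :=
      Finset.sum_congr rfl fun e _ => by rw [hBη]; ring
    rw [h4]
    linear_combination -h2
  -- In `η = ℓ (Λ₁ - λ c)` the part with `Λ₁` contributes nothing, because `X k` is orthogonal to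
  -- the eigenfunction.
  have hval : (lam : ℂ) * ∑ e, (c e : ℂ) * (B e * conj (X k (.inr e)) * G.len e / 2) =
      -(Complex.I * y (.inl (G.base k))) := by
    have h1 := congrArg conj (hXB k)
    simp only [map_sum, map_mul, Complex.conj_conj, Complex.conj_ofReal, map_zero] at h1
    have h2 : ∑ e, conj (X k (.inr e)) * (B e * η e) =
        Λ₁ * (∑ e, (G.len e : ℂ) * (B e * conj (X k (.inr e)))) -
        2 * ((lam : ℂ) * ∑ e, (c e : ℂ) * (B e * conj (X k (.inr e)) * G.len e / 2)) := by
      rw [Finset.mul_sum, Finset.mul_sum, Finset.mul_sum, ← Finset.sum_sub_distrib]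
      exact Finset.sum_congr rfl fun e _ => by simp only [hη]; ring
    rw [h1, hβ, mul_zero, zero_sub] at h2
    linear_combination (1 / 2) * h2
  rw [hval, norm_neg, norm_mul, Complex.norm_I, one_mul]

end IsEmbedded

end Perturbation

/-! ### The implicit function theorem and the family of resonances -/

section Continuation

variable {V L E : Type*} [Fintype V] [DecidableEq V] [Fintype L] [Fintype E]

/-- The outgoing solutions of the graph with lengths `τ e * len e` at the frequency `μ`, normalized
against the embedded eigenfunction, are the zeros of this map of `(τ, x, μ)`. -/
def outgoingMap (G : QuantumGraph V L E) (B : E → ℂ) (p : (E → ℂ) × (V ⊕ E → ℂ) × ℂ) :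
    (V ⊕ E → ℂ) × ℂ :=
  (G.secular (fun e => p.2.2 * G.len e * p.1 e) p.2.1,
    ∑ e, (G.len e : ℂ) * (conj (B e) * p.2.1 (.inr e)) - 2)

theorem contDiff_outgoingMap (G : QuantumGraph V L E) (B : E → ℂ) :
    ContDiff ℂ ω (outgoingMap G B) := by
  have hite : ∀ (p : Prop) [Decidable p] {f : (E → ℂ) × (V ⊕ E → ℂ) × ℂ → ℂ}, ContDiff ℂ ω f →
      ContDiff ℂ ω (fun x => if p then f x else 0) := by
    intro p _ f hf
    split_ifs
    · exact hf
    · exact contDiff_const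
  refine ContDiff.prodMk (contDiff_pi.2 ?_) (by fun_prop)
  rintro (v | e)
  · simp only [secular_inl]
    refine ((ContDiff.sum fun e _ => hite _ ?_).sub (ContDiff.sum fun e _ => hite _ ?_)).sub
      (contDiff_const.mul (ContDiff.sum fun j _ => hite _ ?_)) <;> fun_prop
  · simp only [secular_inr]
    fun_prop

namespace IsEmbedded

variable {G : QuantumGraph V L E} {lam : ℝ} {B : E → ℂ}

theorem outgoingMap_eq_zero (h : G.IsEmbedded lam B) :
    outgoingMap G B (1, edgeVec B, lam) = 0 := by
  have h1 := h.secular_eq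
  have h2 := h.norm_eq
  simp only [outgoingMap, Pi.one_apply, mul_one, edgeVec, Sum.elim_inr]
  rw [h2, sub_self]
  exact Prod.ext h1 rfl

theorem fderiv_outgoingMap_injective (h : G.IsEmbedded lam B) :
    Function.Injective (fderiv ℂ (outgoingMap G B) (1, edgeVec B, (lam : ℂ)) ∘L
      .inr ℂ (E → ℂ) ((V ⊕ E → ℂ) × ℂ)) := by
  rw [injective_iff_map_eq_zero]
  rintro ⟨y, ν⟩ hy
  -- A null vector of the Fréchet derivative makes the derivative along this real line vanish, and
  -- its components are the linearized system.
  have hd : HasDerivAt (fun s : ℝ => outgoingMap G B (1, edgeVec B + (s : ℂ) • y, lam + s * ν))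
      0 0 := by
    have h1 := (((contDiff_outgoingMap G B).differentiable (by simp)
      (1, edgeVec B, (lam : ℂ))).hasFDerivAt.restrictScalars ℝ)
    have h2 : HasDerivAt (fun s : ℝ => ((1 : E → ℂ), edgeVec B + (s : ℂ) • y, lam + s * ν))
        ((0 : E → ℂ), y, ν) 0 := by
      have h3 := Complex.ofRealCLM.hasDerivAt (x := 0)
      refine (hasDerivAt_const _ _).prodMk (HasDerivAt.prodMk ?_ ?_)
      · simpa using (h3.smul_const y).const_add (edgeVec B)
      · simpa using (h3.mul_const ν).const_add (lam : ℂ)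
    have h4 := HasFDerivAt.comp_hasDerivAt_of_eq (0 : ℝ) h1 h2 (by simp)
    have h5 : (fderiv ℂ (outgoingMap G B) (1, edgeVec B, (lam : ℂ))) (0, y, ν) = 0 := hy
    simpa [h5, Function.comp_def] using h4
  set x : ℝ → V ⊕ E → ℂ := fun s => edgeVec B + (s : ℂ) • y with hx
  set θ : ℝ → E → ℂ := fun s e => (lam + s * ν) * G.len e with hθ
  have hx0 : x 0 = edgeVec B := by simp [hx]
  have hθ0 : θ 0 = G.phase lam := by ext e; simp [hθ, phase]
  have hof := Complex.ofRealCLM.hasDerivAt (x := 0)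
  have hx1 : ∀ i, HasDerivAt (fun s => x s i) (y i) 0 := fun i => by
    simpa [hx] using (hof.mul_const (y i)).const_add (edgeVec B i)
  have hθ1 : ∀ e, HasDerivAt (fun s => θ s e) (ν * G.len e) 0 := fun e => by
    simpa [hθ] using ((hof.mul_const ν).const_add (lam : ℂ)).mul_const (G.len e : ℂ)
  have hsec : ∀ i, HasDerivAt (fun s => G.secular (θ s) (x s) i) 0 0 := fun i => by
    have h1 : HasDerivAt (fun s : ℝ =>
        G.secular (fun e => (lam + s * ν) * G.len e * (1 : E → ℂ) e) (x s) i) 0 0 :=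
      hasDerivAt_pi.1 hd.fst i
    simpa only [Pi.one_apply, mul_one] using h1
  have hlin := h.linearized_injective (y := y) (ν := ν)
    (fun v => (h.hasDerivAt_secular_inl hx0 hθ0 hx1 hθ1 v).unique (hsec _))
    (fun e => (h.hasDerivAt_secular_inr hx0 hθ0 hx1 hθ1 e).unique (hsec _))
    (by
      have h1 : HasDerivAt (fun s : ℝ => ∑ e, (G.len e : ℂ) * (conj (B e) * x s (.inr e)) - 2) 0 0 :=
        hd.snd
      have h2 : HasDerivAt (fun s : ℝ => ∑ e, (G.len e : ℂ) * (conj (B e) * x s (.inr e)) - 2)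
          (∑ e, (G.len e : ℂ) * (conj (B e) * y (.inr e))) 0 :=
        (HasDerivAt.fun_sum fun e _ => ((hx1 (.inr e)).const_mul _).const_mul _).sub_const _
      exact h2.unique h1)
  exact Prod.ext hlin.1 hlin.2

/-- The unknowns and the equations live in the same finite-dimensional space, so injectivity
suffices. -/
theorem isInvertible_fderiv_outgoingMap (h : G.IsEmbedded lam B) :
    (fderiv ℂ (outgoingMap G B) (1, edgeVec B, (lam : ℂ)) ∘L
      .inr ℂ (E → ℂ) ((V ⊕ E → ℂ) × ℂ)).IsInvertible :=
  ⟨(LinearEquiv.ofInjectiveEndo _ h.fderiv_outgoingMap_injective).toContinuousLinearEquiv, ContinuousLinearMap.ext fun _ => rfl⟩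

/-- The analytic continuation of the embedded eigenfunction in the edge lengths, as an outgoing
solution. -/
theorem exists_outgoing (h : G.IsEmbedded lam B) :
    ∃ (X : (E → ℂ) → V ⊕ E → ℂ) (M : (E → ℂ) → ℂ), X 1 = edgeVec B ∧ M 1 = lam ∧
      ∀ᶠ τ in 𝓝 1, ContDiffAt ℂ ω X τ ∧ ContDiffAt ℂ ω M τ ∧ M τ ≠ 0 ∧
        G.secular (fun e => M τ * G.len e * τ e) (X τ) = 0 ∧ ∃ e, X τ (.inr e) ≠ 0 := by
  have hc := (contDiff_outgoingMap G B).contDiffAt (x := (1, edgeVec B, (lam : ℂ)))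
  have hinv := h.isInvertible_fderiv_outgoingMap
  have hω : (ω : WithTop ℕ∞) ≠ 0 := by simp
  set ψ := hc.implicitFunction hω hinv with hψ
  have hψ1 : ψ 1 = (edgeVec B, (lam : ℂ)) := hc.implicitFunction_apply_self hω hinv
  have hψc : ContDiffAt ℂ ω ψ 1 := hc.contDiffAt_implicitFunction hω hinv
  have hψe : ∀ᶠ τ in 𝓝 (1 : E → ℂ), outgoingMap G B (τ, ψ τ) = 0 := by
    have := hc.eventually_apply_implicitFunction hω hinv
    rwa [h.outgoingMap_eq_zero] at this
  refine ⟨fun τ => (ψ τ).1, fun τ => (ψ τ).2, congrArg Prod.fst hψ1, congrArg Prod.snd hψ1, ?_⟩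
  have hne : ∀ᶠ τ in 𝓝 (1 : E → ℂ), (ψ τ).2 ≠ 0 := by
    refine hψc.continuousAt.snd.eventually_ne ?_
    rw [hψ1]
    exact Complex.ofReal_ne_zero.2 h.ne_zero
  filter_upwards [hψc.eventually (by simp), hψe, hne] with τ h1 h2 h3
  refine ⟨h1.fst, h1.snd, h3, congrArg Prod.fst h2, ?_⟩
  -- If all sine coefficients vanished, the normalization would read `-2 = 0`.
  by_contra! h4
  have h5 := congrArg Prod.snd h2
  simp [outgoingMap, h4] at h5

/-- `Λ` is the analytic eigenparameter evaluated along the smooth curve of length factors `τ_e =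
e^{-a_e(t)}`. -/
theorem exists_smooth_resonance [Nonempty L] [DecidableEq L] (h : G.IsEmbedded lam B)
    (hG : G.Connected) {a : E → ℝ → ℝ} {T : ℝ} (hT : 0 < T)
    (ha : ∀ m, ContDiffOn ℝ ∞ (a m) (Ioo (-T) T)) (ha0 : ∀ m, a m 0 = 0) :
    ∃ t₀ : ℝ, 0 < t₀ ∧ t₀ < T ∧ ∃ Λ : ℝ → ℂ,
      ContDiffOn ℝ ∞ Λ (Icc (-t₀) t₀) ∧ Λ 0 = lam ∧
      (∀ t ∈ Icc (-t₀) t₀, (G.deform (fun m => a m t)).IsResonance (Λ t)) ∧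
      (iteratedDeriv 2 Λ 0).im = -∑ k, ‖(lam : ℂ) * ∑ e, ((deriv (a e) 0 : ℝ) : ℂ) *
        (B e * conj (scatteringCoeff G lam B k lam (.inr e)) * G.len e / 2)‖ ^ 2 := by
  obtain ⟨X, M, hX1, hM1, hXM⟩ := h.exists_outgoing
  set τ : ℝ → E → ℂ := fun t e => ((Real.exp (-a e t) : ℝ) : ℂ) with hτ
  have hτ0 : τ 0 = 1 := by ext e; simp [hτ, ha0]
  have hac : ∀ e, ∀ t ∈ Ioo (-T) T, ContDiffAt ℝ ∞ (a e) t := fun e t ht =>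
    (ha e).contDiffAt (isOpen_Ioo.mem_nhds ht)
  have hexp : ∀ e, ∀ t ∈ Ioo (-T) T, ContDiffAt ℝ ∞ (fun t => Real.exp (-a e t)) t :=
    fun e t ht => (hac e t ht).neg.exp
  have hτe : ∀ e, ∀ t ∈ Ioo (-T) T, ContDiffAt ℝ ∞ (fun t => τ t e) t := fun e t ht =>
    Complex.ofRealCLM.contDiff.contDiffAt.comp t (hexp e t ht)
  have hτc : ∀ t ∈ Ioo (-T) T, ContDiffAt ℝ ∞ τ t := fun t ht =>
    contDiffAt_pi.2 fun e => hτe e t ht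
  have h0 : (0 : ℝ) ∈ Ioo (-T) T := by simp [hT]
  have hev : ∀ᶠ t in 𝓝 (0 : ℝ), ContDiffAt ℂ ω X (τ t) ∧ ContDiffAt ℂ ω M (τ t) ∧ M (τ t) ≠ 0 ∧
      G.secular (fun e => M (τ t) * G.len e * τ t e) (X (τ t)) = 0 ∧
        ∃ e, X (τ t) (.inr e) ≠ 0 := by
    have h1 : Tendsto τ (𝓝 0) (𝓝 1) := by
      have := (hτc 0 h0).continuousAt.tendsto
      rwa [hτ0] at this
    exact h1.eventually hXM
  obtain ⟨δ, hδ, hball⟩ := Metric.eventually_nhds_iff.1 hev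
  have hΛc : ∀ t ∈ Ioo (-T) T, ContDiffAt ℂ ω M (τ t) → ContDiffAt ℝ ∞ (fun t => M (τ t)) t :=
    fun t ht hM => ((hM.restrict_scalars ℝ).of_le (by simp)).comp t (hτc t ht)
  have hsmall : ∀ t ∈ Icc (-(min δ T / 2)) (min δ T / 2), t ∈ Ioo (-T) T ∧ dist t 0 < δ := by
    intro t ht
    have h1 := min_le_left δ T
    have h2 := min_le_right δ T
    have h3 := lt_min hδ hT
    rw [Real.dist_eq, sub_zero, abs_lt]
    exact ⟨⟨by linarith [ht.1], by linarith [ht.2]⟩, by linarith [ht.1], by linarith [ht.2]⟩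
  -- Halving keeps the closed interval inside both the open domain of `a` and the ball where the
  -- continuation exists.
  refine ⟨min δ T / 2, half_pos (lt_min hδ hT), ?_, fun t => M (τ t), ?_, ?_, ?_, ?_⟩
  · linarith [min_le_right δ T]
  · intro t ht
    exact (hΛc t (hsmall t ht).1 (hball (hsmall t ht).2).2.1).contDiffWithinAt
  · simp only [hτ0, hM1]
  · intro t ht
    obtain ⟨-, -, h1, h2, e₀, h3⟩ := hball (hsmall t ht).2
    refine isResonance_of_secular_eq_zero (G := G.deform fun m => a m t) hG h1 (x := X (τ t)) ?_ h3
    rw [← h2]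
    -- The secular map depends on the lengths only through the phases, and the deformation leaves
    -- the incidence relations unchanged.
    have h4 : (G.deform fun m => a m t).phase (M (τ t)) =
        fun e => M (τ t) * G.len e * τ t e := by
      ext e
      simp only [phase, deform, hτ]
      push_cast; ring
    rw [h4]
    rfl
  · obtain ⟨hXc, hMc, -⟩ := hev.self_of_nhds
    have h2 : (2 : WithTop ℕ∞) ≤ (∞ : WithTop ℕ∞) := ENat.LEInfty.out
    rw [iteratedDeriv_succ, iteratedDeriv_one]
    have hd : ∀ (e : E), (∀ᶠ t in 𝓝 (0 : ℝ), deriv (fun t => τ t e) t =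
        ((deriv (fun t => Real.exp (-a e t)) t : ℝ) : ℂ)) := fun e => by
      filter_upwards [isOpen_Ioo.mem_nhds h0] with t ht
      exact (((hexp e t ht).differentiableAt (by simp)).hasDerivAt.ofReal_comp).deriv
    refine h.golden_rule (x := fun t => X (τ t)) (r := fun e t => τ t e)
      (b := fun e => deriv (deriv fun t => Real.exp (-a e t)) 0) ?_ ?_ ?_ ?_ ?_ ?_ ?_ ?_ ?_
      (h.secular_scatteringCoeff h.mem_goodSet) ?_
    · have h3 := (((hXc.restrict_scalars ℝ).of_le (m := (∞ : WithTop ℕ∞)) (by simp)).comp 0 (hτc 0 h0)).of_le h2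
      exact contDiffAt_pi.1 h3
    · exact (hΛc 0 h0 hMc).of_le h2
    · exact fun e => (hτe e 0 h0).of_le h2
    · simp only [hτ0, hX1]
    · simp only [hτ0, hM1]
    · intro e; rw [hτ0]; rfl
    · intro e
      have h3 : HasDerivAt (fun t => Real.exp (-a e t)) _ 0 :=
        ((hac e 0 h0).differentiableAt (by simp)).hasDerivAt.neg.exp
      rw [(hd e).self_of_nhds, h3.deriv]
      simp [ha0]
    · intro e
      rw [Filter.EventuallyEq.deriv_eq (hd e)]
      refine HasDerivAt.deriv (HasDerivAt.ofReal_comp (DifferentiableAt.hasDerivAt ?_))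
      exact (((hexp e 0 h0).of_le h2).derivWithin (m := 1) (by norm_num)).differentiableAt (by norm_num)
    · exact hev.mono fun t ht => ht.2.2.2.1
    · intro k
      rw [← h.slope_self]
      exact h.slope_scatteringCoeff h.mem_goodSet k

end IsEmbedded

end Continuation

end QuantumGraph

end

theorem mainTheorem8 {V L E : Type*} [Fintype V] [DecidableEq V] [Fintype L] [DecidableEq L]
    [Nonempty L] [Fintype E] (G : QuantumGraph V L E) (hG : G.Connected)
    (lam : ℝ) (hlam : lam ≠ 0) (hsimple : G.IsSimpleEigenvalue ((lam : ℂ) ^ 2))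
    (hlen : ∀ m : E, ∃ n : ℤ, lam * G.len m = Real.pi * n)
    (u : L ⊕ E → ℝ → ℂ) (hu : G.IsEigenvector ((lam : ℂ) ^ 2) u)
    (hnorm : ∑ m, ∫ x in G.dom m, ‖u m x‖ ^ 2 = 1)
    (a : E → ℝ → ℝ) (T : ℝ) (hT : 0 < T)
    (ha : ∀ m, ContDiffOn ℝ ∞ (a m) (Ioo (-T) T)) (ha0 : ∀ m, a m 0 = 0) :
    -- the generalized eigenfunctions at the embedded eigenvalue exist
    (∃ e : L → L ⊕ E → ℝ → ℂ, ∀ k, G.IsGeneralizedEigenfunction k lam (e k)) ∧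
    -- the boundary terms vanish
    (∀ k e, G.IsGeneralizedEigenfunction k lam e →
      G.boundaryTerm (rateAtZero a) u e = 0) ∧
    -- there is a smooth family of resonances, and it obeys the Fermi golden rule
    ∃ t₀ : ℝ, 0 < t₀ ∧ t₀ < T ∧ ∃ Λ : ℝ → ℂ,
      ContDiffOn ℝ ∞ Λ (Icc (-t₀) t₀) ∧ Λ 0 = lam ∧
      (∀ t ∈ Icc (-t₀) t₀, (G.deform (fun m => a m t)).IsResonance (Λ t)) ∧
      ∀ e : L → L ⊕ E → ℝ → ℂ, (∀ k, G.IsGeneralizedEigenfunction k lam (e k)) →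
        (iteratedDeriv 2 Λ 0).im =
          -∑ k, ‖(lam : ℂ) * G.weightedInner (rateAtZero a) u (e k)‖ ^ 2 := by
  obtain ⟨B, h, huB⟩ := QuantumGraph.exists_isEmbedded hG hlam hsimple hlen hu hnorm
  refine ⟨⟨_, fun k => (h.exists_isGeneralizedEigenfunction k).choose_spec⟩,
    fun k e he => h.boundaryTerm_eq_zero huB he _, ?_⟩
  obtain ⟨t₀, h1, h2, Λ, h3, h4, h5, h6⟩ := h.exists_smooth_resonance hG hT ha ha0
  refine ⟨t₀, h1, h2, Λ, h3, h4, h5, fun e he => ?_⟩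
  rw [h6]
  congr 1
  refine Finset.sum_congr rfl fun k _ => ?_
  rw [rateAtZero, h.weightedInner_eq huB (he k)]
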